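/- Let $n\ge 0$ be an integer, $\beta>0$ and $g,g_0,g_1,g_0',g_1'\ge 0$ real numbers. Write $(a;q)_\infty=\prod_{m=0}^\infty(1-aq^m)$ and $(a_1,\dots,a_r;q)_\infty=\prod_{s=1}^r(a_s;q)_\infty$, and set $$d_a^+(z)=\frac{(e^{iz};e^{-\beta})_\infty}{(e^{-\beta g}e^{iz};e^{-\beta})_\infty},\qquad d_b^+(z)=\frac{(e^{2iz};e^{-\beta})_\infty}{(e^{-\beta g_0}e^{iz},\,-e^{-\beta g_1}e^{iz},\,e^{-\beta(g_0'+1/2)}e^{iz},\,-e^{-\beta(g_1'+1/2)}e^{iz};\,e^{-\beta})_\infty},$$ $d_c(z)=d_c^+(z)\,d_c^+(-z)$ for $c=a,b$, and, for almost every $x\in\mathbb R^n$, $$\Delta(x)=\prod_{1\le j<k\le n}d_a(x_j+x_k)\,d_a(x_j-x_k)\prod_{1\le j\le n}d_b(x_j),\qquad \langle f,h\rangle_\Delta=\int_{(-\pi,\pi]^n}f\,\overline{h}\,\Delta\,dx .$$ Let $\mathcal P^+=\{\lambda\in\mathbb Z^n:\lambda_1\ge\dots\ge\lambda_n\ge 0\}$,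 and write $\lambda'\le\lambda$ if $\sum_{j\le k}\lambda'_j\le\sum_{j\le k}\lambda_j$ for $k=1,\dots,n$, and $\lambda'<\lambda$ if moreover $\lambda'\ne\lambda$. For $\lambda\in\mathcal P^+$ let $m_\lambda(x)=\sum_{\mu\in W\lambda}e^{i\sum_j\mu_jx_j}$, where $W\lambda$ is the orbit of $\lambda$ under permutations and sign changes of the coordinates. The Koornwinder polynomial $p_\lambda$ is the function with $p_\lambda-m_\lambda\in\operatorname{span}_{\mathbb C}\{m_{\lambda'}:\lambda'\in\mathcal P^+,\ \lambda'<\lambda\}$ and $\langle p_\lambda,m_{\lambda'}\rangle_\Delta=0$ for all $\lambda'\in\mathcal P^+$ with $\lambda'<\lambda$. Then for every $\lambda\in\mathcal P^+$ these conditions determine exactly one function $p_\lambda$, and for all $\lambda,\lambda'\in\mathcal P^+$ with $\lambda\ne\lambda'$ the integral defining $\langle p_\lambda,p_{\lambda'}\rangle_\Delta$ converges absolutely and $$\langle p_\lambda,p_{\lambda'}\rangle_\Delta=0 .$$ -/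

import Mathlib

open scoped BigOperators

noncomputable section

namespace Koornwinder

/-- The scale `β` and the coupling constants `g, g₀, g₁, g₀', g₁'`. -/
structure Params where
  β : ℝ
  g : ℝ
  g₀ : ℝ
  g₁ : ℝ
  g₀' : ℝ
  g₁' : ℝ

/-! ### Weights -/

/-- The dominant weights: `l₁ ≥ l₂ ≥ ⋯ ≥ lₙ ≥ 0`. -/
def IsDominant {n : ℕ} (l : Fin n → ℤ) : Prop :=
  Antitone l ∧ ∀ j, 0 ≤ l j

/-- The partial order on weights: every partial sum of `l'` is at most that of `l`. -/
def WeightLE {n : ℕ} (l' l : Fin n → ℤ) : Prop :=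
  ∀ k : Fin n, ∑ j ∈ Finset.Iic k, l' j ≤ ∑ j ∈ Finset.Iic k, l j

/-- The strict part of the partial order. -/
def WeightLT {n : ℕ} (l' l : Fin n → ℤ) : Prop :=
  WeightLE l' l ∧ l' ≠ l

/-- The orbit of a weight under permutations and sign flips of the coordinates. -/
def weylOrbit {n : ℕ} (l : Fin n → ℤ) : Finset (Fin n → ℤ) :=
  Finset.univ.image fun w : Equiv.Perm (Fin n) × (Fin n → ℤˣ) =>
    fun j => (w.2 j : ℤ) * l (w.1 j)

/-! ### Trigonometric polynomials, as `2π`-periodic functions of `n` real variables -/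

/-- The Fourier basis function `x ↦ exp (i ∑ⱼ lⱼ xⱼ)`. -/
def fourierExp {n : ℕ} (l : Fin n → ℤ) (x : Fin n → ℝ) : ℂ :=
  Complex.exp (Complex.I * ∑ j, (l j : ℂ) * (x j : ℂ))

/-- The monomial symmetric function, the sum of `fourierExp` over the orbit of `l`
(each element of the orbit occurring once). -/
def monomial {n : ℕ} (l : Fin n → ℤ) (x : Fin n → ℝ) : ℂ :=
  ∑ l' ∈ weylOrbit l, fourierExp l' x

/-- The span of the monomials `m_{l'}` with `l'` dominant and `l' < l`. -/
def lowerSpan {n : ℕ} (l : Fin n → ℤ) : Submodule ℂ ((Fin n → ℝ) → ℂ) :=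
  Submodule.span ℂ (monomial '' {l' : Fin n → ℤ | IsDominant l' ∧ WeightLT l' l})

/-! ### The weight function -/

/-- The `q`-shifted factorial `(a; q)_∞ = ∏_{m ≥ 0} (1 - a q^m)`. -/
def qFactorial (a q : ℂ) : ℂ :=
  ∏' m : ℕ, (1 - a * q ^ m)

/-- The infinite product converges for `|q| < 1`. -/
theorem multipliable_qFactorial (a q : ℂ) (hq : ‖q‖ < 1) :
    Multipliable fun m : ℕ => (1 - a * q ^ m) := by
  have h : Summable fun m : ℕ => ‖-(a * q ^ m)‖ := by
    simp only [norm_neg, norm_mul, norm_pow]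
    exact (summable_geometric_of_lt_one (norm_nonneg q) hq).mul_left _
  simpa [sub_eq_add_neg] using multipliable_one_add_of_summable h

/-- The real power `exp (-β s) = q^s` of the base `q = exp (-β)`, as a complex number. -/
def Params.qpow (P : Params) (s : ℝ) : ℂ :=
  (Real.exp (-P.β * s) : ℂ)

/-- `d_a⁺(z)`. -/
def dAPlus (P : Params) (z : ℝ) : ℂ :=
  let e : ℂ := Complex.exp (Complex.I * z)
  let q : ℂ := P.qpow 1
  qFactorial e q / qFactorial (P.qpow P.g * e) q

/-- `d_b⁺(z)`. -/
def dBPlus (P : Params) (z : ℝ) : ℂ :=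
  let e : ℂ := Complex.exp (Complex.I * z)
  let q : ℂ := P.qpow 1
  qFactorial (e ^ 2) q /
    (qFactorial (P.qpow P.g₀ * e) q * qFactorial (-P.qpow P.g₁ * e) q *
      qFactorial (P.qpow (P.g₀' + 1 / 2) * e) q *
      qFactorial (-P.qpow (P.g₁' + 1 / 2) * e) q)

/-- `d_a(z) = d_a⁺(z) d_a⁺(-z)`. -/
def dA (P : Params) (z : ℝ) : ℂ := dAPlus P z * dAPlus P (-z)

/-- `d_b(z) = d_b⁺(z) d_b⁺(-z)`. -/
def dB (P : Params) (z : ℝ) : ℂ := dBPlus P z * dBPlus P (-z)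

/-- The weight function `Δ`. -/
def weight (P : Params) {n : ℕ} (x : Fin n → ℝ) : ℂ :=
  (∏ j : Fin n, ∏ k ∈ Finset.Ioi j, dA P (x j + x k) * dA P (x j - x k)) *
    ∏ j : Fin n, dB P (x j)

/-- The cube `(-π, π]ⁿ`, a fundamental domain for the torus `ℝⁿ / 2πℤⁿ`. -/
def torusBox (n : ℕ) : Set (Fin n → ℝ) :=
  Set.univ.pi fun _ => Set.Ioc (-Real.pi) Real.pi

/-- The integrand `f ḡ Δ` of the inner product. -/
def pairing (P : Params) {n : ℕ} (f h : (Fin n → ℝ) → ℂ) (x : Fin n → ℝ) : ℂ :=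
  f x * (starRingEnd ℂ) (h x) * weight P x

/-- The inner product `⟨f, h⟩_Δ`, the integral of `f h̄ Δ` over the torus. -/
def innerProd (P : Params) {n : ℕ} (f h : (Fin n → ℝ) → ℂ) : ℂ :=
  ∫ x in torusBox n, pairing P f h x

/-! ### Koornwinder polynomials -/

/-- `p` is the Koornwinder polynomial with label `l`: it equals `m_l` plus a linear combination
of the `m_{l'}` with `l'` dominant, `l' < l`, and it is orthogonal to all those `m_{l'}`. -/
def IsKoornwinderPolynomial (P : Params) {n : ℕ} (l : Fin n → ℤ)
    (p : (Fin n → ℝ) → ℂ) : Prop :=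
  p - monomial l ∈ lowerSpan l ∧
    ∀ l' : Fin n → ℤ, IsDominant l' → WeightLT l' l → innerProd P p (monomial l') = 0

end Koornwinder

end

/-! Uniqueness and existence are linear algebra: the Gram matrix of the monomials below a weight is
invertible, because the weight is bounded and strictly positive off a null set. The real point is
orthogonality of p_λ and p_λ' for weights that are incomparable in the partial order. It comes from
Koornwinder's difference operator D = ∑_j [V_j(z)(T_j - 1) + V_j(z with z_j inverted)(T_j⁻¹ - 1)],
where z_j = exp(i x_j) and T_j sends z_j to q z_j. Two facts carry the argument.

Triangularity (`exists_koornwinderOp_eq_lower`): D m_λ is E_λ m_λ plus lower terms. In the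
coordinates x_j = z_j + z_j⁻¹ all poles of D m_λ cancel: what is left after pairing the shift with
its inverse is a Lagrange sum ∑_j F(x_j)/∏_{k≠j}(x_j - x_k), which is polynomial. The exponents and
the leading coefficient are then read off from growth along curves z_j = s^{c_j} w_j with c positive
and strictly decreasing; such c detect the partial order.

Symmetry (`bilinearIntegral_koornwinderOp_symm`): V_j Δ, as a function of z_j, is analytic on 1 ≤
|z_j| ≤ q⁻¹ and invariant under z_j ↦ (q z_j)⁻¹. Moving the contour from the inner to the outer
circle exchanges the shifted and the unshifted factor of the integrand.

Hence p_λ is an eigenvector of D, and eigenvectors with distinct eigenvalues are orthogonal. This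
needs g, g₀, g₁ > 0 (no poles on the torus) and E_λ ≠ E_λ'. Both can be arranged for a given pair of
weights by an arbitrarily small increase of g, g₀, g₁ (`exists_regular_approximation`). The weights
are bounded uniformly in the couplings at fixed β, so by dominated convergence the Gram matrices,
hence the coefficients of p_λ, converge, and orthogonality passes to the limit
(`IsKoornwinderCoeffs.gramForm_eq_zero_of_ne`). -/

namespace Koornwinder

/-! ### Weight function, orbit sums, and polynomiality of the difference operator. -/

open Filter Topology Complex

/-! ### The infinite product `(a; q)_∞` -/

theorem summable_norm_qFactorial {q : ℂ} (hq : ‖q‖ < 1) (a : ℂ) :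
    Summable fun m : ℕ => ‖-(a * q ^ m)‖ := by
  simp only [norm_neg, norm_mul, norm_pow]
  exact (summable_geometric_of_lt_one (norm_nonneg q) hq).mul_left _

/-- The product converges locally uniformly in `a`, with a geometric majorant on each ball.
Analyticity in `a` is what later permits the contour shift. -/
theorem differentiable_qFactorial {q : ℂ} (hq : ‖q‖ < 1) :
    Differentiable ℂ fun a => qFactorial a q := by
  intro a
  have hu : Summable fun m : ℕ => (‖a‖ + 1) * ‖q‖ ^ m :=
    (summable_geometric_of_lt_one (norm_nonneg q) hq).mul_left _
  have h := Summable.hasProdLocallyUniformlyOn_nat_one_add (f := fun (m : ℕ) (a : ℂ) => -(a * q ^ m))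
    (Metric.isOpen_ball (x := (0 : ℂ)) (ε := ‖a‖ + 1)) hu
    (.of_forall fun m b hb => by
      rw [norm_neg, norm_mul, norm_pow]
      have : ‖b‖ ≤ ‖a‖ + 1 := by simpa using (Metric.mem_ball.1 hb).le
      gcongr) (fun m => by fun_prop)
  have hd := h.differentiableOn
    (.of_forall fun _ => by
      simpa [Finset.prod_fn] using DifferentiableOn.finsetProd (fun _ _ => by fun_prop))
    Metric.isOpen_ball
  have := hd.differentiableAt (Metric.isOpen_ball.mem_nhds (by simp : a ∈ Metric.ball 0 (‖a‖ + 1)))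
  simpa only [qFactorial, sub_eq_add_neg] using this

theorem continuous_qFactorial {q : ℂ} (hq : ‖q‖ < 1) : Continuous fun a => qFactorial a q :=
  (differentiable_qFactorial hq).continuous

theorem qFactorial_ne_zero_of_norm_lt {q a : ℂ} (hq : ‖q‖ < 1) (ha : ‖a‖ < 1) :
    qFactorial a q ≠ 0 := by
  have := tprod_one_add_ne_zero_of_summable (f := fun m : ℕ => -(a * q ^ m)) ?_
    (summable_norm_qFactorial hq a)
  · simpa only [qFactorial, sub_eq_add_neg] using this
  · intro m h
    have h1 : a * q ^ m = 1 := by linear_combination -h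
    have h2 : ‖a * q ^ m‖ < 1 := by
      rw [norm_mul, norm_pow]
      exact mul_lt_one_of_nonneg_of_lt_one_left (norm_nonneg _) ha
        (pow_le_one₀ (norm_nonneg _) hq.le)
    rw [h1] at h2
    simp at h2

/-- This functional equation is used in two ways: it isolates the only factor that can vanish on the
closed unit disc, and it absorbs the coefficients of the difference operator into the weight. -/
theorem qFactorial_eq_mul {q : ℂ} (hq : ‖q‖ < 1) (a : ℂ) :
    qFactorial a q = (1 - a) * qFactorial (q * a) q := by
  unfold qFactorial
  rw [tprod_eq_zero_mul']
  · simp only [pow_zero, mul_one]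
    congr 2
    ext m
    ring
  · convert multipliable_qFactorial (q * a) q hq using 2 with m
    ring

theorem qFactorial_ne_zero {q a : ℂ} (hq : ‖q‖ < 1) (ha : ‖a‖ ≤ 1) (ha1 : a ≠ 1) :
    qFactorial a q ≠ 0 := by
  rw [qFactorial_eq_mul hq]
  refine mul_ne_zero (sub_ne_zero.2 ha1.symm) (qFactorial_ne_zero_of_norm_lt hq ?_)
  rw [norm_mul]
  exact mul_lt_one_of_nonneg_of_lt_one_left (norm_nonneg _) hq ha

theorem conj_qFactorial {q : ℂ} (hq : ‖q‖ < 1) (a : ℂ) :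
    (starRingEnd ℂ) (qFactorial a q) = qFactorial ((starRingEnd ℂ) a) ((starRingEnd ℂ) q) := by
  unfold qFactorial
  rw [Multipliable.map_tprod (multipliable_qFactorial a q hq) (starRingEnd ℂ)
    Complex.continuous_conj]
  simp

theorem exists_norm_qFactorial_le {q : ℂ} (hq : ‖q‖ < 1) :
    ∃ C : ℝ, 0 < C ∧ ∀ a : ℂ, ‖a‖ ≤ 1 → ‖qFactorial a q‖ ≤ C := by
  obtain ⟨C, hC⟩ := (isCompact_closedBall (0 : ℂ) 1).exists_bound_of_continuousOn
    (continuous_qFactorial hq).continuousOn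
  exact ⟨max C 1, by positivity, fun a ha => (hC a (by simpa using ha)).trans (le_max_left _ _)⟩

theorem exists_le_norm_qFactorial {q : ℂ} (hq : ‖q‖ < 1) {r : ℝ} (hr : r < 1) :
    ∃ c : ℝ, 0 < c ∧ ∀ a : ℂ, ‖a‖ ≤ r → c ≤ ‖qFactorial a q‖ := by
  rcases lt_or_ge r 0 with h0 | h0
  · exact ⟨1, one_pos, fun a ha => absurd (norm_nonneg a) (by linarith)⟩
  obtain ⟨a, ha, hmin⟩ := (isCompact_closedBall (0 : ℂ) r).exists_isMinOn
    ⟨0, by simpa using h0⟩ (continuous_qFactorial hq).norm.continuousOn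
  refine ⟨‖qFactorial a q‖, norm_pos_iff.2 (qFactorial_ne_zero_of_norm_lt hq ?_), fun b hb =>
    hmin (by simpa using hb)⟩
  exact lt_of_le_of_lt (by simpa using ha) hr

/-! ### The parameters -/

/-- The base `q = exp (-β)`. -/
noncomputable def Params.q (P : Params) : ℂ := P.qpow 1

/-- The parameter `t = q ^ g`. -/
noncomputable def Params.t (P : Params) : ℂ := P.qpow P.g

/-- The four parameters of the one-particle weight. -/
noncomputable def Params.coef (P : Params) : Fin 4 → ℂ :=
  ![P.qpow P.g₀, -P.qpow P.g₁, P.qpow (P.g₀' + 1 / 2), -P.qpow (P.g₁' + 1 / 2)]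

/-- The hypotheses on the parameters. -/
structure Params.Nonneg (P : Params) : Prop where
  β : 0 < P.β
  g : 0 ≤ P.g
  g₀ : 0 ≤ P.g₀
  g₁ : 0 ≤ P.g₁
  g₀' : 0 ≤ P.g₀'
  g₁' : 0 ≤ P.g₁'

/-- Parameters for which the weight function has no singularities. -/
structure Params.Regular (P : Params) : Prop extends P.Nonneg where
  g_pos : 0 < P.g
  g₀_pos : 0 < P.g₀
  g₁_pos : 0 < P.g₁

theorem norm_qpow (P : Params) (s : ℝ) : ‖P.qpow s‖ = Real.exp (-P.β * s) := by
  rw [Params.qpow, Complex.norm_real, Real.norm_eq_abs, abs_of_pos (Real.exp_pos _)]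

theorem qpow_add (P : Params) (s r : ℝ) : P.qpow (s + r) = P.qpow s * P.qpow r := by
  unfold Params.qpow
  rw [mul_add, Real.exp_add]
  push_cast
  rfl

theorem qpow_ne_zero (P : Params) (s : ℝ) : P.qpow s ≠ 0 :=
  norm_ne_zero_iff.1 (by rw [norm_qpow]; positivity)

theorem conj_qpow (P : Params) (s : ℝ) : (starRingEnd ℂ) (P.qpow s) = P.qpow s :=
  Complex.conj_ofReal _

theorem norm_qpow_le_one {P : Params} (hβ : 0 < P.β) {s : ℝ} (hs : 0 ≤ s) : ‖P.qpow s‖ ≤ 1 := by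
  rw [norm_qpow, Real.exp_le_one_iff]
  nlinarith

theorem norm_qpow_lt_one {P : Params} (hβ : 0 < P.β) {s : ℝ} (hs : 0 < s) : ‖P.qpow s‖ < 1 := by
  rw [norm_qpow, Real.exp_lt_one_iff]
  nlinarith

theorem norm_q_lt_one {P : Params} (hβ : 0 < P.β) : ‖P.q‖ < 1 := norm_qpow_lt_one hβ one_pos

theorem q_ne_zero (P : Params) : P.q ≠ 0 := qpow_ne_zero _ _

theorem t_ne_zero (P : Params) : P.t ≠ 0 := qpow_ne_zero _ _

theorem Params.Regular.norm_t_lt_one {P : Params} (hP : P.Regular) : ‖P.t‖ < 1 :=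
  norm_qpow_lt_one hP.β hP.g_pos

theorem Params.Nonneg.norm_coef_le_one {P : Params} (hP : P.Nonneg) (i : Fin 4) :
    ‖P.coef i‖ ≤ 1 := by
  have h0 := norm_qpow_le_one hP.β hP.g₀
  have h1 := norm_qpow_le_one hP.β hP.g₁
  have h2 := norm_qpow_le_one hP.β (s := P.g₀' + 1 / 2) (by linarith [hP.g₀'])
  have h3 := norm_qpow_le_one hP.β (s := P.g₁' + 1 / 2) (by linarith [hP.g₁'])
  fin_cases i <;> simpa [Params.coef, ← one_div] using ‹_›

theorem Params.Regular.norm_coef_lt_one {P : Params} (hP : P.Regular) (i : Fin 4) :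
    ‖P.coef i‖ < 1 := by
  have h0 := norm_qpow_lt_one hP.β hP.g₀_pos
  have h1 := norm_qpow_lt_one hP.β hP.g₁_pos
  have h2 := norm_qpow_lt_one hP.β (s := P.g₀' + 1 / 2) (by linarith [hP.g₀'])
  have h3 := norm_qpow_lt_one hP.β (s := P.g₁' + 1 / 2) (by linarith [hP.g₁'])
  fin_cases i <;> simpa [Params.coef, ← one_div] using ‹_›

/-! ### The factors of the weight function in exponential coordinates -/

theorem exp_I_mul_neg (x : ℝ) : exp (I * ((-x : ℝ) : ℂ)) = (exp (I * x))⁻¹ := by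
  rw [← Complex.exp_neg]
  push_cast
  ring_nf

theorem norm_exp_I_mul (x : ℝ) : ‖exp (I * x)‖ = 1 := by
  rw [mul_comm, Complex.norm_exp_ofReal_mul_I]

theorem conj_exp_I_mul (x : ℝ) : (starRingEnd ℂ) (exp (I * x)) = exp (I * ((-x : ℝ) : ℂ)) := by
  rw [← Complex.exp_conj]
  simp

theorem dAPlus_eq (P : Params) (x : ℝ) :
    dAPlus P x = qFactorial (exp (I * x)) P.q / qFactorial (P.t * exp (I * x)) P.q := rfl

theorem dBPlus_eq (P : Params) (x : ℝ) :
    dBPlus P x = qFactorial (exp (I * x) ^ 2) P.q /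
      ∏ i, qFactorial (P.coef i * exp (I * x)) P.q := by
  rw [Fin.prod_univ_four]
  rfl

/-- The parameters are real, so on the torus `x ↦ -x` acts as complex conjugation. Hence `dA` is a
squared modulus and the weight is nonnegative. -/
theorem dAPlus_neg (P : Params) (hβ : 0 < P.β) (x : ℝ) :
    dAPlus P (-x) = (starRingEnd ℂ) (dAPlus P x) := by
  have hq := norm_q_lt_one hβ
  rw [dAPlus_eq, dAPlus_eq, map_div₀, conj_qFactorial hq, conj_qFactorial hq, map_mul,
    conj_exp_I_mul, Params.t, Params.q, conj_qpow, conj_qpow]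

theorem conj_coef (P : Params) (i : Fin 4) : (starRingEnd ℂ) (P.coef i) = P.coef i := by
  fin_cases i <;> simp [Params.coef, conj_qpow]

theorem dBPlus_neg (P : Params) (hβ : 0 < P.β) (x : ℝ) :
    dBPlus P (-x) = (starRingEnd ℂ) (dBPlus P x) := by
  have hq := norm_q_lt_one hβ
  have hc : (starRingEnd ℂ) P.q = P.q := conj_qpow _ _
  simp only [dBPlus_eq, map_div₀, conj_qFactorial hq, map_prod, map_mul, map_pow,
    conj_exp_I_mul, conj_coef, hc]

theorem dA_eq_normSq (P : Params) (hβ : 0 < P.β) (x : ℝ) :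
    dA P x = (normSq (dAPlus P x) : ℂ) := by
  rw [dA, dAPlus_neg P hβ, Complex.mul_conj]

theorem dB_eq_normSq (P : Params) (hβ : 0 < P.β) (x : ℝ) :
    dB P x = (normSq (dBPlus P x) : ℂ) := by
  rw [dB, dBPlus_neg P hβ, Complex.mul_conj]

theorem dA_neg (P : Params) (x : ℝ) : dA P (-x) = dA P x := by
  rw [dA, dA, neg_neg, mul_comm]

theorem dB_neg (P : Params) (x : ℝ) : dB P (-x) = dB P x := by
  rw [dB, dB, neg_neg, mul_comm]

theorem mul_exp_ne_one {a : ℂ} {x : ℝ} (ha : ‖a‖ < 1) : a * exp (I * x) ≠ 1 := by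
  intro h
  have := congrArg norm h
  rw [norm_mul, norm_exp_I_mul, mul_one, norm_one] at this
  exact ha.ne this

theorem norm_mul_exp (a : ℂ) (x : ℝ) : ‖a * exp (I * x)‖ = ‖a‖ := by
  rw [norm_mul, norm_exp_I_mul, mul_one]

theorem qpow_mul_exp_ne_one {P : Params} (hβ : 0 < P.β) {s x : ℝ} (hs : 0 ≤ s)
    (hx : exp (I * x) ≠ 1) : P.qpow s * exp (I * x) ≠ 1 := by
  rcases hs.eq_or_lt with rfl | hs
  · simpa [Params.qpow] using hx
  · exact mul_exp_ne_one (norm_qpow_lt_one hβ hs)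

theorem neg_qpow_mul_exp_ne_one {P : Params} (hβ : 0 < P.β) {s x : ℝ} (hs : 0 ≤ s)
    (hx : exp (I * x) ≠ -1) : -P.qpow s * exp (I * x) ≠ 1 := by
  rcases hs.eq_or_lt with rfl | hs
  · intro h
    apply hx
    have : -exp (I * x) = 1 := by simpa [Params.qpow] using h
    linear_combination -this
  · exact mul_exp_ne_one (by rw [norm_neg]; exact norm_qpow_lt_one hβ hs)

theorem Params.Nonneg.coef_mul_exp_ne_one {P : Params} (hP : P.Nonneg) {x : ℝ}
    (hx : exp (I * x) ^ 2 ≠ 1) (i : Fin 4) : P.coef i * exp (I * x) ≠ 1 := by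
  have h1 : exp (I * x) ≠ 1 := fun h => hx (by rw [h]; norm_num)
  have h2 : exp (I * x) ≠ -1 := fun h => hx (by rw [h]; norm_num)
  have k0 := qpow_mul_exp_ne_one hP.β hP.g₀ h1
  have k1 := neg_qpow_mul_exp_ne_one hP.β hP.g₁ h2
  have k2 := qpow_mul_exp_ne_one hP.β (s := P.g₀' + 1 / 2) (by linarith [hP.g₀']) h1
  have k3 := neg_qpow_mul_exp_ne_one hP.β (s := P.g₁' + 1 / 2) (by linarith [hP.g₁']) h2
  fin_cases i
  · exact k0
  · exact k1
  · exact k2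
  · exact k3

theorem Params.Nonneg.dAPlus_ne_zero {P : Params} (hP : P.Nonneg) {x : ℝ}
    (hx : exp (I * x) ≠ 1) : dAPlus P x ≠ 0 := by
  have hq := norm_q_lt_one hP.β
  rw [dAPlus_eq]
  refine div_ne_zero (qFactorial_ne_zero hq (norm_exp_I_mul x).le hx)
    (qFactorial_ne_zero hq ?_ (qpow_mul_exp_ne_one hP.β hP.g hx))
  rw [norm_mul_exp]
  exact norm_qpow_le_one hP.β hP.g

theorem Params.Nonneg.dBPlus_ne_zero {P : Params} (hP : P.Nonneg) {x : ℝ}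
    (hx : exp (I * x) ^ 2 ≠ 1) : dBPlus P x ≠ 0 := by
  have hq := norm_q_lt_one hP.β
  rw [dBPlus_eq]
  refine div_ne_zero (qFactorial_ne_zero hq (by rw [norm_pow, norm_exp_I_mul, one_pow]) hx)
    (Finset.prod_ne_zero_iff.2 fun i _ => ?_)
  refine qFactorial_ne_zero hq ?_ (hP.coef_mul_exp_ne_one hx i)
  rw [norm_mul_exp]
  exact hP.norm_coef_le_one i

/-! ### Generic points -/

/-- A point of the torus off the singular hyperplanes. -/
def IsGeneric {n : ℕ} (x : Fin n → ℝ) : Prop :=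
  (∀ j, exp (I * x j) ^ 2 ≠ 1) ∧
    ∀ j k, j ≠ k → exp (I * ((x j + x k : ℝ) : ℂ)) ≠ 1 ∧ exp (I * ((x j - x k : ℝ) : ℂ)) ≠ 1

/-- The weight function as a real function. -/
noncomputable def realWeight (P : Params) {n : ℕ} (x : Fin n → ℝ) : ℝ :=
  (∏ j : Fin n, ∏ k ∈ Finset.Ioi j,
    normSq (dAPlus P (x j + x k)) * normSq (dAPlus P (x j - x k))) *
    ∏ j : Fin n, normSq (dBPlus P (x j))

theorem weight_eq_realWeight (P : Params) (hβ : 0 < P.β) {n : ℕ} (x : Fin n → ℝ) :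
    weight P x = (realWeight P x : ℂ) := by
  unfold weight realWeight
  push_cast
  congr 1
  · refine Finset.prod_congr rfl fun j _ => Finset.prod_congr rfl fun k _ => ?_
    rw [dA_eq_normSq P hβ, dA_eq_normSq P hβ]
  · exact Finset.prod_congr rfl fun j _ => dB_eq_normSq P hβ _

theorem realWeight_nonneg (P : Params) {n : ℕ} (x : Fin n → ℝ) : 0 ≤ realWeight P x :=
  mul_nonneg (Finset.prod_nonneg fun _ _ => Finset.prod_nonneg fun _ _ =>
    mul_nonneg (normSq_nonneg _) (normSq_nonneg _)) (Finset.prod_nonneg fun _ _ => normSq_nonneg _)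

theorem Params.Nonneg.realWeight_pos {P : Params} (hP : P.Nonneg) {n : ℕ} {x : Fin n → ℝ}
    (hx : IsGeneric x) : 0 < realWeight P x := by
  refine mul_pos (Finset.prod_pos fun j _ => Finset.prod_pos fun k hk => ?_)
    (Finset.prod_pos fun j _ => normSq_pos.2 (hP.dBPlus_ne_zero (hx.1 j)))
  have h := hx.2 j k (Finset.mem_Ioi.1 hk).ne
  exact mul_pos (normSq_pos.2 (hP.dAPlus_ne_zero h.1)) (normSq_pos.2 (hP.dAPlus_ne_zero h.2))

/-! ### Measurability and uniform bounds -/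

theorem measurable_weight (P : Params) (hβ : 0 < P.β) (n : ℕ) :
    Measurable (weight P : (Fin n → ℝ) → ℂ) := by
  have hq := norm_q_lt_one hβ
  have hqF : Measurable fun a => qFactorial a P.q := (continuous_qFactorial hq).measurable
  have hA : Measurable (dAPlus P) := by
    have : dAPlus P = fun x : ℝ =>
      qFactorial (exp (I * x)) P.q / qFactorial (P.t * exp (I * x)) P.q := rfl
    rw [this]
    exact (hqF.comp (by fun_prop)).div (hqF.comp (by fun_prop))
  have hB : Measurable (dBPlus P) := by
    rw [funext (dBPlus_eq P)]
    exact (hqF.comp (by fun_prop)).div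
      (Finset.measurable_prod _ fun i _ => hqF.comp (by fun_prop))
  have hA' : Measurable (dA P) := hA.mul (hA.comp measurable_neg)
  have hB' : Measurable (dB P) := hB.mul (hB.comp measurable_neg)
  unfold weight
  refine (Finset.measurable_prod _ fun j _ => Finset.measurable_prod _ fun k _ => ?_).mul
    (Finset.measurable_prod _ fun j _ => hB'.comp (measurable_pi_apply j))
  exact (hA'.comp ((measurable_pi_apply j).add (measurable_pi_apply k))).mul
    (hA'.comp ((measurable_pi_apply j).sub (measurable_pi_apply k)))

/-- Write 1 - z = (1 - rz) - (1 - r)z and use 1 - r ≤ |1 - rz|. The constant does not depend on r,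
so the zero of the numerator of the weight controls the denominator even as a coupling tends to 0
and r to 1. -/
theorem norm_one_sub_le_two_mul {z : ℂ} (hz : ‖z‖ = 1) {r : ℝ} (h0 : 0 ≤ r) (h1 : r ≤ 1) :
    ‖1 - z‖ ≤ 2 * ‖1 - r * z‖ := by
  have e1 : ‖((1 - r : ℝ) : ℂ)‖ = 1 - r := by
    rw [Complex.norm_real, Real.norm_eq_abs, abs_of_nonneg (by linarith)]
  have e2 : 1 - r ≤ ‖1 - r * z‖ := by
    have := norm_sub_norm_le (1 : ℂ) (r * z)
    rwa [norm_one, norm_mul, hz, mul_one, Complex.norm_real, Real.norm_eq_abs,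
      abs_of_nonneg h0] at this
  have e3 : ‖(1 - z : ℂ)‖ ≤ ‖1 - r * z‖ + ‖((1 - r : ℝ) : ℂ) * z‖ := by
    have : (1 - z : ℂ) = (1 - r * z) - ((1 - r : ℝ) : ℂ) * z := by push_cast; ring
    conv_lhs => rw [this]
    exact norm_sub_le _ _
  rw [norm_mul, hz, e1] at e3
  linarith

theorem norm_div_le_of_le_mul {a b : ℂ} {C : ℝ} (hC : 0 ≤ C) (h : ‖a‖ ≤ C * ‖b‖) :
    ‖a / b‖ ≤ C := by
  rw [norm_div]
  exact div_le_of_le_mul₀ (norm_nonneg _) hC h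

theorem norm_one_sub_le_two_mul_qpow {P : Params} (hβ : 0 < P.β) {s : ℝ} (hs : 0 ≤ s) {z : ℂ}
    (hz : ‖z‖ = 1) : ‖1 - z‖ ≤ 2 * ‖1 - P.qpow s * z‖ :=
  norm_one_sub_le_two_mul hz (Real.exp_pos _).le (Real.exp_le_one_iff.2 (by nlinarith))

/-- The base depends on `β` only. -/
theorem q_eq_of_β_eq {P Q : Params} (h : P.β = Q.β) : P.q = Q.q := by
  simp [Params.q, Params.qpow, h]

theorem exists_norm_dAPlus_le {β : ℝ} (hβ : 0 < β) :
    ∃ C : ℝ, 0 ≤ C ∧ ∀ P : Params, P.Nonneg → P.β = β → ∀ x : ℝ, ‖dAPlus P x‖ ≤ C := by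
  set q : ℂ := (⟨β, 0, 0, 0, 0, 0⟩ : Params).q
  have hq : ‖q‖ < 1 := norm_q_lt_one (P := ⟨β, 0, 0, 0, 0, 0⟩) hβ
  obtain ⟨C, hC, hCb⟩ := exists_norm_qFactorial_le hq
  -- Once the first factor is split off, the arguments in the denominator lie in the disc of radius
  -- |q|, whatever the coupling.
  obtain ⟨c, hc, hcb⟩ := exists_le_norm_qFactorial hq hq
  refine ⟨2 * (C / c), by positivity, fun P hP hPβ x => ?_⟩
  have hPq : P.q = q := q_eq_of_β_eq hPβ
  have hz := norm_exp_I_mul x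
  have ht := norm_qpow_le_one hP.β hP.g
  rw [dAPlus_eq, hPq, qFactorial_eq_mul hq (exp (I * x)), qFactorial_eq_mul hq (P.t * _),
    mul_div_mul_comm, norm_mul]
  refine mul_le_mul ?_ ?_ (norm_nonneg _) (by norm_num)
  · exact norm_div_le_of_le_mul (by norm_num) (norm_one_sub_le_two_mul_qpow hP.β hP.g hz)
  · rw [norm_div]
    refine div_le_div₀ hC.le (hCb _ ?_) hc (hcb _ ?_)
    · rw [norm_mul, hz, mul_one]; exact hq.le
    · rw [norm_mul, norm_mul, hz, mul_one]
      exact mul_le_of_le_one_right (norm_nonneg _) ht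

theorem exists_norm_dBPlus_le {β : ℝ} (hβ : 0 < β) :
    ∃ C : ℝ, 0 ≤ C ∧ ∀ P : Params, P.Nonneg → P.β = β → ∀ x : ℝ, ‖dBPlus P x‖ ≤ C := by
  set P₀ : Params := ⟨β, 0, 0, 0, 0, 0⟩
  set q : ℂ := P₀.q
  have hq : ‖q‖ < 1 := norm_q_lt_one (P := P₀) hβ
  have hr : ‖P₀.qpow (1 / 2)‖ < 1 := norm_qpow_lt_one hβ (by norm_num)
  have hqr : ‖q‖ ≤ ‖P₀.qpow (1 / 2)‖ := by
    have : q = P₀.qpow (1 / 2) * P₀.qpow (1 / 2) := by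
      rw [← qpow_add]; norm_num; rfl
    rw [this, norm_mul]
    exact mul_le_of_le_one_right (norm_nonneg _) hr.le
  obtain ⟨C, hC, hCb⟩ := exists_norm_qFactorial_le hq
  obtain ⟨c, hc, hcb⟩ := exists_le_norm_qFactorial hq hr
  refine ⟨2 * 2 * (C / (c * c * c * c)), by positivity, fun P hP hPβ x => ?_⟩
  have hPq : P.q = q := q_eq_of_β_eq hPβ
  have hhalf : P.qpow (1 / 2) = P₀.qpow (1 / 2) := by simp [Params.qpow, hPβ, P₀]
  set z := exp (I * x) with hzdef
  have hz : ‖z‖ = 1 := norm_exp_I_mul x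
  have k0 := norm_qpow_le_one hP.β hP.g₀
  have k1 := norm_qpow_le_one hP.β hP.g₁
  have k2 := norm_qpow_le_one hP.β hP.g₀'
  have k3 := norm_qpow_le_one hP.β hP.g₁'
  have b0 : c ≤ ‖qFactorial (q * (P.qpow P.g₀ * z)) q‖ := by
    refine hcb _ (le_trans ?_ hqr)
    rw [norm_mul, norm_mul, hz, mul_one]
    exact mul_le_of_le_one_right (norm_nonneg _) k0
  have b1 : c ≤ ‖qFactorial (q * (-P.qpow P.g₁ * z)) q‖ := by
    refine hcb _ (le_trans ?_ hqr)
    rw [norm_mul, norm_mul, norm_neg, hz, mul_one]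
    exact mul_le_of_le_one_right (norm_nonneg _) k1
  have b2 : c ≤ ‖qFactorial (P.qpow (P.g₀' + 1 / 2) * z) q‖ := by
    refine hcb _ ?_
    rw [norm_mul, hz, mul_one, qpow_add, norm_mul, hhalf]
    exact mul_le_of_le_one_left (norm_nonneg _) k2
  have b3 : c ≤ ‖qFactorial (-P.qpow (P.g₁' + 1 / 2) * z) q‖ := by
    refine hcb _ ?_
    rw [norm_mul, norm_neg, hz, mul_one, qpow_add, norm_mul, hhalf]
    exact mul_le_of_le_one_left (norm_nonneg _) k3
  -- The factor 1 - z² = (1 - z)(1 + z) is shared out: 1 - z compensates the parameter q^{g₀}, 1 + z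
  -- the parameter -q^{g₁}. The two remaining parameters have modulus at most q^{1/2} and need no
  -- compensation.
  have key : dBPlus P x = (1 - z) / (1 - P.qpow P.g₀ * z) *
      ((1 - -z) / (1 - P.qpow P.g₁ * -z)) *
      (qFactorial (q * z ^ 2) q / (qFactorial (q * (P.qpow P.g₀ * z)) q *
        qFactorial (q * (-P.qpow P.g₁ * z)) q * qFactorial (P.qpow (P.g₀' + 1 / 2) * z) q *
        qFactorial (-P.qpow (P.g₁' + 1 / 2) * z) q)) := by
    have e : dBPlus P x = qFactorial (z ^ 2) q / (qFactorial (P.qpow P.g₀ * z) q *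
        qFactorial (-P.qpow P.g₁ * z) q * qFactorial (P.qpow (P.g₀' + 1 / 2) * z) q *
        qFactorial (-P.qpow (P.g₁' + 1 / 2) * z) q) := by
      rw [← hPq]; rfl
    rw [e, qFactorial_eq_mul hq (z ^ 2), qFactorial_eq_mul hq (P.qpow P.g₀ * z),
      qFactorial_eq_mul hq (-P.qpow P.g₁ * z)]
    rw [div_mul_div_comm, div_mul_div_comm]
    congr 1 <;> ring
  rw [key, norm_mul, norm_mul]
  have hz' : ‖-z‖ = 1 := by rw [norm_neg, hz]
  refine mul_le_mul (mul_le_mul ?_ ?_ (norm_nonneg _) (by norm_num)) ?_ (norm_nonneg _)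
    (by norm_num)
  · exact norm_div_le_of_le_mul (by norm_num) (norm_one_sub_le_two_mul_qpow hP.β hP.g₀ hz)
  · exact norm_div_le_of_le_mul (by norm_num) (norm_one_sub_le_two_mul_qpow hP.β hP.g₁ hz')
  · rw [norm_div]
    refine div_le_div₀ hC.le (hCb _ ?_) (by positivity) ?_
    · rw [norm_mul, norm_pow, hz, one_pow, mul_one]; exact hq.le
    · rw [norm_mul, norm_mul, norm_mul]
      gcongr

theorem exists_norm_weight_le {β : ℝ} (hβ : 0 < β) (n : ℕ) :
    ∃ C : ℝ, ∀ P : Params, P.Nonneg → P.β = β → ∀ x : Fin n → ℝ, ‖weight P x‖ ≤ C := by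
  obtain ⟨A, hA, hAb⟩ := exists_norm_dAPlus_le hβ
  obtain ⟨B, hB, hBb⟩ := exists_norm_dBPlus_le hβ
  refine ⟨(∏ j : Fin n, ∏ k ∈ Finset.Ioi j, (A * A) * (A * A)) * ∏ j : Fin n, (B * B),
    fun P hP hPβ x => ?_⟩
  have hA' : ∀ y, ‖dA P y‖ ≤ A * A := fun y => by
    rw [dA, norm_mul]
    exact mul_le_mul (hAb P hP hPβ _) (hAb P hP hPβ _) (norm_nonneg _) hA
  have hB' : ∀ y, ‖dB P y‖ ≤ B * B := fun y => by
    rw [dB, norm_mul]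
    exact mul_le_mul (hBb P hP hPβ _) (hBb P hP hPβ _) (norm_nonneg _) hB
  rw [weight, norm_mul, norm_prod, norm_prod]
  refine mul_le_mul ?_ (Finset.prod_le_prod (fun _ _ => norm_nonneg _) fun _ _ => hB' _)
    (Finset.prod_nonneg fun _ _ => norm_nonneg _)
    (Finset.prod_nonneg fun _ _ => Finset.prod_nonneg fun _ _ => by positivity)
  refine Finset.prod_le_prod (fun _ _ => norm_nonneg _) fun j _ => ?_
  rw [norm_prod]
  refine Finset.prod_le_prod (fun _ _ => norm_nonneg _) fun k _ => ?_
  rw [norm_mul]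
  exact mul_le_mul (hA' _) (hA' _) (norm_nonneg _) (by positivity)

/-! ### Continuity in the parameters -/

/-- Convergence of parameters, with the scale `β` kept fixed. -/
structure ParamsTendsto (u : ℕ → Params) (P : Params) : Prop where
  β : ∀ k, (u k).β = P.β
  g : Tendsto (fun k => (u k).g) atTop (𝓝 P.g)
  g₀ : Tendsto (fun k => (u k).g₀) atTop (𝓝 P.g₀)
  g₁ : Tendsto (fun k => (u k).g₁) atTop (𝓝 P.g₁)
  g₀' : Tendsto (fun k => (u k).g₀') atTop (𝓝 P.g₀')
  g₁' : Tendsto (fun k => (u k).g₁') atTop (𝓝 P.g₁')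

theorem ParamsTendsto.qpow {u : ℕ → Params} {P : Params} (h : ParamsTendsto u P) {s : ℕ → ℝ}
    {r : ℝ} (hs : Tendsto s atTop (𝓝 r)) :
    Tendsto (fun k => (u k).qpow (s k)) atTop (𝓝 (P.qpow r)) := by
  simp only [Params.qpow, h.β]
  exact (Complex.continuous_ofReal.tendsto _).comp
    ((Real.continuous_exp.tendsto _).comp (hs.const_mul _))

theorem ParamsTendsto.coef {u : ℕ → Params} {P : Params} (h : ParamsTendsto u P) (i : Fin 4) :
    Tendsto (fun k => (u k).coef i) atTop (𝓝 (P.coef i)) := by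
  have h0 := h.qpow h.g₀
  have h1 := (h.qpow h.g₁).neg
  have h2 := h.qpow (h.g₀'.add_const (1 / 2))
  have h3 := (h.qpow (h.g₁'.add_const (1 / 2))).neg
  fin_cases i
  · exact h0
  · exact h1
  · exact h2
  · exact h3

theorem ParamsTendsto.dAPlus {u : ℕ → Params} {P : Params} (h : ParamsTendsto u P)
    (hP : P.Nonneg) {x : ℝ} (hx : exp (I * x) ≠ 1) :
    Tendsto (fun k => dAPlus (u k) x) atTop (𝓝 (dAPlus P x)) := by
  have hq := norm_q_lt_one hP.β
  have hc := continuous_qFactorial hq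
  simp only [dAPlus_eq, fun k => q_eq_of_β_eq (h.β k)]
  refine tendsto_const_nhds.div ((hc.tendsto _).comp ((h.qpow h.g).mul_const _)) ?_
  refine qFactorial_ne_zero hq ?_ (qpow_mul_exp_ne_one hP.β hP.g hx)
  rw [norm_mul_exp]
  exact norm_qpow_le_one hP.β hP.g

theorem ParamsTendsto.dBPlus {u : ℕ → Params} {P : Params} (h : ParamsTendsto u P)
    (hP : P.Nonneg) {x : ℝ} (hx : exp (I * x) ^ 2 ≠ 1) :
    Tendsto (fun k => dBPlus (u k) x) atTop (𝓝 (dBPlus P x)) := by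
  have hq := norm_q_lt_one hP.β
  have hc := continuous_qFactorial hq
  simp only [dBPlus_eq, fun k => q_eq_of_β_eq (h.β k)]
  refine tendsto_const_nhds.div
    (tendsto_finsetProd _ fun i _ => (hc.tendsto _).comp ((h.coef i).mul_const _))
    (Finset.prod_ne_zero_iff.2 fun i _ => ?_)
  refine qFactorial_ne_zero hq ?_ (hP.coef_mul_exp_ne_one hx i)
  rw [norm_mul_exp]
  exact hP.norm_coef_le_one i

/-- Convergence is claimed at generic points only: when a limiting coupling is 0, the denominators
vanish on the singular hyperplanes. -/
theorem ParamsTendsto.weight {u : ℕ → Params} {P : Params} (h : ParamsTendsto u P)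
    (hP : P.Nonneg) {n : ℕ} {x : Fin n → ℝ} (hx : IsGeneric x) :
    Tendsto (fun k => weight (u k) x) atTop (𝓝 (weight P x)) := by
  have hA : ∀ {y : ℝ}, exp (I * y) ≠ 1 → Tendsto (fun k => dA (u k) y) atTop (𝓝 (dA P y)) :=
    fun {y} hy => (h.dAPlus hP hy).mul (h.dAPlus hP (by
      rw [exp_I_mul_neg]
      exact fun h => hy (inv_eq_one.1 h)))
  have hB : ∀ {y : ℝ}, exp (I * y) ^ 2 ≠ 1 → Tendsto (fun k => dB (u k) y) atTop (𝓝 (dB P y)) :=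
    fun {y} hy => (h.dBPlus hP hy).mul (h.dBPlus hP (by
      rw [exp_I_mul_neg, inv_pow]
      exact fun h => hy (inv_eq_one.1 h)))
  refine (tendsto_finsetProd _ fun j _ => tendsto_finsetProd _ fun k hk => ?_).mul
    (tendsto_finsetProd _ fun j _ => hB (hx.1 j))
  have hjk := hx.2 j k (Finset.mem_Ioi.1 hk).ne
  exact (hA hjk.1).mul (hA hjk.2)

/-! ### The partial order on weights -/

theorem WeightLE.trans {n : ℕ} {a b c : Fin n → ℤ} (h : WeightLE a b) (h' : WeightLE b c) :
    WeightLE a c := fun k => (h k).trans (h' k)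

theorem WeightLE.antisymm {n : ℕ} {a b : Fin n → ℤ} (h : WeightLE a b) (h' : WeightLE b a) :
    a = b := by
  have key : ∀ k, ∑ j ∈ Finset.Iic k, a j = ∑ j ∈ Finset.Iic k, b j :=
    fun k => le_antisymm (h k) (h' k)
  funext k
  induction k using WellFoundedLT.induction with
  | ind k ih =>
    have := key k
    rw [← Finset.Iio_insert, Finset.sum_insert (by simp), Finset.sum_insert (by simp),
      Finset.sum_congr rfl fun j hj => ih j (Finset.mem_Iio.1 hj)] at this
    linarith

theorem WeightLT.trans_le {n : ℕ} {a b c : Fin n → ℤ} (h : WeightLT a b) (h' : WeightLE b c) :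
    WeightLT a c :=
  ⟨h.1.trans h', fun e => h.2 (h.1.antisymm (e ▸ h'))⟩

/-- The entries of a dominant weight are nonnegative, so each is bounded by a partial sum, and the
partial sums are bounded by those of `l`. -/
theorem finite_setOf_weightLT {n : ℕ} (l : Fin n → ℤ) :
    {l' : Fin n → ℤ | IsDominant l' ∧ WeightLT l' l}.Finite := by
  refine (Set.finite_Icc (0 : Fin n → ℤ) fun j => ∑ i ∈ Finset.Iic j, l i).subset ?_
  rintro l' ⟨hd, hl, -⟩
  exact ⟨fun j => hd.2 j, fun j => (Finset.single_le_sum (fun i _ => hd.2 i)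
    (Finset.mem_Iic.2 le_rfl)).trans (hl j)⟩

/-! ### The action of the hyperoctahedral group on weights -/

/-- The action of a permutation and sign flips on a weight. -/
def weylAct {n : ℕ} (w : Equiv.Perm (Fin n) × (Fin n → ℤˣ)) (l : Fin n → ℤ) : Fin n → ℤ :=
  fun j => (w.2 j : ℤ) * l (w.1 j)

theorem mem_weylOrbit {n : ℕ} {l m : Fin n → ℤ} : m ∈ weylOrbit l ↔ ∃ w, weylAct w l = m := by
  simp only [weylOrbit, Finset.mem_image, Finset.mem_univ, true_and]
  rfl

theorem weylAct_mem {n : ℕ} (w : Equiv.Perm (Fin n) × (Fin n → ℤˣ)) (l : Fin n → ℤ) :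
    weylAct w l ∈ weylOrbit l := mem_weylOrbit.2 ⟨w, rfl⟩

theorem self_mem_weylOrbit {n : ℕ} (l : Fin n → ℤ) : l ∈ weylOrbit l :=
  mem_weylOrbit.2 ⟨(1, 1), by funext j; simp [weylAct]⟩

theorem weylOrbit_subset {n : ℕ} {l m : Fin n → ℤ} (h : m ∈ weylOrbit l) :
    weylOrbit m ⊆ weylOrbit l := by
  obtain ⟨v, rfl⟩ := mem_weylOrbit.1 h
  intro k hk
  obtain ⟨w, rfl⟩ := mem_weylOrbit.1 hk
  exact mem_weylOrbit.2 ⟨(v.1 * w.1, fun j => w.2 j * v.2 (w.1 j)), by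
    funext j; simp [weylAct, mul_assoc]⟩

theorem weylOrbit_symm {n : ℕ} {l m : Fin n → ℤ} (h : m ∈ weylOrbit l) : l ∈ weylOrbit m := by
  obtain ⟨v, rfl⟩ := mem_weylOrbit.1 h
  refine mem_weylOrbit.2 ⟨(v.1⁻¹, fun j => v.2 (v.1⁻¹ j)), ?_⟩
  funext j
  simp [weylAct, ← mul_assoc, ← Units.val_mul]

theorem weylOrbit_eq {n : ℕ} {l m : Fin n → ℤ} (h : m ∈ weylOrbit l) :
    weylOrbit m = weylOrbit l :=
  (weylOrbit_subset h).antisymm (weylOrbit_subset (weylOrbit_symm h))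

theorem comp_perm_eq_of_antitone {n : ℕ} {l : Fin n → ℤ} (hl : Antitone l)
    {σ : Equiv.Perm (Fin n)} (hσ : Antitone (l ∘ σ)) : l ∘ σ = l := by
  have := Tuple.unique_monotone (f := OrderDual.toDual ∘ l) (σ := σ) (τ := 1)
    (fun i j h => hσ h) (fun i j h => hl h)
  funext j
  exact congrFun this j

theorem eq_of_mem_weylOrbit {n : ℕ} {l m : Fin n → ℤ} (hl : IsDominant l) (hm : IsDominant m)
    (h : m ∈ weylOrbit l) : m = l := by
  obtain ⟨w, rfl⟩ := mem_weylOrbit.1 h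
  have e : weylAct w l = l ∘ w.1 := by
    funext j
    have h1 := hm.2 j
    have h2 := hl.2 (w.1 j)
    simp only [weylAct, Function.comp] at h1 ⊢
    rcases Int.units_eq_one_or (w.2 j) with h | h <;> rw [h] at h1 ⊢ <;> simp at h1 ⊢
    omega
  rw [e]
  refine comp_perm_eq_of_antitone hl.1 ?_
  rw [← e]
  exact hm.1

theorem exists_dominant_mem_weylOrbit {n : ℕ} (l : Fin n → ℤ) :
    ∃ m ∈ weylOrbit l, IsDominant m := by
  set σ := Tuple.sort fun j => -|l j|
  refine ⟨weylAct (σ, fun j => if l (σ j) < 0 then -1 else 1) l, weylAct_mem _ _, ?_⟩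
  have e : weylAct (σ, fun j => if l (σ j) < 0 then -1 else 1) l = fun j => |l (σ j)| := by
    funext j
    simp only [weylAct]
    split_ifs with h
    · simp [abs_of_neg h]
    · simp [abs_of_nonneg (not_lt.1 h)]
  rw [e]
  exact ⟨fun i j h => neg_le_neg_iff.1 (Tuple.monotone_sort (fun j => -|l j|) h),
    fun j => abs_nonneg _⟩

/-- The rearrangement inequality, after making all signs positive. This makes a dominant weight the
unique point of its orbit with maximal growth along the curves used below. -/
theorem sum_mul_lt_of_mem_weylOrbit {n : ℕ} {l m : Fin n → ℤ} (hl : IsDominant l)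
    (h : m ∈ weylOrbit l) (hne : m ≠ l) {c : Fin n → ℤ} (hc : StrictAnti c) (hc0 : ∀ j, 0 < c j) :
    ∑ j, c j * m j < ∑ j, c j * l j := by
  obtain ⟨w, rfl⟩ := mem_weylOrbit.1 h
  have hmono : Monovary c l := hc.antitone.monovary hl.1
  have hle : ∀ j, c j * weylAct w l j ≤ c j * l (w.1 j) := fun j => by
    refine mul_le_mul_of_nonneg_left ?_ (hc0 j).le
    have h2 := hl.2 (w.1 j)
    simp only [weylAct]
    rcases Int.units_eq_one_or (w.2 j) with h | h <;> rw [h] <;> simp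
    omega
  have h1 : ∑ j, c j * weylAct w l j ≤ ∑ j, c j * l (w.1 j) := Finset.sum_le_sum fun j _ => hle j
  have h2 : ∑ j, c j * l (w.1 j) ≤ ∑ j, c j * l j := hmono.sum_mul_comp_perm_le_sum_mul
  -- In the equality case `l ∘ w.1` monovaries with the strictly decreasing `c`, so it is itself
  -- decreasing and equals `l`; positivity of `c` rules out effective sign changes.
  refine lt_of_le_of_ne (h1.trans h2) fun heq => hne ?_
  have e2 : ∑ j, c j * l (w.1 j) = ∑ j, c j * l j := le_antisymm h2 (heq ▸ h1)
  have e1 : ∀ j, c j * weylAct w l j = c j * l (w.1 j) := fun j =>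
    (Finset.sum_eq_sum_iff_of_le fun j _ => hle j).1 (heq.trans e2.symm) j (Finset.mem_univ j)
  have hmono' := hmono.sum_mul_comp_perm_eq_sum_mul_iff.1 e2
  have hanti : Antitone (l ∘ w.1) := by
    intro i j hij
    by_contra! hlt
    exact absurd (hc.le_iff_ge.1 (hmono' hlt)) (not_le.2 (lt_of_le_of_ne hij (by
      rintro rfl; exact lt_irrefl _ hlt)))
  funext j
  rw [mul_left_cancel₀ (hc0 j).ne' (e1 j)]
  exact congrFun (comp_perm_eq_of_antitone hl.1 hanti) j

/-! ### Laurent monomials and orbit sums -/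

/-- The Laurent monomial `z ↦ ∏ⱼ zⱼ ^ lⱼ`. -/
noncomputable def laurentMonomial {n : ℕ} (l : Fin n → ℤ) (z : Fin n → ℂ) : ℂ := ∏ j, z j ^ l j

/-- The orbit sum as a function of `n` complex variables. -/
noncomputable def orbitSum {n : ℕ} (l : Fin n → ℤ) (z : Fin n → ℂ) : ℂ :=
  ∑ m ∈ weylOrbit l, laurentMonomial m z

/-- The point `exp (i x)` of the torus. -/
noncomputable def torusExp {n : ℕ} (x : Fin n → ℝ) : Fin n → ℂ := fun j => exp (I * x j)

theorem torusExp_ne_zero {n : ℕ} (x : Fin n → ℝ) (j : Fin n) : torusExp x j ≠ 0 := exp_ne_zero _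

theorem fourierExp_eq {n : ℕ} (l : Fin n → ℤ) (x : Fin n → ℝ) :
    fourierExp l x = laurentMonomial l (torusExp x) := by
  simp only [fourierExp, laurentMonomial, torusExp, ← Complex.exp_int_mul, ← Complex.exp_sum,
    Finset.mul_sum]
  congr 1
  exact Finset.sum_congr rfl fun j _ => by ring

theorem monomial_eq {n : ℕ} (l : Fin n → ℤ) (x : Fin n → ℝ) :
    monomial l x = orbitSum l (torusExp x) :=
  Finset.sum_congr rfl fun m _ => fourierExp_eq m x

theorem continuous_fourierExp {n : ℕ} (l : Fin n → ℤ) : Continuous (fourierExp l) := by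
  unfold fourierExp
  fun_prop

theorem continuous_monomial {n : ℕ} (l : Fin n → ℤ) : Continuous (monomial l) := by
  unfold monomial
  exact continuous_finsetSum _ fun m _ => continuous_fourierExp m

/-- The action of a permutation and inversions on the variables. -/
noncomputable def weylActVar {n : ℕ} (w : Equiv.Perm (Fin n) × (Fin n → ℤˣ)) (z : Fin n → ℂ) :
    Fin n → ℂ := fun j => z (w.1 j) ^ (w.2 j : ℤ)

theorem laurentMonomial_weylActVar {n : ℕ} (w : Equiv.Perm (Fin n) × (Fin n → ℤˣ))
    (l : Fin n → ℤ) (z : Fin n → ℂ) :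
    laurentMonomial l (weylActVar w z) =
      laurentMonomial (weylAct (w.1⁻¹, fun j => w.2 (w.1⁻¹ j)) l) z := by
  simp only [laurentMonomial, weylActVar, weylAct, ← zpow_mul]
  rw [← Equiv.prod_comp w.1 (fun j => z j ^ ((w.2 (w.1⁻¹ j) : ℤ) * l (w.1⁻¹ j)))]
  simp

theorem orbitSum_weylActVar {n : ℕ} (w : Equiv.Perm (Fin n) × (Fin n → ℤˣ))
    (l : Fin n → ℤ) (z : Fin n → ℂ) : orbitSum l (weylActVar w z) = orbitSum l z := by
  unfold orbitSum
  simp only [laurentMonomial_weylActVar]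
  set w' : Equiv.Perm (Fin n) × (Fin n → ℤˣ) := (w.1⁻¹, fun j => w.2 (w.1⁻¹ j))
  refine Finset.sum_bij' (fun m _ => weylAct w' m) (fun m _ => weylAct w m)
    (fun m hm => weylOrbit_subset hm (weylAct_mem _ _))
    (fun m hm => weylOrbit_subset hm (weylAct_mem _ _)) ?_ ?_ (fun _ _ => rfl) <;>
  · intro m _
    funext j
    simp [weylAct, w', ← mul_assoc, ← Units.val_mul]

theorem orbitSum_comp_perm {n : ℕ} (σ : Equiv.Perm (Fin n)) (l : Fin n → ℤ) (z : Fin n → ℂ) :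
    orbitSum l (z ∘ σ) = orbitSum l z := by
  rw [← orbitSum_weylActVar (σ, 1) l z]
  congr 1
  funext j
  simp [weylActVar]

theorem orbitSum_update_inv {n : ℕ} (j : Fin n) (l : Fin n → ℤ) (z : Fin n → ℂ) (a : ℂ) :
    orbitSum l (Function.update z j a⁻¹) = orbitSum l (Function.update z j a) := by
  rw [← orbitSum_weylActVar (1, Function.update 1 j (-1)) l (Function.update z j a)]
  congr 1
  funext k
  rcases eq_or_ne k j with rfl | h
  · simp [weylActVar]
  · simp [weylActVar, h]

theorem orbitSum_inv {n : ℕ} (l : Fin n → ℤ) (z : Fin n → ℂ) :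
    orbitSum l (fun j => (z j)⁻¹) = orbitSum l z := by
  rw [← orbitSum_weylActVar (1, fun _ => -1) l z]
  congr 1
  funext k
  simp [weylActVar]

theorem conj_fourierExp {n : ℕ} (l : Fin n → ℤ) (x : Fin n → ℝ) :
    (starRingEnd ℂ) (fourierExp l x) = fourierExp l (-x) := by
  unfold fourierExp
  rw [← Complex.exp_conj]
  simp

theorem torusExp_neg {n : ℕ} (x : Fin n → ℝ) : torusExp (-x) = fun j => (torusExp x j)⁻¹ := by
  funext j
  exact exp_I_mul_neg (x j)

theorem conj_monomial {n : ℕ} (l : Fin n → ℤ) (x : Fin n → ℝ) :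
    (starRingEnd ℂ) (monomial l x) = monomial l x := by
  have : (starRingEnd ℂ) (monomial l x) = monomial l (-x) := by
    unfold monomial
    rw [map_sum]
    exact Finset.sum_congr rfl fun m _ => conj_fourierExp m x
  rw [this, monomial_eq, monomial_eq, torusExp_neg, orbitSum_inv]

/-! ### Linear independence -/

/-- The Fourier basis function as a character. -/
noncomputable def fourierChar {n : ℕ} (l : Fin n → ℤ) : Multiplicative (Fin n → ℝ) →* ℂ where
  toFun x := fourierExp l x.toAdd
  map_one' := by simp [fourierExp]
  map_mul' x y := by
    simp only [fourierExp, ← Complex.exp_add, toAdd_mul, Pi.add_apply, Complex.ofReal_add,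
      mul_add, Finset.sum_add_distrib]

theorem fourierChar_injective (n : ℕ) :
    Function.Injective (fourierChar : (Fin n → ℤ) → _) := by
  intro l m h
  funext j
  by_contra hne
  have hd : ((l j : ℂ) - m j) ≠ 0 := sub_ne_zero.2 (by exact_mod_cast hne)
  -- At this point the two characters differ by the factor exp(iπ) = -1.
  set x : Fin n → ℝ := Pi.single j (Real.pi / (l j - m j))
  have hx : ∀ k : Fin n → ℤ, fourierExp k x = exp (I * (k j * (Real.pi / (l j - m j)))) := by
    intro k
    unfold fourierExp
    rw [Finset.sum_eq_single j]
    · simp [x]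
    · intro i _ hi
      simp [x, Pi.single_eq_of_ne hi]
    · simp
  have h1 : fourierExp l x = fourierExp m x := DFunLike.congr_fun h (Multiplicative.ofAdd x)
  rw [hx, hx] at h1
  have h2 : exp (Real.pi * I) = 1 := by
    have : (Real.pi * I : ℂ) =
        I * (l j * (Real.pi / (l j - m j))) - I * (m j * (Real.pi / (l j - m j))) := by
      field_simp
    rw [this, Complex.exp_sub, h1, div_self (exp_ne_zero _)]
  rw [Complex.exp_pi_mul_I] at h2
  norm_num at h2

/-- Dedekind's independence of characters. -/
theorem linearIndependent_fourierExp (n : ℕ) :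
    LinearIndependent ℂ (fourierExp : (Fin n → ℤ) → (Fin n → ℝ) → ℂ) :=
  (linearIndependent_monoidHom (Multiplicative (Fin n → ℝ)) ℂ).comp fourierChar
    (fourierChar_injective n)

/-- A vanishing trigonometric polynomial has vanishing coefficients. -/
theorem eq_zero_of_sum_fourierExp_eq_zero {n : ℕ} {s : Finset (Fin n → ℤ)} {a : (Fin n → ℤ) → ℂ}
    (h : ∀ x, ∑ m ∈ s, a m * fourierExp m x = 0) {m : Fin n → ℤ} (hm : m ∈ s) : a m = 0 := by
  refine linearIndependent_iff'.1 (linearIndependent_fourierExp n) s a ?_ m hm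
  funext x
  simpa using h x

theorem pairwiseDisjoint_weylOrbit {n : ℕ} {s : Finset (Fin n → ℤ)}
    (hs : ∀ l ∈ s, IsDominant l) : (s : Set (Fin n → ℤ)).PairwiseDisjoint weylOrbit := by
  intro i hi j hj hij
  refine Finset.disjoint_left.2 fun m hmi hmj => hij ?_
  refine eq_of_mem_weylOrbit (hs j hj) (hs i hi) ?_
  rw [← weylOrbit_eq hmj, weylOrbit_eq hmi]
  exact self_mem_weylOrbit i

/-- Orbits of distinct dominant weights are disjoint, so a relation between orbit sums is a relation
between characters whose coefficient at m is the one attached to the dominant representative of m.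
-/
theorem eq_zero_of_sum_monomial_eq_zero {n : ℕ} {s : Finset (Fin n → ℤ)} {a : (Fin n → ℤ) → ℂ}
    (hs : ∀ l ∈ s, IsDominant l) (h : ∀ x, ∑ l ∈ s, a l * monomial l x = 0) {l : Fin n → ℤ}
    (hl : l ∈ s) : a l = 0 := by
  have hdisj := pairwiseDisjoint_weylOrbit hs
  choose d hd hdd using fun m : Fin n → ℤ => exists_dominant_mem_weylOrbit m
  have hd' : ∀ i ∈ s, ∀ m ∈ weylOrbit i, d m = i := fun i hi m hm =>
    eq_of_mem_weylOrbit (hs i hi) (hdd m) (weylOrbit_eq hm ▸ hd m)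
  have key := eq_zero_of_sum_fourierExp_eq_zero (s := s.biUnion weylOrbit) (a := fun m => a (d m))
    (fun x => by
      rw [Finset.sum_biUnion hdisj, ← h x]
      refine Finset.sum_congr rfl fun i hi => ?_
      rw [monomial, Finset.mul_sum]
      exact Finset.sum_congr rfl fun m hm => by rw [hd' i hi m hm])
    (Finset.mem_biUnion.2 ⟨l, hl, self_mem_weylOrbit l⟩)
  rwa [hd' l hl l (self_mem_weylOrbit l)] at key

/-! ### Generic points have full measure -/

open MeasureTheory

/-- The excluded set is the preimage of a countable set under a surjective linear functional, hence
null. -/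
theorem ae_exp_comp_linearMap_pow_ne_one {n : ℕ} (L : (Fin n → ℝ) →ₗ[ℝ] ℝ)
    (hL : Function.Surjective L) {k : ℕ} (hk : k ≠ 0) :
    ∀ᵐ x : Fin n → ℝ, exp (I * (L x : ℂ)) ^ k ≠ 1 := by
  have hm : MeasurableSet {y : ℝ | exp (I * (y : ℂ)) ^ k ≠ 1} :=
    (measurableSet_eq_fun (by fun_prop) (by fun_prop)).compl
  have hcount : {y : ℝ | exp (I * (y : ℂ)) ^ k = 1}.Countable := by
    refine (Set.countable_range fun m : ℤ => (m * (2 * Real.pi) / k : ℝ)).mono fun y hy => ?_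
    rw [Set.mem_ofPred_eq, ← Complex.exp_nat_mul, Complex.exp_eq_one_iff] at hy
    obtain ⟨m, hm⟩ := hy
    refine ⟨m, ?_⟩
    have h1 : (k * y : ℂ) = m * (2 * Real.pi) :=
      mul_right_cancel₀ I_ne_zero (by linear_combination hm)
    have h2 : (k * y : ℝ) = m * (2 * Real.pi) := by exact_mod_cast h1
    have hk' : (k : ℝ) ≠ 0 := by exact_mod_cast hk
    dsimp only
    rw [← h2]
    field_simp
  refine (ae_comp_linearMap_mem_iff L volume volume hL hm).2 ?_
  rw [ae_iff]
  have : {y : ℝ | ¬ y ∈ {y : ℝ | exp (I * (y : ℂ)) ^ k ≠ 1}} =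
      {y : ℝ | exp (I * (y : ℂ)) ^ k = 1} := by ext; simp
  rw [this]
  exact hcount.measure_zero _

theorem ae_isGeneric (n : ℕ) : ∀ᵐ x : Fin n → ℝ, IsGeneric x := by
  refine Filter.Eventually.and ?_ ?_
  · rw [ae_all_iff]
    intro j
    refine ae_exp_comp_linearMap_pow_ne_one (LinearMap.proj j) (fun y => ⟨fun _ => y, rfl⟩)
      two_ne_zero
  · rw [ae_all_iff]
    intro j
    rw [ae_all_iff]
    intro k
    rcases eq_or_ne j k with rfl | hjk
    · exact .of_forall fun x h => absurd rfl h
    have h1 := ae_exp_comp_linearMap_pow_ne_one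
      (LinearMap.proj (R := ℝ) (φ := fun _ : Fin n => ℝ) j + LinearMap.proj k)
      (fun y => ⟨Pi.single j y, by
        rw [LinearMap.add_apply, LinearMap.proj_apply, LinearMap.proj_apply, Pi.single_eq_same,
          Pi.single_eq_of_ne hjk.symm, add_zero]⟩) one_ne_zero
    have h2 := ae_exp_comp_linearMap_pow_ne_one
      (LinearMap.proj (R := ℝ) (φ := fun _ : Fin n => ℝ) j - LinearMap.proj k)
      (fun y => ⟨Pi.single j y, by
        rw [LinearMap.sub_apply, LinearMap.proj_apply, LinearMap.proj_apply, Pi.single_eq_same,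
          Pi.single_eq_of_ne hjk.symm, sub_zero]⟩) one_ne_zero
    filter_upwards [h1, h2] with x hx1 hx2 _
    exact ⟨by simpa using hx1, by simpa using hx2⟩

/-! ### Symmetric polynomials and power sums -/

/-- Newton's identities, solved for the elementary symmetric polynomials by dividing by k in
characteristic 0. Power sums are convenient because changing one variable changes a single summand.
-/
theorem mem_adjoin_psum_of_isSymmetric {n : ℕ} {f : MvPolynomial (Fin n) ℂ} (hf : f.IsSymmetric) :
    f ∈ Algebra.adjoin ℂ (Set.range (MvPolynomial.psum (Fin n) ℂ)) := by
  set S := Algebra.adjoin ℂ (Set.range (MvPolynomial.psum (Fin n) ℂ))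
  have hesymm : ∀ k, MvPolynomial.esymm (Fin n) ℂ k ∈ S := by
    intro k
    induction k using Nat.strong_induction_on with
    | _ k ih =>
      rcases Nat.eq_zero_or_pos k with rfl | hk
      · rw [MvPolynomial.esymm_zero]; exact one_mem S
      have hN := MvPolynomial.mul_esymm_eq_sum (Fin n) ℂ k
      have hmem : (k : MvPolynomial (Fin n) ℂ) * MvPolynomial.esymm (Fin n) ℂ k ∈ S := by
        rw [hN]
        refine mul_mem (pow_mem (neg_mem (one_mem S)) _) (sum_mem fun a ha => ?_)
        exact mul_mem (mul_mem (pow_mem (neg_mem (one_mem S)) _)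
          (ih _ (Finset.mem_filter.1 ha).2)) (Algebra.subset_adjoin ⟨_, rfl⟩)
      have hk' : (k : ℂ) ≠ 0 := by exact_mod_cast hk.ne'
      have e : MvPolynomial.esymm (Fin n) ℂ k =
          (k : ℂ)⁻¹ • ((k : MvPolynomial (Fin n) ℂ) * MvPolynomial.esymm (Fin n) ℂ k) := by
        rw [← nsmul_eq_mul, ← Nat.cast_smul_eq_nsmul ℂ, smul_smul, inv_mul_cancel₀ hk', one_smul]
      rw [e]
      exact S.smul_mem hmem _
  obtain ⟨g, hg⟩ := MvPolynomial.esymmAlgHom_surjective (σ := Fin n) (n := n) ℂ (by simp) ⟨f, hf⟩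
  have hfg : f = MvPolynomial.aeval (fun i : Fin n => MvPolynomial.esymm (Fin n) ℂ (i + 1)) g := by
    have := congrArg (Subtype.val) hg
    rw [MvPolynomial.esymmAlgHom_apply] at this
    exact this.symm
  have hmem : f ∈ (MvPolynomial.aeval (R := ℂ)
      (fun i : Fin n => MvPolynomial.esymm (Fin n) ℂ (i + 1))).range := ⟨g, hfg.symm⟩
  rw [← Algebra.adjoin_range_eq_range_aeval] at hmem
  refine Algebra.adjoin_le ?_ hmem
  rintro _ ⟨i, rfl⟩
  exact hesymm _

/-! ### The Joukowski coordinate and Laurent polynomials -/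

/-- The Joukowski map `u ↦ u + u⁻¹`. -/
noncomputable def joukowski (u : ℂ) : ℂ := u + u⁻¹

theorem joukowski_inv (u : ℂ) : joukowski u⁻¹ = joukowski u := by
  rw [joukowski, joukowski, inv_inv, add_comm]

theorem joukowski_sub {u v : ℂ} (hu : u ≠ 0) (hv : v ≠ 0) :
    joukowski u - joukowski v = (1 - u * v) * (1 - u / v) / u := by
  unfold joukowski
  field_simp
  ring

theorem joukowski_update_inv {n : ℕ} (z : Fin n → ℂ) (j : Fin n) :
    joukowski ∘ Function.update z j (z j)⁻¹ = joukowski ∘ z := by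
  funext k
  rcases eq_or_ne k j with rfl | h
  · simp [joukowski_inv]
  · simp [h]

theorem joukowski_comp_update {n : ℕ} (z : Fin n → ℂ) (j : Fin n) (a : ℂ) :
    joukowski ∘ Function.update z j a = Function.update (joukowski ∘ z) j (joukowski a) := by
  funext k
  rcases eq_or_ne k j with rfl | h
  · simp
  · simp [h]

/-- Evaluation of a Laurent polynomial with polynomial coefficients. -/
noncomputable def laurentEval {n : ℕ} (x : Fin n → ℂ) (z : ℂˣ) :
    LaurentPolynomial (MvPolynomial (Fin n) ℂ) →+* ℂ :=
  LaurentPolynomial.eval₂ (MvPolynomial.eval x) z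

/-- The Laurent polynomial `c T + c⁻¹ T⁻¹`. -/
noncomputable def laurentJoukowski (n : ℕ) (c : ℂ) :
    LaurentPolynomial (MvPolynomial (Fin n) ℂ) :=
  LaurentPolynomial.C (MvPolynomial.C c) * LaurentPolynomial.T 1 +
    LaurentPolynomial.C (MvPolynomial.C c⁻¹) * LaurentPolynomial.T (-1)

theorem laurentEval_laurentJoukowski {n : ℕ} (c : ℂ) (x : Fin n → ℂ) (z : ℂˣ) :
    laurentEval x z (laurentJoukowski n c) = joukowski (c * z) := by
  simp [laurentEval, laurentJoukowski, joukowski]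
  ring

/-- a - b divides F(a) - F(b), applied in the ring of Laurent polynomials to a = cT + c⁻¹T⁻¹ and b =
T + T⁻¹. The quotient is universal: it depends on neither `x` nor `z`. -/
theorem exists_eval₂_sub_eq {n : ℕ} (c : ℂ) (F : Polynomial (MvPolynomial (Fin n) ℂ)) :
    ∃ G, ∀ (x : Fin n → ℂ) (z : ℂˣ),
      F.eval₂ (MvPolynomial.eval x) (joukowski (c * z)) -
        F.eval₂ (MvPolynomial.eval x) (joukowski z) =
      (joukowski (c * z) - joukowski z) * laurentEval x z G := by
  obtain ⟨G, hG⟩ := Polynomial.sub_dvd_eval_sub (laurentJoukowski n c) (laurentJoukowski n 1)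
    (F.map LaurentPolynomial.C)
  refine ⟨G, fun x z => ?_⟩
  have hcomp : (laurentEval x z).comp LaurentPolynomial.C = MvPolynomial.eval x := by
    ext <;> simp [laurentEval]
  have h := congrArg (laurentEval x z) hG
  rw [map_mul, map_sub, map_sub, Polynomial.eval_map, Polynomial.eval_map, Polynomial.hom_eval₂,
    Polynomial.hom_eval₂, hcomp, laurentEval_laurentJoukowski, laurentEval_laurentJoukowski,
    one_mul] at h
  exact h

/-- The increment of a symmetric polynomial under a multiplicative shift of one variable. -/
theorem exists_eval_update_sub_eq {n : ℕ} (c : ℂ) {f : MvPolynomial (Fin n) ℂ}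
    (hf : f.IsSymmetric) :
    ∃ G, ∀ (x : Fin n → ℂ) (j : Fin n) (z : ℂˣ), x j = joukowski z →
      MvPolynomial.eval (Function.update x j (joukowski (c * z))) f - MvPolynomial.eval x f =
      (joukowski (c * z) - joukowski z) * laurentEval x z G := by
  refine Algebra.adjoin_induction (p := fun f _ => ∃ G, ∀ (x : Fin n → ℂ) (j : Fin n) (z : ℂˣ),
    x j = joukowski z →
      MvPolynomial.eval (Function.update x j (joukowski (c * z))) f - MvPolynomial.eval x f =
      (joukowski (c * z) - joukowski z) * laurentEval x z G) ?_ ?_ ?_ ?_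
    (mem_adjoin_psum_of_isSymmetric hf)
  · rintro _ ⟨r, rfl⟩
    obtain ⟨G, hG⟩ := exists_eval₂_sub_eq (n := n) c (Polynomial.X ^ r)
    refine ⟨G, fun x j z hxz => ?_⟩
    rw [← hG x z]
    simp only [MvPolynomial.psum, map_sum, map_pow, MvPolynomial.eval_X, Polynomial.eval₂_X_pow]
    rw [← Finset.add_sum_erase _ _ (Finset.mem_univ j), ← Finset.add_sum_erase Finset.univ
      (fun i => x i ^ r) (Finset.mem_univ j), Function.update_self, hxz,
      Finset.sum_congr rfl fun i hi => by rw [Function.update_of_ne (Finset.ne_of_mem_erase hi)]]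
    ring
  · intro r
    exact ⟨0, fun x j z _ => by simp [MvPolynomial.algebraMap_eq]⟩
  · rintro f g _ _ ⟨F, hF⟩ ⟨G, hG⟩
    refine ⟨F + G, fun x j z h => ?_⟩
    rw [map_add, map_add, map_add]
    linear_combination hF x j z h + hG x j z h
  · rintro f g _ _ ⟨F, hF⟩ ⟨G, hG⟩
    -- Discrete Leibniz rule: the increment of fg is fΔg + gΔf + ΔfΔg, and one factor `joukowski (c
    -- * z) - joukowski z` of the last term stays in the quotient.
    refine ⟨LaurentPolynomial.C f * G + LaurentPolynomial.C g * F +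
      (laurentJoukowski n c - laurentJoukowski n 1) * F * G, fun x j z h => ?_⟩
    have hC : ∀ p, laurentEval x z (LaurentPolynomial.C p) = MvPolynomial.eval x p := by
      intro p; simp [laurentEval]
    simp only [map_add, map_mul, map_sub, laurentEval_laurentJoukowski, hC, one_mul]
    have h1 := hF x j z h
    have h2 := hG x j z h
    rw [sub_eq_iff_eq_add] at h1 h2
    rw [h1, h2]
    ring

/-- The nodal polynomial ∏(X - x_k) vanishes at x_j, so its value at `joukowski (c * z)` is its
increment; dividing by the difference of the arguments leaves the product over k ≠ j. The quotient
is the same for every j. -/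
theorem exists_prod_sub_eq {n : ℕ} (c : ℂ) :
    ∃ G, ∀ (x : Fin n → ℂ) (j : Fin n) (z : ℂˣ), x j = joukowski z →
      joukowski (c * z) ≠ joukowski z →
      ∏ k ∈ Finset.univ.erase j, (joukowski (c * z) - x k) = laurentEval x z G := by
  obtain ⟨G, hG⟩ := exists_eval₂_sub_eq (n := n) c
    (∏ k, (Polynomial.X - Polynomial.C (MvPolynomial.X k)))
  refine ⟨G, fun x j z hx hne => ?_⟩
  have h := hG x z
  simp only [Polynomial.eval₂_finsetProd, Polynomial.eval₂_sub, Polynomial.eval₂_X,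
    Polynomial.eval₂_C, MvPolynomial.eval_X] at h
  rw [Finset.prod_eq_zero (f := fun i => joukowski z - x i) (Finset.mem_univ j) (by simp [hx]),
    sub_zero, ← Finset.mul_prod_erase _ _ (Finset.mem_univ j), hx] at h
  exact mul_left_cancel₀ (sub_ne_zero.2 hne) h

/-- The recursion of the Chebyshev polynomials of the second kind. -/
theorem exists_zpow_sub_eq (m : ℤ) : ∃ S : Polynomial ℂ, ∀ z : ℂˣ,
    (z : ℂ) ^ m - (z : ℂ)⁻¹ ^ m = (z - (z : ℂ)⁻¹) * S.eval (joukowski z) := by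
  have hnat : ∀ m : ℕ, ∃ S : Polynomial ℂ, ∀ z : ℂˣ,
      (z : ℂ) ^ m - (z : ℂ)⁻¹ ^ m = (z - (z : ℂ)⁻¹) * S.eval (joukowski z) := by
    intro m
    induction m using Nat.twoStepInduction with
    | zero => exact ⟨0, by simp⟩
    | one => exact ⟨1, by simp⟩
    | more m h0 h1 =>
      obtain ⟨S, hS⟩ := h0
      obtain ⟨T, hT⟩ := h1
      refine ⟨Polynomial.X * T - S, fun z => ?_⟩
      have hz : (z : ℂ) * (z : ℂ)⁻¹ = 1 := mul_inv_cancel₀ z.ne_zero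
      simp only [Polynomial.eval_sub, Polynomial.eval_mul, Polynomial.eval_X]
      have e : ((z : ℂ) - (z : ℂ)⁻¹) * (joukowski z * T.eval (joukowski z) - S.eval (joukowski z)) =
          joukowski z * ((z : ℂ) ^ (m + 1) - (z : ℂ)⁻¹ ^ (m + 1)) -
            ((z : ℂ) ^ m - (z : ℂ)⁻¹ ^ m) := by
        rw [hT, hS]; ring
      rw [e, joukowski]
      linear_combination ((z : ℂ)⁻¹ ^ m - (z : ℂ) ^ m) * hz
  obtain ⟨k, rfl | rfl⟩ := m.eq_nat_or_neg
  · simpa using hnat k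
  · obtain ⟨S, hS⟩ := hnat k
    refine ⟨-S, fun z => ?_⟩
    rw [Polynomial.eval_neg, mul_neg, ← hS z]
    simp [zpow_neg]

/-- The recursion of the Chebyshev polynomials of the first kind. -/
theorem exists_zpow_add_eq (m : ℤ) : ∃ S : Polynomial ℂ, ∀ z : ℂ, z ≠ 0 →
    z ^ m + z⁻¹ ^ m = S.eval (joukowski z) := by
  have hnat : ∀ m : ℕ, ∃ S : Polynomial ℂ, ∀ z : ℂ, z ≠ 0 →
      z ^ m + z⁻¹ ^ m = S.eval (joukowski z) := by
    intro m
    induction m using Nat.twoStepInduction with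
    | zero => exact ⟨2, fun z _ => by norm_num⟩
    | one => exact ⟨Polynomial.X, fun z _ => by simp [joukowski]⟩
    | more m h0 h1 =>
      obtain ⟨S, hS⟩ := h0
      obtain ⟨T, hT⟩ := h1
      refine ⟨Polynomial.X * T - S, fun z h => ?_⟩
      have hz : z * z⁻¹ = 1 := mul_inv_cancel₀ h
      rw [Polynomial.eval_sub, Polynomial.eval_mul, Polynomial.eval_X, ← hT z h, ← hS z h,
        joukowski]
      linear_combination -(z⁻¹ ^ m + z ^ m) * hz
  obtain ⟨k, rfl | rfl⟩ := m.eq_nat_or_neg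
  · simpa using hnat k
  · obtain ⟨S, hS⟩ := hnat k
    refine ⟨S, fun z h => ?_⟩
    rw [← hS z h]
    simp [zpow_neg, add_comm]

/-- An antisymmetric Laurent polynomial is divisible by `z - z⁻¹`. -/
theorem exists_laurentEval_sub_eq {n : ℕ} (G : LaurentPolynomial (MvPolynomial (Fin n) ℂ)) :
    ∃ F : Polynomial (MvPolynomial (Fin n) ℂ), ∀ (x : Fin n → ℂ) (z : ℂˣ),
      laurentEval x z G - laurentEval x z⁻¹ G =
        (z - (z : ℂ)⁻¹) * F.eval₂ (MvPolynomial.eval x) (joukowski z) := by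
  induction G using LaurentPolynomial.induction_on' with
  | add p q hp hq =>
    obtain ⟨F, hF⟩ := hp
    obtain ⟨G, hG⟩ := hq
    refine ⟨F + G, fun x z => ?_⟩
    rw [map_add, map_add, Polynomial.eval₂_add]
    linear_combination hF x z + hG x z
  | C_mul_T m a =>
    obtain ⟨S, hS⟩ := exists_zpow_sub_eq m
    refine ⟨Polynomial.C a * S.map MvPolynomial.C, fun x z => ?_⟩
    have e : (MvPolynomial.eval x).comp (MvPolynomial.C : ℂ →+* MvPolynomial (Fin n) ℂ) =
        RingHom.id ℂ := by ext; simp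
    rw [Polynomial.eval₂_mul, Polynomial.eval₂_C, Polynomial.eval₂_map, e, Polynomial.eval₂_id]
    have := hS z
    simp only [laurentEval, LaurentPolynomial.eval₂_C_mul_T, Units.val_zpow_eq_zpow_val,
      Units.val_inv_eq_inv_val]
    linear_combination (MvPolynomial.eval x a) * this

/-- Lagrange-type sums are polynomial in the nodes. -/
theorem exists_sum_div_prod_eq {n : ℕ} (F : Polynomial (MvPolynomial (Fin n) ℂ)) :
    ∃ p : MvPolynomial (Fin n) ℂ, ∀ x : Fin n → ℂ, Function.Injective x →
      ∑ j, F.eval₂ (MvPolynomial.eval x) (x j) / ∏ k ∈ Finset.univ.erase j, (x j - x k) =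
        MvPolynomial.eval x p := by
  set N : Polynomial (MvPolynomial (Fin n) ℂ) :=
    Lagrange.nodal Finset.univ (MvPolynomial.X : Fin n → MvPolynomial (Fin n) ℂ)
  have hN : N.Monic := Lagrange.nodal_monic
  -- The sum is Lagrange's formula for the coefficient of degree n - 1 of the interpolant at the
  -- nodes x_j. The interpolant is the remainder of F modulo the nodal polynomial, and since that is
  -- monic the remainder has polynomial coefficients in the nodes.
  refine ⟨(F %ₘ N).coeff (n - 1), fun x hx => ?_⟩
  have hmap : N.map (MvPolynomial.eval x) = Lagrange.nodal Finset.univ x := by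
    simp [N, Lagrange.nodal_eq, Polynomial.map_prod]
  have hdeg : (F.map (MvPolynomial.eval x) %ₘ Lagrange.nodal Finset.univ x).degree <
      (Finset.univ : Finset (Fin n)).card := by
    rw [← Lagrange.degree_nodal (v := x)]
    exact Polynomial.degree_modByMonic_lt _ Lagrange.nodal_monic
  have h := Lagrange.coeff_eq_sum hx.injOn hdeg
  rw [← hmap, ← Polynomial.map_modByMonic _ hN, Polynomial.coeff_map, Finset.card_univ,
    Fintype.card_fin] at h
  rw [h]
  refine Finset.sum_congr rfl fun j _ => ?_
  rw [Polynomial.eval_map, Polynomial.eval₂_modByMonic_eq_self_of_root]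
  rw [← Polynomial.eval_map, hmap]
  exact Lagrange.eval_nodal_at_node (Finset.mem_univ j)

/-! ### Orbit sums as symmetric polynomials in the Joukowski coordinates -/

theorem sum_laurentMonomial_weylActVar {n : ℕ} (m : Fin n → ℤ) (z : Fin n → ℂ) :
    ∑ w, laurentMonomial m (weylActVar w z) =
      ∑ σ : Equiv.Perm (Fin n), ∏ j, (z (σ j) ^ m j + (z (σ j))⁻¹ ^ m j) := by
  rw [Fintype.sum_prod_type]
  refine Finset.sum_congr rfl fun σ _ => ?_
  have h : ∀ j, z (σ j) ^ m j + (z (σ j))⁻¹ ^ m j =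
      ∑ e : ℤˣ, (z (σ j) ^ (e : ℤ)) ^ m j := by
    intro j
    have : (Finset.univ : Finset ℤˣ) = {1, -1} := rfl
    rw [this, Finset.sum_pair (by decide)]
    simp
  simp only [h, Finset.prod_univ_sum, Fintype.piFinset_univ]
  rfl

theorem exists_isSymmetric_orbitSum {n : ℕ} (l : Fin n → ℤ) :
    ∃ f : MvPolynomial (Fin n) ℂ, f.IsSymmetric ∧ ∀ z : Fin n → ℂ, (∀ j, z j ≠ 0) →
      orbitSum l z = MvPolynomial.eval (joukowski ∘ z) f := by
  choose S hS using exists_zpow_add_eq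
  set N : ℂ := (Fintype.card (Equiv.Perm (Fin n) × (Fin n → ℤˣ)) : ℂ)
  have hN : N ≠ 0 := by
    simp only [N]; exact_mod_cast Fintype.card_ne_zero
  -- Averaging over the whole group, of order `N`, avoids stabilizers. Summing a monomial over signs
  -- turns each factor into z^m + z^{-m}, a polynomial in the Joukowski coordinate.
  refine ⟨MvPolynomial.C N⁻¹ * ∑ m ∈ weylOrbit l, ∑ σ : Equiv.Perm (Fin n),
    ∏ j, Polynomial.aeval (MvPolynomial.X (σ j)) (S (m j)), ?_, fun z hz => ?_⟩
  · intro e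
    rw [map_mul, MvPolynomial.rename_C, map_sum]
    congr 1
    refine Finset.sum_congr rfl fun m _ => ?_
    rw [map_sum]
    refine Fintype.sum_equiv (Equiv.mulLeft e) _ _ fun σ => ?_
    rw [map_prod]
    refine Finset.prod_congr rfl fun j _ => ?_
    rw [← Polynomial.aeval_algHom_apply]
    simp
  · have h1 : N * orbitSum l z =
        ∑ w : Equiv.Perm (Fin n) × (Fin n → ℤˣ), orbitSum l (weylActVar w z) := by
      simp only [orbitSum_weylActVar, Finset.sum_const, Finset.card_univ, nsmul_eq_mul, N]
    rw [map_mul, MvPolynomial.eval_C, eq_inv_mul_iff_mul_eq₀ hN, h1]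
    simp only [orbitSum]
    rw [Finset.sum_comm, map_sum]
    refine Finset.sum_congr rfl fun m _ => ?_
    rw [sum_laurentMonomial_weylActVar, map_sum]
    refine Finset.sum_congr rfl fun σ _ => ?_
    rw [map_prod]
    refine Finset.prod_congr rfl fun j _ => ?_
    rw [hS _ _ (hz _), ← MvPolynomial.coe_aeval_eq_eval]
    change _ = (MvPolynomial.aeval (joukowski ∘ z)) _
    rw [← Polynomial.aeval_algHom_apply]
    simp

/-! ### Koornwinder's difference operator -/

/-- The coefficient of the shift in the `j`-th variable. -/
noncomputable def shiftCoeff (P : Params) {n : ℕ} (j : Fin n) (z : Fin n → ℂ) : ℂ :=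
  (∏ i, (1 - P.coef i * z j)) / ((1 - z j ^ 2) * (1 - P.q * z j ^ 2)) *
    ∏ k ∈ Finset.univ.erase j, ((1 - P.t * (z j * z k)) / (1 - z j * z k) *
      ((1 - P.t * (z j / z k)) / (1 - z j / z k)))

/-- The contribution of the shift `zⱼ ↦ q zⱼ`. -/
noncomputable def shiftTerm (P : Params) {n : ℕ} (j : Fin n) (f : (Fin n → ℂ) → ℂ)
    (z : Fin n → ℂ) : ℂ :=
  shiftCoeff P j z * (f (Function.update z j (P.q * z j)) - f z)

/-- Koornwinder's difference operator. -/
noncomputable def koornwinderOp (P : Params) {n : ℕ} (f : (Fin n → ℂ) → ℂ) (z : Fin n → ℂ) : ℂ :=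
  ∑ j, (shiftTerm P j f z + shiftTerm P j f (Function.update z j (z j)⁻¹))

/-- Points at which the `j`-th shift coefficient is regular. -/
structure RegularAt (P : Params) {n : ℕ} (j : Fin n) (z : Fin n → ℂ) : Prop where
  ne_zero : ∀ k, z k ≠ 0
  sq_ne : z j ^ 2 ≠ 1
  q_sq_ne : P.q * z j ^ 2 ≠ 1
  -- Not a pole of the coefficient: this keeps `joukowski (t * z j)` and `joukowski (z j)` distinct
  -- (given t ≠ 1), as `exists_prod_sub_eq` requires.
  t_sq_ne : P.t * z j ^ 2 ≠ 1
  mul_ne : ∀ k, k ≠ j → z j * z k ≠ 1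
  ne : ∀ k, k ≠ j → z j ≠ z k

/-- Points at which Koornwinder's difference operator is regular. -/
def RegularPoint (P : Params) {n : ℕ} (z : Fin n → ℂ) : Prop :=
  ∀ j, RegularAt P j z ∧ RegularAt P j (Function.update z j (z j)⁻¹)

/-- By `joukowski_sub`, each two-particle factor is, up to the factor t, a quotient of differences
of Joukowski coordinates. -/
theorem prod_shiftCoeff_eq {n : ℕ} {t : ℂ} (ht : t ≠ 0) {j : Fin n} {z : Fin n → ℂ}
    (hz : ∀ k, z k ≠ 0) :
    ∏ k ∈ Finset.univ.erase j, ((1 - t * (z j * z k)) / (1 - z j * z k) *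
      ((1 - t * (z j / z k)) / (1 - z j / z k))) =
    t ^ (n - 1) * (∏ k ∈ Finset.univ.erase j, (joukowski (t * z j) - joukowski (z k))) /
      ∏ k ∈ Finset.univ.erase j, (joukowski (z j) - joukowski (z k)) := by
  have hcard : (Finset.univ.erase j).card = n - 1 := by simp
  rw [← hcard, ← Finset.prod_const, ← Finset.prod_mul_distrib, ← Finset.prod_div_distrib]
  refine Finset.prod_congr rfl fun k _ => ?_
  have hj := hz j
  rw [joukowski_sub (mul_ne_zero ht hj) (hz k), joukowski_sub hj (hz k), div_mul_div_comm,
    mul_assoc t (z j) (z k), mul_div_assoc t (z j) (z k)]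
  generalize (1 - t * (z j * z k)) * (1 - t * (z j / z k)) = A
  generalize (1 - z j * z k) * (1 - z j / z k) = B
  field_simp

/-- The increment of the orbit sum contains 1 - q z_j², which cancels that factor of the
denominator. Only the poles at z_j = z_j⁻¹ and x_j = x_k remain. That one `H` serves all j, and the
points with z_j inverted, is what makes the sum over all shifts tractable. -/
theorem exists_shiftTerm_eq {P : Params} (hP : P.Regular) {n : ℕ} (l : Fin n → ℤ) :
    ∃ H : LaurentPolynomial (MvPolynomial (Fin n) ℂ), ∀ (j : Fin n) (z : Fin n → ℂ) (u : ℂˣ),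
      (u : ℂ) = z j → RegularAt P j z →
      shiftTerm P j (orbitSum l) z = laurentEval (joukowski ∘ z) u H / ((u : ℂ)⁻¹ - u) /
        ∏ k ∈ Finset.univ.erase j, (joukowski (z j) - joukowski (z k)) := by
  obtain ⟨f, hf, hfz⟩ := exists_isSymmetric_orbitSum l
  obtain ⟨G, hG⟩ := exists_eval_update_sub_eq P.q hf
  obtain ⟨K, hK⟩ := exists_prod_sub_eq (n := n) P.t
  have hq0 := q_ne_zero P
  have ht0 := t_ne_zero P
  -- The power T⁻² collects z_j⁻¹ from the increment of the Joukowski coordinate and z_j⁻¹ from 1 -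
  -- z_j² = z_j(z_j⁻¹ - z_j).
  refine ⟨LaurentPolynomial.C (MvPolynomial.C (P.t ^ (n - 1) * ((1 - P.q) / P.q))) *
    (∏ i, (1 - LaurentPolynomial.C (MvPolynomial.C (P.coef i)) * LaurentPolynomial.T 1)) *
    LaurentPolynomial.T (-2) * K * G, fun j z u hu hz => ?_⟩
  have hzj := hz.ne_zero j
  have hupd : orbitSum l (Function.update z j (P.q * z j)) - orbitSum l z =
      (joukowski (P.q * u) - joukowski u) * laurentEval (joukowski ∘ z) u G := by
    rw [← hG (joukowski ∘ z) j u (by simp [hu]), hfz z hz.ne_zero, hfz, joukowski_comp_update, hu]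
    intro k
    rcases eq_or_ne k j with rfl | h
    · simp [hq0, hzj]
    · simpa [h] using hz.ne_zero k
  have hprod : ∏ k ∈ Finset.univ.erase j, (joukowski (P.t * z j) - joukowski (z k)) =
      laurentEval (joukowski ∘ z) u K := by
    rw [← hK (joukowski ∘ z) j u (by simp [hu])]
    · simp [hu]
    · rw [hu, ← sub_ne_zero, joukowski_sub (mul_ne_zero ht0 hzj) hzj]
      refine div_ne_zero (mul_ne_zero ?_ ?_) (mul_ne_zero ht0 hzj)
      · rw [mul_assoc, ← sq]
        exact sub_ne_zero.2 hz.t_sq_ne.symm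
      · rw [mul_div_assoc, div_self hzj, mul_one]
        refine sub_ne_zero.2 fun h => ?_
        have := hP.norm_t_lt_one
        rw [← h, norm_one] at this
        exact lt_irrefl _ this
  have hjouk : joukowski (P.q * u) - joukowski u =
      (1 - P.q) / P.q * (1 - P.q * z j ^ 2) * (z j)⁻¹ := by
    rw [hu, joukowski]
    unfold joukowski
    field_simp
    ring
  have hev : laurentEval (joukowski ∘ z) u
      (LaurentPolynomial.C (MvPolynomial.C (P.t ^ (n - 1) * ((1 - P.q) / P.q))) *
      (∏ i, (1 - LaurentPolynomial.C (MvPolynomial.C (P.coef i)) * LaurentPolynomial.T 1)) *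
      LaurentPolynomial.T (-2) * K * G) =
      P.t ^ (n - 1) * ((1 - P.q) / P.q) * (∏ i, (1 - P.coef i * z j)) * (z j ^ 2)⁻¹ *
        laurentEval (joukowski ∘ z) u K * laurentEval (joukowski ∘ z) u G := by
    simp only [map_mul, map_prod, map_sub, map_one]
    simp [laurentEval, hu, zpow_neg, zpow_ofNat]
  have h1 : (1 - z j ^ 2) ≠ 0 := sub_ne_zero.2 hz.sq_ne.symm
  have h2 : (1 - P.q * z j ^ 2) ≠ 0 := sub_ne_zero.2 hz.q_sq_ne.symm
  have h3 : ((z j)⁻¹ - z j) = (1 - z j ^ 2) / z j := by field_simp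
  rw [hev, shiftTerm, shiftCoeff, prod_shiftCoeff_eq ht0 hz.ne_zero, hprod, hupd, hjouk, hu, h3]
  generalize (∏ k ∈ Finset.univ.erase j, (joukowski (z j) - joukowski (z k))) = D
  generalize (∏ i, (1 - P.coef i * z j)) = A
  generalize (1 - P.q * z j ^ 2) = B at h2 ⊢
  rw [← mul_div_assoc, div_mul_eq_mul_div]
  congr 1
  field_simp

/-- Adding the inverse shift replaces `H` by its antisymmetrization, which is divisible by z_j -
z_j⁻¹ with quotient a polynomial F in x_j. The remaining sum over j is of Lagrange type, so the
poles at x_j = x_k cancel as well. -/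
theorem exists_koornwinderOp_orbitSum_eq {P : Params} (hP : P.Regular) {n : ℕ} (l : Fin n → ℤ) :
    ∃ p : MvPolynomial (Fin n) ℂ, ∀ z : Fin n → ℂ, RegularPoint P z →
      koornwinderOp P (orbitSum l) z = MvPolynomial.eval (joukowski ∘ z) p := by
  obtain ⟨H, hH⟩ := exists_shiftTerm_eq hP l
  obtain ⟨F, hF⟩ := exists_laurentEval_sub_eq H
  obtain ⟨p, hp⟩ := exists_sum_div_prod_eq F
  refine ⟨-p, fun z hz => ?_⟩
  have hinj : Function.Injective (joukowski ∘ z) := by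
    intro j k hjk
    by_contra hne
    have h := (hz j).1
    have h0 : joukowski (z j) - joukowski (z k) = 0 := sub_eq_zero.2 hjk
    rw [joukowski_sub (h.ne_zero j) (h.ne_zero k)] at h0
    refine div_ne_zero (mul_ne_zero (sub_ne_zero.2 (h.mul_ne k (Ne.symm hne)).symm)
      (sub_ne_zero.2 fun e => h.ne k (Ne.symm hne) ?_)) (h.ne_zero j) h0
    rw [eq_div_iff (h.ne_zero k), one_mul] at e
    exact e.symm
  rw [map_neg, ← hp _ hinj, koornwinderOp, ← Finset.sum_neg_distrib]
  refine Finset.sum_congr rfl fun j _ => ?_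
  have hzj := (hz j).1.ne_zero j
  set u : ℂˣ := Units.mk0 (z j) hzj
  rw [hH j z u rfl (hz j).1, hH j (Function.update z j (z j)⁻¹) u⁻¹ (by simp [u]) (hz j).2,
    joukowski_update_inv]
  have hprod : ∏ k ∈ Finset.univ.erase j, (joukowski (Function.update z j (z j)⁻¹ j) -
      joukowski (Function.update z j (z j)⁻¹ k)) =
      ∏ k ∈ Finset.univ.erase j, (joukowski (z j) - joukowski (z k)) := by
    refine Finset.prod_congr rfl fun k hk => ?_
    rw [Function.update_self, Function.update_of_ne (Finset.ne_of_mem_erase hk), joukowski_inv]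
  have hu : (u : ℂ)⁻¹ - u ≠ 0 := by
    rw [sub_ne_zero]
    intro h
    apply (hz j).1.sq_ne
    have : (z j)⁻¹ = z j := h
    rw [sq]
    nth_rewrite 1 [← this]
    exact inv_mul_cancel₀ hzj
  have hu' : (u : ℂ) - (u : ℂ)⁻¹ ≠ 0 := fun h => hu (by linear_combination -h)
  rw [hprod, Units.val_inv_eq_inv_val, inv_inv, ← add_div, ← neg_div]
  change _ / (∏ k ∈ Finset.univ.erase j, (joukowski (z j) - joukowski (z k))) =
    _ / (∏ k ∈ Finset.univ.erase j, (joukowski (z j) - joukowski (z k)))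
  congr 1
  have h := hF (joukowski ∘ z) u
  have e : joukowski u = (joukowski ∘ z) j := rfl
  rw [e] at h
  rw [show (u : ℂ)⁻¹ - u = -(u - (u : ℂ)⁻¹) by ring, div_neg, neg_add_eq_sub, ← sub_div,
    ← neg_sub (laurentEval _ u H), h, neg_div, mul_div_cancel_left₀ _ hu']

/-! ### Triangularity of the difference operator, from asymptotics. -/

open Filter Topology

/-! ### Asymptotics along one-parameter curves -/

theorem tendsto_ofReal_zpow_neg {k : ℤ} (hk : k < 0) :
    Tendsto (fun s : ℝ => (s : ℂ) ^ k) atTop (𝓝 0) := by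
  have h : Tendsto (fun s : ℝ => ((s ^ k : ℝ) : ℂ)) atTop (𝓝 ((0 : ℝ) : ℂ)) :=
    (Complex.continuous_ofReal.tendsto 0).comp (tendsto_zpow_atTop_zero hk)
  simpa using h

theorem eventually_zpow_mul_ne {k : ℤ} (hk : k ≠ 0) {a b : ℂ} (ha : a ≠ 0) (hb : b ≠ 0) :
    ∀ᶠ s : ℝ in atTop, (s : ℂ) ^ k * a ≠ b := by
  rcases hk.lt_or_gt with h | h
  · have := (tendsto_ofReal_zpow_neg h).mul_const a
    rw [zero_mul] at this
    exact this.eventually_ne hb.symm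
  · have := (tendsto_ofReal_zpow_neg (neg_lt_zero.2 h)).mul_const b
    rw [zero_mul] at this
    filter_upwards [this.eventually_ne ha.symm, eventually_gt_atTop 0] with s hs hs0 e
    apply hs
    have hs' : (s : ℂ) ≠ 0 := by exact_mod_cast hs0.ne'
    rw [← e, ← mul_assoc, ← zpow_add₀ hs', neg_add_cancel, zpow_zero, one_mul]

theorem tendsto_inv_zpow_mul {k : ℤ} (hk : 0 < k) (a : ℂ) :
    Tendsto (fun s : ℝ => ((s : ℂ) ^ k * a)⁻¹) atTop (𝓝 0) := by
  have := (tendsto_ofReal_zpow_neg (neg_lt_zero.2 hk)).mul_const a⁻¹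
  rw [zero_mul] at this
  refine this.congr fun s => ?_
  rw [mul_inv, zpow_neg]

theorem tendsto_one_sub_mul_div {k : ℤ} (hk : k ≠ 0) {a : ℂ} (ha : a ≠ 0) (t : ℂ) :
    Tendsto (fun s : ℝ => (1 - t * ((s : ℂ) ^ k * a)) / (1 - (s : ℂ) ^ k * a)) atTop
      (𝓝 (if 0 < k then t else 1)) := by
  split_ifs with h
  · have hy := tendsto_inv_zpow_mul h a
    have h1 : Tendsto (fun s : ℝ => (((s : ℂ) ^ k * a)⁻¹ - t) / (((s : ℂ) ^ k * a)⁻¹ - 1)) atTop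
        (𝓝 ((0 - t) / (0 - 1))) := (hy.sub_const t).div (hy.sub_const 1) (by norm_num)
    rw [show (0 - t) / (0 - 1) = t by ring] at h1
    refine h1.congr' ?_
    filter_upwards [eventually_gt_atTop 0] with s hs
    have hz : (s : ℂ) ^ k * a ≠ 0 := mul_ne_zero (zpow_ne_zero _ (by exact_mod_cast hs.ne')) ha
    generalize (s : ℂ) ^ k * a = z at hz
    rw [← mul_div_mul_left _ _ hz, mul_sub, mul_sub, mul_inv_cancel₀ hz]
    ring_nf
  · have hy := (tendsto_ofReal_zpow_neg (lt_of_le_of_ne (not_lt.1 h) hk)).mul_const a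
    rw [zero_mul] at hy
    have h1 : Tendsto (fun s : ℝ => (1 - t * ((s : ℂ) ^ k * a)) / (1 - (s : ℂ) ^ k * a)) atTop
        (𝓝 ((1 - t * 0) / (1 - 0))) :=
      (tendsto_const_nhds.sub (hy.const_mul t)).div (tendsto_const_nhds.sub hy) (by norm_num)
    simpa using h1

/-- Numerator and denominator both have degree 4 in the variable, so the limit at infinity is the
ratio of the leading coefficients and the limit at 0 is 1. -/
theorem tendsto_oneParticleCoeff (P : Params) {k : ℤ} (hk : k ≠ 0) {a : ℂ} (ha : a ≠ 0) :
    Tendsto (fun s : ℝ => (∏ i, (1 - P.coef i * ((s : ℂ) ^ k * a))) /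
      ((1 - ((s : ℂ) ^ k * a) ^ 2) * (1 - P.q * ((s : ℂ) ^ k * a) ^ 2))) atTop
      (𝓝 (if 0 < k then (∏ i, P.coef i) / P.q else 1)) := by
  have hq := q_ne_zero P
  split_ifs with h
  · have hy := tendsto_inv_zpow_mul h a
    have h1 : Tendsto (fun s : ℝ => (∏ i, (((s : ℂ) ^ k * a)⁻¹ - P.coef i)) /
        (((((s : ℂ) ^ k * a)⁻¹) ^ 2 - 1) * ((((s : ℂ) ^ k * a)⁻¹) ^ 2 - P.q))) atTop
        (𝓝 ((∏ i, (0 - P.coef i)) / ((0 ^ 2 - 1) * (0 ^ 2 - P.q)))) :=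
      (tendsto_finsetProd _ fun i _ => hy.sub_const _).div
        (((hy.pow 2).sub_const 1).mul ((hy.pow 2).sub_const _)) (by simpa using hq)
    have e : (∏ i, (0 - P.coef i)) / ((0 ^ 2 - 1) * (0 ^ 2 - P.q)) = (∏ i, P.coef i) / P.q := by
      rw [Fin.prod_univ_four, Fin.prod_univ_four]
      congr 1 <;> ring
    rw [e] at h1
    refine h1.congr' ?_
    filter_upwards [eventually_gt_atTop 0] with s hs
    have hz : (s : ℂ) ^ k * a ≠ 0 := mul_ne_zero (zpow_ne_zero _ (by exact_mod_cast hs.ne')) ha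
    generalize (s : ℂ) ^ k * a = z at hz
    rw [← mul_div_mul_left _ _ (pow_ne_zero 4 hz), Fin.prod_univ_four, Fin.prod_univ_four]
    congr 1 <;> field_simp
  · have hy := (tendsto_ofReal_zpow_neg (lt_of_le_of_ne (not_lt.1 h) hk)).mul_const a
    rw [zero_mul] at hy
    have h1 : Tendsto (fun s : ℝ => (∏ i, (1 - P.coef i * ((s : ℂ) ^ k * a))) /
        ((1 - ((s : ℂ) ^ k * a) ^ 2) * (1 - P.q * ((s : ℂ) ^ k * a) ^ 2))) atTop
        (𝓝 ((∏ i, (1 - P.coef i * 0)) / ((1 - 0 ^ 2) * (1 - P.q * 0 ^ 2)))) :=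
      (tendsto_finsetProd _ fun i _ => tendsto_const_nhds.sub (hy.const_mul _)).div
        ((tendsto_const_nhds.sub (hy.pow 2)).mul
          (tendsto_const_nhds.sub ((hy.pow 2).const_mul _))) (by norm_num)
    simpa using h1

/-- The curve `s ↦ (s ^ cⱼ wⱼ)ⱼ`. -/
noncomputable def cocharCurve {n : ℕ} (c : Fin n → ℤ) (w : Fin n → ℂ) (s : ℝ) : Fin n → ℂ :=
  fun j => (s : ℂ) ^ c j * w j

theorem cocharCurve_update_mul {n : ℕ} (c : Fin n → ℤ) (w : Fin n → ℂ) (s : ℝ) (j : Fin n)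
    (a : ℂ) : Function.update (cocharCurve c w s) j (a * cocharCurve c w s j) =
      cocharCurve c (Function.update w j (a * w j)) s := by
  funext k
  rcases eq_or_ne k j with rfl | h
  · simp only [Function.update_self, cocharCurve]; ring
  · simp [cocharCurve, h]

theorem cocharCurve_update_inv {n : ℕ} (c : Fin n → ℤ) (w : Fin n → ℂ) (s : ℝ) (j : Fin n) :
    Function.update (cocharCurve c w s) j (cocharCurve c w s j)⁻¹ =
      cocharCurve (Function.update c j (-c j)) (Function.update w j (w j)⁻¹) s := by
  funext k
  rcases eq_or_ne k j with rfl | h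
  · simp [cocharCurve, mul_comm]
  · simp [cocharCurve, h]

/-- Along the curve every nonvanishing condition reads s^k a ≠ b with k ≠ 0, which holds for all
large s. -/
theorem eventually_regularAt {P : Params} {n : ℕ} {c : Fin n → ℤ} {w : Fin n → ℂ}
    (hw : ∀ k, w k ≠ 0) {j : Fin n} (hj : c j ≠ 0) (hadd : ∀ k, k ≠ j → c j + c k ≠ 0)
    (hsub : ∀ k, k ≠ j → c j - c k ≠ 0) :
    ∀ᶠ s in atTop, RegularAt P j (cocharCurve c w s) := by
  have h2 : c j * 2 ≠ 0 := mul_ne_zero hj two_ne_zero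
  have hw2 : w j ^ 2 ≠ 0 := pow_ne_zero 2 (hw j)
  have hsq : ∀ s : ℝ, cocharCurve c w s j ^ 2 = (s : ℂ) ^ (c j * 2) * w j ^ 2 := fun s => by
    rw [cocharCurve, mul_pow, zpow_mul]
    rfl
  have e1 := eventually_zpow_mul_ne h2 hw2 one_ne_zero
  have e2 := eventually_zpow_mul_ne h2 (mul_ne_zero (q_ne_zero P) hw2) one_ne_zero
  have e3 := eventually_zpow_mul_ne h2 (mul_ne_zero (t_ne_zero P) hw2) one_ne_zero
  have e4 : ∀ᶠ s : ℝ in atTop, ∀ k, k ≠ j → (s : ℂ) ^ (c j + c k) * (w j * w k) ≠ 1 :=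
    eventually_all.2 fun k => by
      rcases eq_or_ne k j with h | h
      · exact .of_forall fun s h' => absurd h h'
      · filter_upwards [eventually_zpow_mul_ne (hadd k h) (mul_ne_zero (hw j) (hw k)) one_ne_zero]
          with s hs _ using hs
  have e5 : ∀ᶠ s : ℝ in atTop, ∀ k, k ≠ j → (s : ℂ) ^ (c j - c k) * w j ≠ w k :=
    eventually_all.2 fun k => by
      rcases eq_or_ne k j with h | h
      · exact .of_forall fun s h' => absurd h h'
      · filter_upwards [eventually_zpow_mul_ne (hsub k h) (hw j) (hw k)] with s hs _ using hs
  filter_upwards [e1, e2, e3, e4, e5, eventually_gt_atTop 0] with s h1 h2 h3 h4 h5 hs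
  have hs' : (s : ℂ) ≠ 0 := by exact_mod_cast hs.ne'
  refine ⟨fun k => mul_ne_zero (zpow_ne_zero _ hs') (hw k), ?_, ?_, ?_, fun k hk h => h4 k hk ?_,
    fun k hk h => h5 k hk ?_⟩
  · rwa [hsq]
  · rw [hsq]; convert h2 using 1; ring
  · rw [hsq]; convert h3 using 1; ring
  · rw [← h, cocharCurve, cocharCurve, zpow_add₀ hs']; ring
  · rw [zpow_sub₀ hs', div_mul_eq_mul_div, div_eq_iff (zpow_ne_zero _ hs'), mul_comm (w k)]
    exact h

theorem tendsto_shiftCoeff (P : Params) {n : ℕ} {c : Fin n → ℤ} {w : Fin n → ℂ}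
    (hw : ∀ k, w k ≠ 0) {j : Fin n} (hj : c j ≠ 0) (hadd : ∀ k, k ≠ j → c j + c k ≠ 0)
    (hsub : ∀ k, k ≠ j → c j - c k ≠ 0) :
    Tendsto (fun s => shiftCoeff P j (cocharCurve c w s)) atTop
      (𝓝 ((if 0 < c j then (∏ i, P.coef i) / P.q else 1) *
        ∏ k ∈ Finset.univ.erase j, ((if 0 < c j + c k then P.t else 1) *
          (if 0 < c j - c k then P.t else 1)))) := by
  refine (tendsto_oneParticleCoeff P hj (hw j)).mul (tendsto_finsetProd _ fun k hk => ?_)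
  have hk' := Finset.ne_of_mem_erase hk
  have h1 := tendsto_one_sub_mul_div (hadd k hk') (mul_ne_zero (hw j) (hw k)) P.t
  have h2 := tendsto_one_sub_mul_div (hsub k hk') (div_ne_zero (hw j) (hw k)) P.t
  refine (h1.mul h2).congr' ?_
  filter_upwards [eventually_gt_atTop 0] with s hs
  have hs' : (s : ℂ) ≠ 0 := by exact_mod_cast hs.ne'
  have e1 : (s : ℂ) ^ (c j + c k) * (w j * w k) = cocharCurve c w s j * cocharCurve c w s k := by
    rw [cocharCurve, cocharCurve, zpow_add₀ hs']; ring
  have e2 : (s : ℂ) ^ (c j - c k) * (w j / w k) = cocharCurve c w s j / cocharCurve c w s k := by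
    rw [cocharCurve, cocharCurve, zpow_sub₀ hs', div_mul_div_comm]
  rw [e1, e2]

/-- The pairing of a coweight with a weight. -/
def weightPairing {n : ℕ} (c l : Fin n → ℤ) : ℤ := ∑ j, c j * l j

theorem laurentMonomial_cocharCurve {n : ℕ} (c l : Fin n → ℤ) (w : Fin n → ℂ) {s : ℝ}
    (hs : s ≠ 0) :
    laurentMonomial l (cocharCurve c w s) = (s : ℂ) ^ weightPairing c l * laurentMonomial l w := by
  have hs' : (s : ℂ) ≠ 0 := by exact_mod_cast hs
  have key : ∀ t : Finset (Fin n), (s : ℂ) ^ (∑ j ∈ t, c j * l j) = ∏ j ∈ t, (s : ℂ) ^ (c j * l j) :=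
    fun t => by
      induction t using Finset.cons_induction with
      | empty => simp
      | cons a t h ih => rw [Finset.sum_cons, Finset.prod_cons, zpow_add₀ hs', ih]
  rw [weightPairing, key, laurentMonomial, laurentMonomial, ← Finset.prod_mul_distrib]
  refine Finset.prod_congr rfl fun j _ => ?_
  rw [cocharCurve, mul_zpow, zpow_mul]

theorem tendsto_orbitSum {n : ℕ} {l : Fin n → ℤ} (hl : IsDominant l) {c : Fin n → ℤ}
    (hc : StrictAnti c) (hc0 : ∀ j, 0 < c j) (w : Fin n → ℂ) :
    Tendsto (fun s : ℝ => orbitSum l (cocharCurve c w s) * (s : ℂ) ^ (-weightPairing c l)) atTop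
      (𝓝 (laurentMonomial l w)) := by
  have h : Tendsto (fun s : ℝ => ∑ m ∈ weylOrbit l,
      (s : ℂ) ^ (weightPairing c m - weightPairing c l) * laurentMonomial m w) atTop
      (𝓝 (∑ m ∈ weylOrbit l, if m = l then laurentMonomial l w else 0)) := by
    refine tendsto_finsetSum _ fun m hm => ?_
    split_ifs with hml
    · simp [hml]
    · have := (tendsto_ofReal_zpow_neg (sub_neg.2
        (sum_mul_lt_of_mem_weylOrbit hl hm hml hc hc0))).mul_const (laurentMonomial m w)
      rwa [zero_mul] at this
  rw [Finset.sum_ite_eq' (weylOrbit l) l, if_pos (self_mem_weylOrbit l)] at h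
  refine h.congr' ?_
  filter_upwards [eventually_gt_atTop 0] with s hs
  have hs' : (s : ℂ) ≠ 0 := by exact_mod_cast hs.ne'
  rw [orbitSum, Finset.sum_mul]
  refine Finset.sum_congr rfl fun m _ => ?_
  rw [laurentMonomial_cocharCurve c m w hs.ne', sub_eq_add_neg, zpow_add₀ hs']
  ring

theorem laurentMonomial_update_mul {n : ℕ} (l : Fin n → ℤ) (w : Fin n → ℂ) (j : Fin n) (a : ℂ) :
    laurentMonomial l (Function.update w j (a * w j)) = a ^ l j * laurentMonomial l w := by
  unfold laurentMonomial
  rw [← Finset.mul_prod_erase _ _ (Finset.mem_univ j), ← Finset.mul_prod_erase Finset.univ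
    (fun k => w k ^ l k) (Finset.mem_univ j), Function.update_self, mul_zpow, mul_assoc]
  congr 2
  exact Finset.prod_congr rfl fun k hk => by
    rw [Function.update_of_ne (Finset.ne_of_mem_erase hk)]

/-- The eigenvalue of Koornwinder's difference operator. -/
noncomputable def eigenvalue (P : Params) {n : ℕ} (l : Fin n → ℤ) : ℂ :=
  ∑ j, ((∏ i, P.coef i) / P.q * (∏ k ∈ Finset.univ.erase j, (P.t * if j < k then P.t else 1)) *
      (P.q ^ l j - 1) +
    (∏ k ∈ Finset.univ.erase j, if k < j then P.t else 1) * (P.q ^ (-l j) - 1))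

/-- Every shift coefficient has a finite limit along the curve, fixed by the signs of c_j and c_j ±
c_k, and each shift multiplies the leading monomial by q^{l_j} or q^{-l_j}. -/
theorem tendsto_koornwinderOp (P : Params) {n : ℕ} {l : Fin n → ℤ} (hl : IsDominant l)
    {c : Fin n → ℤ} (hc : StrictAnti c) (hc0 : ∀ j, 0 < c j) {w : Fin n → ℂ}
    (hw : ∀ k, w k ≠ 0) :
    Tendsto (fun s : ℝ => koornwinderOp P (orbitSum l) (cocharCurve c w s) *
      (s : ℂ) ^ (-weightPairing c l)) atTop (𝓝 (eigenvalue P l * laurentMonomial l w)) := by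
  have hq := q_ne_zero P
  simp only [koornwinderOp, eigenvalue, Finset.sum_mul, add_mul]
  refine tendsto_finsetSum _ fun j _ => Tendsto.add ?_ ?_
  · have h1 := tendsto_shiftCoeff P (c := c) hw (j := j) (hc0 j).ne'
      (fun k _ => (add_pos (hc0 j) (hc0 k)).ne') (fun k hk => sub_ne_zero.2 (hc.injective.ne hk.symm))
    have h2 := (tendsto_orbitSum hl hc hc0 (Function.update w j (P.q * w j))).sub
      (tendsto_orbitSum hl hc hc0 w)
    have h3 := h1.mul h2
    rw [if_pos (hc0 j), laurentMonomial_update_mul] at h3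
    have hlim : ∏ k ∈ Finset.univ.erase j, ((if 0 < c j + c k then P.t else 1) *
        (if 0 < c j - c k then P.t else 1)) =
        ∏ k ∈ Finset.univ.erase j, (P.t * if j < k then P.t else 1) := by
      refine Finset.prod_congr rfl fun k _ => ?_
      rw [if_pos (add_pos (hc0 j) (hc0 k))]
      congr 1
      simp only [sub_pos, hc.lt_iff_gt]
    rw [hlim, show ∀ a b x : ℂ, a * (b * x - x) = a * (b - 1) * x by intros; ring] at h3
    refine h3.congr fun s => ?_
    rw [shiftTerm, cocharCurve_update_mul]
    ring
  · set c' := Function.update c j (-c j)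
    set w' := Function.update w j (w j)⁻¹
    have hc'j : c' j = -c j := Function.update_self _ _ _
    have hc'k : ∀ k, k ≠ j → c' k = c k := fun k hk => Function.update_of_ne hk _ _
    have hw' : ∀ k, w' k ≠ 0 := fun k => by
      rcases eq_or_ne k j with rfl | h
      · simp [w', hw]
      · simp [w', h, hw]
    have h1 := tendsto_shiftCoeff P (c := c') hw' (j := j) (by rw [hc'j]; exact (neg_neg_of_pos (hc0 j)).ne)
      (fun k hk => by
        rw [hc'j, hc'k k hk, neg_add_eq_sub]
        exact sub_ne_zero.2 (hc.injective.ne hk))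
      (fun k hk => by
        rw [hc'j, hc'k k hk]
        have := hc0 j
        have := hc0 k
        omega)
    -- The orbit sum is invariant under inversion of a variable, so shifting z_j⁻¹ to q z_j⁻¹
    -- amounts to shifting z_j to q⁻¹ z_j.
    have h2 := (tendsto_orbitSum hl hc hc0 (Function.update w j (P.q⁻¹ * w j))).sub
      (tendsto_orbitSum hl hc hc0 w)
    have h3 := h1.mul h2
    rw [if_neg (by rw [hc'j]; have := hc0 j; omega), laurentMonomial_update_mul] at h3
    have hlim : ∏ k ∈ Finset.univ.erase j, ((if 0 < c' j + c' k then P.t else 1) *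
        (if 0 < c' j - c' k then P.t else 1)) =
        ∏ k ∈ Finset.univ.erase j, if k < j then P.t else 1 := by
      refine Finset.prod_congr rfl fun k hk => ?_
      rw [hc'j, hc'k k (Finset.ne_of_mem_erase hk), if_neg (by
        have := hc0 j
        have := hc0 k
        omega : ¬ 0 < -c j - c k), mul_one, neg_add_eq_sub]
      simp only [sub_pos, hc.lt_iff_gt]
    rw [hlim, show ∀ a b x : ℂ, 1 * a * (b * x - x) = a * (b - 1) * x by intros; ring, inv_zpow,
      ← zpow_neg] at h3
    refine h3.congr fun s => ?_
    have e1 : Function.update (Function.update (cocharCurve c w s) j (cocharCurve c w s j)⁻¹) j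
        (P.q * Function.update (cocharCurve c w s) j (cocharCurve c w s j)⁻¹ j) =
        Function.update (cocharCurve c w s) j (P.q⁻¹ * cocharCurve c w s j)⁻¹ := by
      rw [Function.update_self, Function.update_idem, mul_inv, inv_inv]
    have e2 : orbitSum l (Function.update (cocharCurve c w s) j (cocharCurve c w s j)⁻¹) =
        orbitSum l (cocharCurve c w s) := by
      rw [orbitSum_update_inv, Function.update_eq_self]
    rw [shiftTerm, e1, e2, orbitSum_update_inv, cocharCurve_update_mul, cocharCurve_update_inv]
    ring

/-! ### Leading coefficients from limits -/

/-- If E were the largest positive exponent with nonzero coefficient, multiplication by s^{-E} would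
send the sum both to 0 and to that coefficient. -/
theorem leadingCoeff_of_tendsto {T : Finset ℤ} {b : ℤ → ℂ} {L : ℂ}
    (h : Tendsto (fun s : ℝ => ∑ e ∈ T, b e * (s : ℂ) ^ e) atTop (𝓝 L)) :
    (∀ e ∈ T, 0 < e → b e = 0) ∧ (if 0 ∈ T then b 0 else 0) = L := by
  have key : ∀ E : ℤ, (∀ e ∈ T, E < e → b e = 0) →
      Tendsto (fun s : ℝ => ∑ e ∈ T, b e * (s : ℂ) ^ (e - E)) atTop
        (𝓝 (if E ∈ T then b E else 0)) := by
    intro E hE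
    have : Tendsto (fun s : ℝ => ∑ e ∈ T, b e * (s : ℂ) ^ (e - E)) atTop
        (𝓝 (∑ e ∈ T, if e = E then b E else 0)) := by
      refine tendsto_finsetSum _ fun e he => ?_
      rcases lt_trichotomy e E with h | h | h
      · rw [if_neg h.ne]
        have := (tendsto_ofReal_zpow_neg (sub_neg.2 h)).const_mul (b e)
        rwa [mul_zero] at this
      · simp [h]
      · rw [if_neg h.ne', hE e he h]
        simp
    rwa [Finset.sum_ite_eq'] at this
  have hpos : ∀ e ∈ T, 0 < e → b e = 0 := by
    by_contra! hcon
    obtain ⟨e₀, he₀, hpos₀, hb₀⟩ := hcon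
    set U := T.filter fun e => 0 < e ∧ b e ≠ 0
    have hU : U.Nonempty := ⟨e₀, Finset.mem_filter.2 ⟨he₀, hpos₀, hb₀⟩⟩
    obtain ⟨hET, hE0, hbE⟩ := Finset.mem_filter.1 (U.max'_mem hU)
    set E := U.max' hU
    have h1 := key E fun e he hlt => by
      by_contra hb
      exact absurd (U.le_max' e (Finset.mem_filter.2 ⟨he, hE0.trans hlt, hb⟩)) (not_le.2 hlt)
    have h2 := (tendsto_ofReal_zpow_neg (neg_lt_zero.2 hE0)).mul h
    rw [zero_mul] at h2
    rw [if_pos hET] at h1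
    refine hbE (tendsto_nhds_unique h1 (h2.congr' ?_))
    filter_upwards [eventually_gt_atTop 0] with s hs
    have hs' : (s : ℂ) ≠ 0 := by exact_mod_cast hs.ne'
    rw [Finset.mul_sum]
    refine Finset.sum_congr rfl fun e _ => ?_
    rw [sub_eq_add_neg, zpow_add₀ hs']
    ring
  refine ⟨hpos, tendsto_nhds_unique (key 0 hpos) ?_⟩
  simpa using h

/-- Several indices may share an exponent, so only the sums of coefficients over the fibres of `d`
are determined. -/
theorem leadingCoeff_of_tendsto_sum {ι : Type*} {S : Finset ι} {a : ι → ℂ} {d : ι → ℤ} {L : ℂ}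
    (h : Tendsto (fun s : ℝ => ∑ m ∈ S, a m * (s : ℂ) ^ d m) atTop (𝓝 L)) :
    (∀ e, 0 < e → ∑ m ∈ S with d m = e, a m = 0) ∧ ∑ m ∈ S with d m = 0, a m = L := by
  have h' : Tendsto (fun s : ℝ => ∑ e ∈ S.image d, (∑ m ∈ S with d m = e, a m) * (s : ℂ) ^ e)
      atTop (𝓝 L) := by
    refine h.congr fun s => ?_
    rw [← Finset.sum_fiberwise_of_maps_to (fun m hm => Finset.mem_image_of_mem d hm)]
    refine Finset.sum_congr rfl fun e _ => ?_
    rw [Finset.sum_mul]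
    exact Finset.sum_congr rfl fun m hm => by rw [(Finset.mem_filter.1 hm).2]
  have hempty : ∀ e, e ∉ S.image d → ∑ m ∈ S with d m = e, a m = 0 := fun e he =>
    Finset.sum_eq_zero fun m hm => absurd (Finset.mem_image.2
      ⟨m, (Finset.mem_filter.1 hm).1, (Finset.mem_filter.1 hm).2⟩) he
  obtain ⟨h1, h2⟩ := leadingCoeff_of_tendsto h'
  refine ⟨fun e he => ?_, ?_⟩
  · by_cases hm : e ∈ S.image d
    · exact h1 e hm he
    · exact hempty e hm
  · split_ifs at h2 with hm
    · exact h2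
    · rw [← h2]; exact hempty 0 hm

/-! ### Laurent expansions -/

theorem laurentMonomial_add_single {n : ℕ} (m : Fin n → ℤ) (j : Fin n) (e : ℤ) {z : Fin n → ℂ}
    (hz : ∀ k, z k ≠ 0) :
    laurentMonomial (m + Pi.single j e) z = laurentMonomial m z * z j ^ e := by
  simp only [laurentMonomial, Pi.add_apply, zpow_add₀ (hz _), Finset.prod_mul_distrib]
  congr 1
  rw [Finset.prod_eq_single j]
  · simp
  · intro k _ hk
    simp [Pi.single_eq_of_ne hk]
  · simp

theorem exists_laurent_expansion {n : ℕ} (p : MvPolynomial (Fin n) ℂ) :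
    ∃ a : (Fin n → ℤ) →₀ ℂ, ∀ z : Fin n → ℂ, (∀ j, z j ≠ 0) →
      MvPolynomial.eval (joukowski ∘ z) p = a.sum fun m c => c * laurentMonomial m z := by
  induction p using MvPolynomial.induction_on with
  | C c =>
    refine ⟨Finsupp.single 0 c, fun z _ => ?_⟩
    rw [Finsupp.sum_single_index (zero_mul _)]
    simp [laurentMonomial]
  | add p q hp hq =>
    obtain ⟨a, ha⟩ := hp
    obtain ⟨b, hb⟩ := hq
    refine ⟨a + b, fun z hz => ?_⟩
    rw [map_add, ha z hz, hb z hz, Finsupp.sum_add_index' (by simp) (fun _ _ _ => add_mul _ _ _)]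
  | mul_X p j hp =>
    obtain ⟨a, ha⟩ := hp
    refine ⟨a.mapDomain (· + Pi.single j 1) + a.mapDomain (· + Pi.single j (-1)), fun z hz => ?_⟩
    rw [map_mul, ha z hz, MvPolynomial.eval_X,
      Finsupp.sum_add_index' (by simp) (fun _ _ _ => add_mul _ _ _),
      Finsupp.sum_mapDomain_index (by simp) (fun _ _ _ => add_mul _ _ _),
      Finsupp.sum_mapDomain_index (by simp) (fun _ _ _ => add_mul _ _ _), ← Finsupp.sum_add,
      Finsupp.sum_mul]
    refine Finsupp.sum_congr fun m _ => ?_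
    rw [laurentMonomial_add_single m j _ hz, laurentMonomial_add_single m j _ hz]
    simp only [Function.comp, joukowski, zpow_one, zpow_neg]
    ring

theorem weightLE_of_forall_weightPairing_le {n : ℕ} {m l : Fin n → ℤ}
    (h : ∀ c : Fin n → ℤ, StrictAnti c → (∀ j, 0 < c j) → weightPairing c m ≤ weightPairing c l) :
    WeightLE m l := by
  intro k
  by_contra! hlt
  set A : ℤ := ∑ j : Fin n, ((n : ℤ) - j) * m j
  set B : ℤ := ∑ j : Fin n, ((n : ℤ) - j) * l j
  set N : ℤ := |A| + |B| + 1
  have hN : 0 < N := by positivity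
  -- A large multiple of the indicator of j ≤ k, which pairs to the k-th partial sum, perturbed by n
  -- - j to become positive and strictly decreasing. `N` is large enough for a violated integer
  -- inequality to outweigh the perturbation.
  have key := h (fun j => (if j ≤ k then N else 0) + ((n : ℤ) - j)) ?_ ?_
  · have hs : ∀ r : Fin n → ℤ,
        weightPairing (fun j => (if j ≤ k then N else 0) + ((n : ℤ) - j)) r =
        N * ∑ j ∈ Finset.Iic k, r j + ∑ j : Fin n, ((n : ℤ) - j) * r j := by
      intro r
      simp only [weightPairing, add_mul, Finset.sum_add_distrib, ite_mul, zero_mul]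
      congr 1
      rw [← Finset.sum_filter, Finset.mul_sum]
      refine Finset.sum_congr ?_ fun _ _ => rfl
      ext j
      simp
    rw [hs, hs] at key
    have hA := neg_abs_le A
    have hB := le_abs_self B
    nlinarith
  · intro i j hij
    have h1 : (i : ℤ) < j := by exact_mod_cast hij
    dsimp only
    split_ifs with h2 h3 h3
    · omega
    · exact absurd (hij.le.trans h2) h3
    · omega
    · omega
  · intro j
    have h1 : (j : ℤ) < n := by exact_mod_cast j.2
    split_ifs <;> omega

/-- The support and the leading coefficient of a Laurent polynomial with prescribed growth. -/
theorem support_of_tendsto {n : ℕ} {a : (Fin n → ℤ) →₀ ℂ} {l : Fin n → ℤ} {E : ℂ}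
    (h : ∀ c : Fin n → ℤ, StrictAnti c → (∀ j, 0 < c j) → ∀ x : Fin n → ℝ,
      Tendsto (fun s : ℝ =>
        (a.sum fun m r => r * laurentMonomial m (cocharCurve c (torusExp x) s)) *
          (s : ℂ) ^ (-weightPairing c l)) atTop (𝓝 (E * fourierExp l x))) :
    (∀ m, a m ≠ 0 → WeightLE m l) ∧ a l = E := by
  have h' : ∀ c : Fin n → ℤ, StrictAnti c → (∀ j, 0 < c j) → ∀ x : Fin n → ℝ,
      Tendsto (fun s : ℝ => ∑ m ∈ a.support, (a m * fourierExp m x) *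
        (s : ℂ) ^ (weightPairing c m - weightPairing c l)) atTop (𝓝 (E * fourierExp l x)) := by
    intro c hc hc0 x
    refine (h c hc hc0 x).congr' ?_
    filter_upwards [eventually_gt_atTop 0] with s hs
    have hs' : (s : ℂ) ≠ 0 := by exact_mod_cast hs.ne'
    rw [Finsupp.sum, Finset.sum_mul]
    refine Finset.sum_congr rfl fun m _ => ?_
    rw [laurentMonomial_cocharCurve c m _ hs.ne', sub_eq_add_neg, zpow_add₀ hs', fourierExp_eq]
    ring
  constructor
  · intro m hm
    refine weightLE_of_forall_weightPairing_le fun c hc hc0 => ?_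
    by_contra! hlt
    -- Different weights may grow at the same rate along the curve; they are separated by letting
    -- the base point x vary and using independence of characters.
    have key : ∀ x, ∑ m' ∈ a.support with weightPairing c m' - weightPairing c l =
        weightPairing c m - weightPairing c l, a m' * fourierExp m' x = 0 := fun x =>
      (leadingCoeff_of_tendsto_sum (h' c hc hc0 x)).1 _ (sub_pos.2 hlt)
    exact hm (eq_zero_of_sum_fourierExp_eq_zero key
      (Finset.mem_filter.2 ⟨Finsupp.mem_support_iff.2 hm, rfl⟩))
  · set c : Fin n → ℤ := fun j => (n : ℤ) - j
    have hc : StrictAnti c := fun i j hij => by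
      have h1 : (i : ℤ) < j := by exact_mod_cast hij
      simp only [c]
      omega
    have hc0 : ∀ j, 0 < c j := fun j => by
      have h1 : (j : ℤ) < n := by exact_mod_cast j.2
      simp only [c]
      omega
    set U := a.support.filter fun m' => weightPairing c m' - weightPairing c l = 0
    have key : ∀ x, ∑ m' ∈ U, a m' * fourierExp m' x = E * fourierExp l x := fun x =>
      (leadingCoeff_of_tendsto_sum (h' c hc hc0 x)).2
    -- The index `l` is inserted because it need not lie in the support, namely when its
    -- coefficient, and then E, vanishes.
    have key2 : ∀ x, ∑ m' ∈ insert l U, ((if m' ∈ U then a m' else 0) - (if m' = l then E else 0)) *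
        fourierExp m' x = 0 := by
      intro x
      simp only [sub_mul, Finset.sum_sub_distrib, ite_mul, zero_mul, Finset.sum_ite_eq',
        Finset.mem_insert_self, if_true]
      rw [← key x, sub_eq_zero, ← Finset.sum_filter]
      refine Finset.sum_congr ?_ fun _ _ => rfl
      ext m
      simp only [Finset.mem_filter, Finset.mem_insert]
      tauto
    have h0 := eq_zero_of_sum_fourierExp_eq_zero key2 (Finset.mem_insert_self l U)
    rw [if_pos rfl] at h0
    by_cases hl : a l = 0
    · rw [hl, ite_self] at h0
      rw [hl]
      linear_combination h0
    · rw [if_pos (Finset.mem_filter.2 ⟨Finsupp.mem_support_iff.2 hl, sub_self _⟩)] at h0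
      linear_combination h0

/-! ### Invariant trigonometric polynomials -/

theorem mapDomain_eq_of_invariant {n : ℕ} {a : (Fin n → ℤ) →₀ ℂ} (g : (Fin n → ℤ) → (Fin n → ℤ))
    (h : ∀ x, (a.sum fun m r => r * fourierExp (g m) x) = a.sum fun m r => r * fourierExp m x) :
    a.mapDomain g = a := by
  have hli := linearIndependent_fourierExp n
  apply hli
  rw [Finsupp.linearCombination_mapDomain]
  funext x
  simp only [Finsupp.linearCombination_apply, Finsupp.sum, Finset.sum_apply, Pi.smul_apply,
    smul_eq_mul, Function.comp]
  exact h x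

theorem sum_eq_sum_monomial {n : ℕ} {a : (Fin n → ℤ) →₀ ℂ}
    (ha : ∀ w m, a (weylAct w m) = a m) {T : Finset (Fin n → ℤ)}
    (hT : ∀ l, l ∈ T ↔ a l ≠ 0 ∧ IsDominant l) (x : Fin n → ℝ) :
    (a.sum fun m r => r * fourierExp m x) = ∑ l ∈ T, a l * monomial l x := by
  have hconst : ∀ l, ∀ m ∈ weylOrbit l, a m = a l := fun l m hm => by
    obtain ⟨w, rfl⟩ := mem_weylOrbit.1 hm
    exact ha w l
  have hU : T.biUnion weylOrbit = a.support := by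
    ext m
    rw [Finset.mem_biUnion, Finsupp.mem_support_iff]
    constructor
    · rintro ⟨l, hl, hm⟩
      rw [hconst l m hm]
      exact ((hT l).1 hl).1
    · intro hm
      obtain ⟨l, hl, hdom⟩ := exists_dominant_mem_weylOrbit m
      exact ⟨l, (hT l).2 ⟨by rwa [hconst m l hl], hdom⟩, weylOrbit_symm hl⟩
  rw [Finsupp.sum, ← hU, Finset.sum_biUnion (pairwiseDisjoint_weylOrbit fun l hl => ((hT l).1 hl).2)]
  refine Finset.sum_congr rfl fun l _ => ?_
  rw [monomial, Finset.mul_sum]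
  exact Finset.sum_congr rfl fun m hm => by rw [hconst l m hm]

/-! ### Symmetry of the difference operator -/

theorem shiftTerm_comp_perm (P : Params) {n : ℕ} (σ : Equiv.Perm (Fin n)) {f : (Fin n → ℂ) → ℂ}
    (hf : ∀ z, f (z ∘ σ) = f z) (j : Fin n) (z : Fin n → ℂ) :
    shiftTerm P j f (z ∘ σ) = shiftTerm P (σ j) f z := by
  have hupd : ∀ a, Function.update (z ∘ σ) j a = Function.update z (σ j) a ∘ σ := fun a => by
    rw [Function.update_comp_equiv, Equiv.symm_apply_apply]
  have hcoeff : shiftCoeff P j (z ∘ σ) = shiftCoeff P (σ j) z := by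
    unfold shiftCoeff
    congr 1
    refine Finset.prod_equiv σ (fun k => ?_) fun _ _ => rfl
    simp
  rw [shiftTerm, shiftTerm, hcoeff, hupd, hf, hf]
  rfl

theorem koornwinderOp_comp_perm (P : Params) {n : ℕ} (σ : Equiv.Perm (Fin n))
    {f : (Fin n → ℂ) → ℂ} (hf : ∀ z, f (z ∘ σ) = f z) (z : Fin n → ℂ) :
    koornwinderOp P f (z ∘ σ) = koornwinderOp P f z := by
  unfold koornwinderOp
  rw [← Equiv.sum_comp σ fun j => shiftTerm P j f z + shiftTerm P j f (Function.update z j (z j)⁻¹)]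
  refine Finset.sum_congr rfl fun j _ => ?_
  have hupd : ∀ a, Function.update (z ∘ σ) j a = Function.update z (σ j) a ∘ σ := fun a => by
    rw [Function.update_comp_equiv, Equiv.symm_apply_apply]
  rw [shiftTerm_comp_perm P σ hf, hupd, shiftTerm_comp_perm P σ hf]
  rfl

/-! ### Generic points are regular -/

theorem torusExp_update_neg {n : ℕ} (x : Fin n → ℝ) (j : Fin n) :
    torusExp (Function.update x j (-x j)) =
      Function.update (torusExp x) j (torusExp x j)⁻¹ := by
  funext k
  rcases eq_or_ne k j with rfl | h
  · simp only [torusExp, Function.update_self, exp_I_mul_neg]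
  · simp [torusExp, h]

theorem exp_I_mul_add (x y : ℝ) : Complex.exp (Complex.I * ((x + y : ℝ) : ℂ)) =
    Complex.exp (Complex.I * x) * Complex.exp (Complex.I * y) := by
  rw [← Complex.exp_add]
  push_cast
  ring_nf

theorem exp_I_mul_sub (x y : ℝ) : Complex.exp (Complex.I * ((x - y : ℝ) : ℂ)) =
    Complex.exp (Complex.I * x) / Complex.exp (Complex.I * y) := by
  rw [← Complex.exp_sub]
  push_cast
  ring_nf

theorem IsGeneric.regularAt {P : Params} (hP : P.Regular) {n : ℕ} {x : Fin n → ℝ}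
    (hx : IsGeneric x) (j : Fin n) : RegularAt P j (torusExp x) := by
  have hne : ∀ {a : ℂ}, ‖a‖ < 1 → a * torusExp x j ^ 2 ≠ 1 := fun {a} ha h => by
    have := congrArg norm h
    rw [norm_mul, norm_pow, torusExp, norm_exp_I_mul, one_pow, mul_one, norm_one] at this
    exact ha.ne this
  refine ⟨torusExp_ne_zero x, hx.1 j, hne (norm_q_lt_one hP.β), hne hP.norm_t_lt_one,
    fun k hk h => ?_, fun k hk h => ?_⟩
  · exact (hx.2 j k hk.symm).1 (by rw [exp_I_mul_add]; exact h)
  · refine (hx.2 j k hk.symm).2 ?_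
    rw [exp_I_mul_sub, div_eq_one_iff_eq (Complex.exp_ne_zero _)]
    exact h

theorem IsGeneric.update_neg {n : ℕ} {x : Fin n → ℝ} (hx : IsGeneric x) (j : Fin n) :
    IsGeneric (Function.update x j (-x j)) := by
  have hneg : ∀ y : ℝ, Complex.exp (Complex.I * (y : ℂ)) ≠ 1 →
      Complex.exp (Complex.I * ((-y : ℝ) : ℂ)) ≠ 1 := fun y hy h => by
    rw [exp_I_mul_neg] at h
    exact hy (inv_eq_one.1 h)
  refine ⟨fun k => ?_, fun k m hkm => ?_⟩
  · rcases eq_or_ne k j with rfl | h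
    · rw [Function.update_self, exp_I_mul_neg, inv_pow]
      exact fun h => hx.1 k (inv_eq_one.1 h)
    · rw [Function.update_of_ne h]
      exact hx.1 k
  · have h := hx.2 k m hkm
    rcases eq_or_ne k j with rfl | hk
    · rw [Function.update_self, Function.update_of_ne hkm.symm]
      refine ⟨?_, ?_⟩
      · have := hneg _ h.2
        rwa [neg_sub, sub_eq_neg_add] at this
      · have := hneg _ h.1
        rwa [neg_add] at this
    · rw [Function.update_of_ne hk]
      rcases eq_or_ne m j with rfl | hm
      · rw [Function.update_self]
        exact ⟨by simpa [sub_eq_add_neg] using h.2, by simpa using h.1⟩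
      · rw [Function.update_of_ne hm]
        exact h

theorem IsGeneric.comp_perm {n : ℕ} {x : Fin n → ℝ} (hx : IsGeneric x) (σ : Equiv.Perm (Fin n)) :
    IsGeneric (x ∘ σ) :=
  ⟨fun j => hx.1 (σ j), fun j k hjk => hx.2 (σ j) (σ k) (σ.injective.ne hjk)⟩

theorem IsGeneric.regularPoint {P : Params} (hP : P.Regular) {n : ℕ} {x : Fin n → ℝ}
    (hx : IsGeneric x) : RegularPoint P (torusExp x) := fun j => by
  refine ⟨hx.regularAt hP j, ?_⟩
  rw [← torusExp_update_neg]
  exact (hx.update_neg j).regularAt hP j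

/-! ### Triangularity -/

/-- The operator is permutation-equivariant, but equals the polynomial only at regular points.
Generic points have full measure, and continuous functions that agree almost everywhere agree. -/
theorem eval_comp_perm_of_koornwinderOp_eq {P : Params} (hP : P.Regular) {n : ℕ} {l : Fin n → ℤ}
    {p : MvPolynomial (Fin n) ℂ} (hp : ∀ z : Fin n → ℂ, RegularPoint P z →
      koornwinderOp P (orbitSum l) z = MvPolynomial.eval (joukowski ∘ z) p)
    (σ : Equiv.Perm (Fin n)) (x : Fin n → ℝ) :
    MvPolynomial.eval (joukowski ∘ torusExp (x ∘ σ)) p =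
      MvPolynomial.eval (joukowski ∘ torusExp x) p := by
  set F : (Fin n → ℝ) → ℂ := fun x => MvPolynomial.eval (joukowski ∘ torusExp x) p with hF
  have hJ : Continuous fun x : Fin n → ℝ => joukowski ∘ torusExp x := by
    refine continuous_pi fun j => ?_
    simp only [Function.comp, joukowski, torusExp, ← exp_I_mul_neg]
    fun_prop
  have hcont : Continuous F := (MvPolynomial.continuous_eval p).comp hJ
  have hc' : Continuous fun x : Fin n → ℝ => x ∘ σ := by fun_prop
  have h : (fun x => F (x ∘ σ)) =ᵐ[MeasureTheory.volume] F := by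
    filter_upwards [ae_isGeneric n] with y hy
    rw [hF]
    dsimp only
    rw [← hp _ (hy.regularPoint hP), ← hp _ ((hy.comp_perm σ).regularPoint hP),
      show torusExp (y ∘ σ) = torusExp y ∘ σ from rfl]
    exact koornwinderOp_comp_perm P σ (orbitSum_comp_perm σ l) _
  exact congrFun ((Continuous.ae_eq_iff_eq MeasureTheory.volume (hcont.comp hc') hcont).1 h) x

/-- Koornwinder's operator is triangular on the orbit sums. -/
theorem exists_koornwinderOp_eq_lower {P : Params} (hP : P.Regular) {n : ℕ} {l : Fin n → ℤ}
    (hl : IsDominant l) :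
    ∃ h ∈ lowerSpan l, ∀ x : Fin n → ℝ, IsGeneric x →
      koornwinderOp P (orbitSum l) (torusExp x) = eigenvalue P l * monomial l x + h x := by
  obtain ⟨p, hp⟩ := exists_koornwinderOp_orbitSum_eq hP l
  obtain ⟨a, ha⟩ := exists_laurent_expansion p
  have hF : ∀ x, MvPolynomial.eval (joukowski ∘ torusExp x) p =
      a.sum fun m r => r * fourierExp m x := fun x => by
    rw [ha _ (torusExp_ne_zero x)]
    simp only [fourierExp_eq]
  obtain ⟨hsupp, hlead⟩ := support_of_tendsto (a := a) (l := l) (E := eigenvalue P l) (by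
    intro c hc hc0 x
    have hw := torusExp_ne_zero x
    have h1 := tendsto_koornwinderOp P hl hc hc0 hw
    rw [← fourierExp_eq] at h1
    refine h1.congr' ?_
    have hreg : ∀ᶠ s in atTop, RegularPoint P (cocharCurve c (torusExp x) s) := by
      refine eventually_all.2 fun j => Filter.Eventually.and ?_ ?_
      · exact eventually_regularAt hw (hc0 j).ne' (fun k _ => (add_pos (hc0 j) (hc0 k)).ne')
          (fun k hk => sub_ne_zero.2 (hc.injective.ne hk.symm))
      · simp only [cocharCurve_update_inv]
        refine eventually_regularAt (fun k => ?_) ?_ (fun k hk => ?_) (fun k hk => ?_)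
        · rcases eq_or_ne k j with rfl | h
          · simp [hw]
          · simp [h, hw]
        · simpa using (hc0 j).ne'
        · rw [Function.update_self, Function.update_of_ne hk, neg_add_eq_sub]
          exact sub_ne_zero.2 (hc.injective.ne hk)
        · rw [Function.update_self, Function.update_of_ne hk]
          have := hc0 j
          have := hc0 k
          omega
    filter_upwards [hreg, eventually_gt_atTop 0] with s hs hs0
    have hs' : (s : ℂ) ≠ 0 := by exact_mod_cast hs0.ne'
    rw [hp _ hs, ha (cocharCurve c _ s) fun j => mul_ne_zero (zpow_ne_zero _ hs') (hw j)])
  have hperm : ∀ (σ : Equiv.Perm (Fin n)) (x : Fin n → ℝ),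
      (a.sum fun m r => r * fourierExp m (x ∘ σ)) = a.sum fun m r => r * fourierExp m x := by
    intro σ x
    rw [← hF, ← hF]
    exact eval_comp_perm_of_koornwinderOp_eq hP hp σ x
  -- Sign changes of x leave the Joukowski coordinates fixed, so no operator argument is needed
  -- here.
  have hsign : ∀ (e : Fin n → ℤˣ) (x : Fin n → ℝ),
      (a.sum fun m r => r * fourierExp m fun j => ((e j : ℤ) : ℝ) * x j) =
        a.sum fun m r => r * fourierExp m x := by
    intro e x
    rw [← hF, ← hF]
    congr 2
    funext j
    simp only [Function.comp, torusExp]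
    rcases Int.units_eq_one_or (e j) with h | h
    · simp [h]
    · rw [h, ← joukowski_inv, ← exp_I_mul_neg]
      simp
  have hinv : ∀ w m, a (weylAct w m) = a m := by
    intro w m
    have h := mapDomain_eq_of_invariant (a := a) (weylAct w) (fun x => by
      rw [← hperm (w.1⁻¹) x, ← hsign (fun j => w.2 (w.1⁻¹ j)) (x ∘ (w.1⁻¹ : Equiv.Perm (Fin n)))]
      refine Finsupp.sum_congr fun m _ => ?_
      rw [fourierExp_eq, fourierExp_eq]
      have hz : torusExp (fun j => (((w.2 (w.1⁻¹ j) : ℤˣ) : ℤ) : ℝ) * (x ∘ (w.1⁻¹ : Equiv.Perm (Fin n))) j) =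
          weylActVar (w.1⁻¹, fun j => w.2 (w.1⁻¹ j)) (torusExp x) := by
        funext j
        simp only [torusExp, weylActVar, ← Complex.exp_int_mul]
        congr 1
        push_cast
        simp only [Function.comp]
        ring
      rw [hz, laurentMonomial_weylActVar]
      congr 2
      funext j
      simp [weylAct])
    have hinj : Function.Injective (weylAct w) := by
      intro m m' hmm
      funext j
      have := congrFun hmm (w.1⁻¹ j)
      have e : w.1 (w.1⁻¹ j) = j := Equiv.apply_symm_apply w.1 j
      simp only [weylAct, e] at this
      exact mul_left_cancel₀ (Units.ne_zero _) this
    nth_rewrite 1 [← h]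
    rw [Finsupp.mapDomain_apply hinj]
  classical
  set T := a.support.filter IsDominant
  have hT : ∀ l, l ∈ T ↔ a l ≠ 0 ∧ IsDominant l := fun l => by
    rw [Finset.mem_filter, Finsupp.mem_support_iff]
  refine ⟨∑ m ∈ T.erase l, a m • monomial m, ?_, fun x hx => ?_⟩
  · refine sum_mem fun m hm => Submodule.smul_mem _ _ (Submodule.subset_span ⟨m, ?_, rfl⟩)
    obtain ⟨hne, hm⟩ := Finset.mem_erase.1 hm
    have := (hT m).1 hm
    exact ⟨this.2, hsupp m this.1, hne⟩
  · rw [hp _ (hx.regularPoint hP), hF, sum_eq_sum_monomial hinv hT, Finset.sum_apply, ← hlead]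
    simp only [Pi.smul_apply, smul_eq_mul]
    by_cases hlT : l ∈ T
    · rw [Finset.add_sum_erase T (fun m => a m * monomial m x) hlT]
    · have h0 : a l = 0 := by
        by_contra h
        exact hlT ((hT l).2 ⟨h, hl⟩)
      rw [Finset.erase_eq_of_notMem hlT, h0, zero_mul, zero_add]

/-! ### Symmetry of the difference operator, the Gram form, and the passage to the limit. -/

open Filter Topology MeasureTheory Complex

/-! ### The contour shift -/

theorem circleIntegral_inv_smul_eq (G : ℂ → ℂ) {R : ℝ} (hR : R ≠ 0) :
    (∮ z in C(0, R), (z - 0)⁻¹ • G z) = I * ∫ θ in (0 : ℝ)..2 * Real.pi, G (R * exp (I * θ)) := by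
  rw [circleIntegral, ← intervalIntegral.integral_const_mul]
  refine intervalIntegral.integral_congr fun θ _ => ?_
  have h : circleMap 0 R θ = R * exp (I * θ) := by rw [circleMap_zero, mul_comm I]
  have h0 : circleMap 0 R θ ≠ 0 := circleMap_ne_center hR
  simp only [deriv_circleMap, sub_zero, smul_eq_mul]
  rw [mul_comm _ I, mul_assoc, mul_inv_cancel_left₀ h0, h]

theorem periodic_comp_exp (G : ℂ → ℂ) : Function.Periodic (fun θ : ℝ => G (exp (I * θ)))
    (2 * Real.pi) := fun θ => by
  have : exp (I * ((θ + 2 * Real.pi : ℝ) : ℂ)) = exp (I * θ) := by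
    push_cast
    rw [mul_add, show I * (2 * Real.pi : ℂ) = 2 * Real.pi * I by ring]
    exact exp_periodic _
  simp only [this]

/-- Shifting the contour of a kernel that is symmetric with respect to `z ↦ (ρ z)⁻¹`. -/
theorem integral_shift_symm {ρ : ℝ} (h0 : 0 < ρ) (h1 : ρ < 1) {u f h : ℂ → ℂ}
    (hu : ∀ z, 1 ≤ ‖z‖ → ‖z‖ ≤ ρ⁻¹ → DifferentiableAt ℂ u z)
    (hf : ∀ z, z ≠ 0 → DifferentiableAt ℂ f z) (hh : ∀ z, z ≠ 0 → DifferentiableAt ℂ h z)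
    (usym : ∀ z, z ≠ 0 → u (ρ * z)⁻¹ = u z) (fsym : ∀ z, f z⁻¹ = f z) (hsym : ∀ z, h z⁻¹ = h z) :
    (∫ t in -Real.pi..Real.pi, u (exp (I * t)) * f (ρ * exp (I * t)) * h (exp (I * t))) =
      ∫ t in -Real.pi..Real.pi, u (exp (I * t)) * h (ρ * exp (I * t)) * f (exp (I * t)) := by
  have hρ : (ρ : ℂ) ≠ 0 := by exact_mod_cast h0.ne'
  set G : ℂ → ℂ := fun z => u z * h (ρ * z) * f z with hG
  have hd : ∀ z, 1 ≤ ‖z‖ → ‖z‖ ≤ ρ⁻¹ → DifferentiableAt ℂ G z := fun z hz1 hz2 => by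
    have hz : z ≠ 0 := norm_pos_iff.1 (by linarith)
    have h2 : DifferentiableAt ℂ (fun z => h (ρ * z)) z :=
      (hh _ (mul_ne_zero hρ hz)).comp z ((differentiableAt_id).const_mul _)
    exact ((hu z hz1 hz2).mul h2).mul (hf z hz)
  have hshift : ∀ G : ℂ → ℂ, (∫ θ in (0 : ℝ)..2 * Real.pi, G (exp (I * θ))) =
      ∫ θ in -Real.pi..Real.pi, G (exp (I * θ)) := fun G => by
    have := (periodic_comp_exp G).intervalIntegral_add_eq 0 (-Real.pi)
    rw [zero_add] at this
    rw [this]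
    congr 1
    ring
  -- By Cauchy on the annulus, G(z) dz/z has the same integral over |z| = 1 and |z| = ρ⁻¹.
  have hcirc := Complex.circleIntegral_sub_center_inv_smul_eq_of_differentiable_on_annulus_off_countable
    (c := 0) one_pos (one_le_inv₀ h0 |>.2 h1.le) (f := G) (s := ∅) Set.countable_empty
    (fun z hz => (hd z (by simpa using hz.2) (by simpa using hz.1)).continuousAt.continuousWithinAt)
    (fun z hz => hd z (by simpa using (not_le.1 (by simpa using hz.1.2) : 1 < ‖z‖).le)
      (by simpa using (Metric.mem_ball.1 hz.1.1).le))
  rw [circleIntegral_inv_smul_eq G (inv_ne_zero h0.ne'), circleIntegral_inv_smul_eq G one_ne_zero,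
    mul_right_inj' I_ne_zero, hshift fun z => G (((ρ⁻¹ : ℝ) : ℂ) * z),
    hshift fun z => G (((1 : ℝ) : ℂ) * z)] at hcirc
  simp only [ofReal_one, one_mul] at hcirc
  rw [show (∫ t in -Real.pi..Real.pi, u (exp (I * t)) * h (ρ * exp (I * t)) * f (exp (I * t))) =
    ∫ t in -Real.pi..Real.pi, G (exp (I * t)) from rfl, ← hcirc]
  have hneg := intervalIntegral.integral_comp_neg (a := -Real.pi) (b := Real.pi)
    (fun t : ℝ => u (exp (I * t)) * f (ρ * exp (I * t)) * h (exp (I * t)))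
  rw [neg_neg] at hneg
  rw [← hneg]
  refine intervalIntegral.integral_congr fun t _ => ?_
  simp only [hG]
  -- A point of the outer circle is (ρ z')⁻¹ with z' on the unit circle. The symmetry of u brings it
  -- back to z', and t ↦ -t matches the two integrands.
  have e : ((ρ⁻¹ : ℝ) : ℂ) * exp (I * t) = (ρ * exp (I * ((-t : ℝ) : ℂ)))⁻¹ := by
    rw [exp_I_mul_neg, mul_inv, inv_inv, ofReal_inv]
  rw [e, usym _ (exp_ne_zero _), fsym, ← e, ← mul_assoc, ofReal_inv, mul_inv_cancel₀ hρ, one_mul,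
    ← hsym (exp (I * t)), ← exp_I_mul_neg]
  ring

/-! ### The kernel of the shift -/

/-- The two-particle factor of the kernel. -/
noncomputable def pairKernel (P : Params) (w : ℂ) : ℂ :=
  qFactorial (P.q * w) P.q * qFactorial w⁻¹ P.q /
    (qFactorial (P.t * (P.q * w)) P.q * qFactorial (P.t * w⁻¹) P.q)

/-- The one-particle factor of the kernel. -/
noncomputable def singleKernel (P : Params) (z : ℂ) : ℂ :=
  qFactorial ((P.q * z) ^ 2) P.q * qFactorial (z⁻¹ ^ 2) P.q /
    ((∏ i, qFactorial (P.coef i * (P.q * z)) P.q) * ∏ i, qFactorial (P.coef i * z⁻¹) P.q)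

/-- The substitution w ↦ (qw)⁻¹ exchanges qw and w⁻¹, that is, the two halves of the kernel. -/
theorem pairKernel_symm (P : Params) (w : ℂ) :
    pairKernel P (P.q * w)⁻¹ = pairKernel P w := by
  have e : P.q * (P.q * w)⁻¹ = w⁻¹ := by
    rw [mul_inv, mul_inv_cancel_left₀ (q_ne_zero P)]
  rw [pairKernel, pairKernel, e, inv_inv]
  congr 1 <;> ring

theorem singleKernel_symm (P : Params) (z : ℂ) :
    singleKernel P (P.q * z)⁻¹ = singleKernel P z := by
  have e : P.q * (P.q * z)⁻¹ = z⁻¹ := by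
    rw [mul_inv, mul_inv_cancel_left₀ (q_ne_zero P)]
  rw [singleKernel, singleKernel, e, inv_inv]
  congr 1 <;> ring

theorem norm_mul_lt_one {a b : ℂ} (ha : ‖a‖ < 1) (hb : ‖b‖ ≤ 1) : ‖a * b‖ < 1 := by
  rw [norm_mul]
  exact mul_lt_one_of_nonneg_of_lt_one_left (norm_nonneg _) ha hb

/-- The strict inequality |t| < 1 keeps the denominator nonzero on the closed annulus 1 ≤ |w| ≤ q⁻¹;
this is one place where positive couplings are needed. -/
theorem pairKernel_denom_ne_zero {P : Params} (hP : P.Regular) {w : ℂ} (h1 : 1 ≤ ‖w‖)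
    (h2 : ‖P.q * w‖ ≤ 1) :
    qFactorial (P.t * (P.q * w)) P.q * qFactorial (P.t * w⁻¹) P.q ≠ 0 := by
  have hq := norm_q_lt_one hP.β
  exact mul_ne_zero (qFactorial_ne_zero_of_norm_lt hq (norm_mul_lt_one hP.norm_t_lt_one h2))
    (qFactorial_ne_zero_of_norm_lt hq (norm_mul_lt_one hP.norm_t_lt_one
      (by rw [norm_inv]; exact inv_le_one_of_one_le₀ h1)))

theorem singleKernel_denom_ne_zero {P : Params} (hP : P.Regular) {z : ℂ} (h1 : 1 ≤ ‖z‖)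
    (h2 : ‖P.q * z‖ ≤ 1) :
    (∏ i, qFactorial (P.coef i * (P.q * z)) P.q) * ∏ i, qFactorial (P.coef i * z⁻¹) P.q ≠ 0 := by
  have hq := norm_q_lt_one hP.β
  refine mul_ne_zero (Finset.prod_ne_zero_iff.2 fun i _ => ?_)
    (Finset.prod_ne_zero_iff.2 fun i _ => ?_)
  · exact qFactorial_ne_zero_of_norm_lt hq (norm_mul_lt_one (hP.norm_coef_lt_one i) h2)
  · exact qFactorial_ne_zero_of_norm_lt hq (norm_mul_lt_one (hP.norm_coef_lt_one i)
      (by rw [norm_inv]; exact inv_le_one_of_one_le₀ h1))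

theorem differentiableAt_pairKernel {P : Params} (hP : P.Regular) {w : ℂ} (h1 : 1 ≤ ‖w‖)
    (h2 : ‖P.q * w‖ ≤ 1) : DifferentiableAt ℂ (pairKernel P) w := by
  have hw : w ≠ 0 := norm_pos_iff.1 (by linarith)
  have hF := differentiable_qFactorial (norm_q_lt_one hP.β)
  have hc : ∀ {g : ℂ → ℂ}, DifferentiableAt ℂ g w →
      DifferentiableAt ℂ (fun w => qFactorial (g w) P.q) w := fun {g} hg =>
    (hF _).comp w hg
  unfold pairKernel
  exact ((hc (by fun_prop)).mul (hc (by fun_prop (disch := assumption)))).div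
    ((hc (by fun_prop)).mul (hc (by fun_prop (disch := assumption))))
    (pairKernel_denom_ne_zero hP h1 h2)

theorem differentiableAt_singleKernel {P : Params} (hP : P.Regular) {z : ℂ} (h1 : 1 ≤ ‖z‖)
    (h2 : ‖P.q * z‖ ≤ 1) : DifferentiableAt ℂ (singleKernel P) z := by
  have hz : z ≠ 0 := norm_pos_iff.1 (by linarith)
  have hF := differentiable_qFactorial (norm_q_lt_one hP.β)
  have hc : ∀ {g : ℂ → ℂ}, DifferentiableAt ℂ g z →
      DifferentiableAt ℂ (fun z => qFactorial (g z) P.q) z := fun {g} hg =>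
    (hF _).comp z hg
  unfold singleKernel
  exact ((hc (by fun_prop)).mul (hc (by fun_prop (disch := assumption)))).div
    ((DifferentiableAt.fun_finsetProd fun i _ => hc (by fun_prop)).mul
      (DifferentiableAt.fun_finsetProd fun i _ => hc (by fun_prop (disch := assumption))))
    (singleKernel_denom_ne_zero hP h1 h2)

theorem norm_q_mul_exp_le_one {P : Params} (hβ : 0 < P.β) (x : ℝ) : ‖P.q * exp (I * x)‖ ≤ 1 := by
  rw [norm_mul_exp]
  exact (norm_q_lt_one hβ).le

theorem continuous_pairKernel_exp {P : Params} (hP : P.Regular) :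
    Continuous fun x : ℝ => pairKernel P (exp (I * x)) := by
  rw [continuous_iff_continuousAt]
  intro x
  exact ContinuousAt.comp (f := fun x : ℝ => exp (I * x)) (differentiableAt_pairKernel hP
    (norm_exp_I_mul x).ge (norm_q_mul_exp_le_one hP.β x)).continuousAt (by fun_prop)

theorem continuous_singleKernel_exp {P : Params} (hP : P.Regular) :
    Continuous fun x : ℝ => singleKernel P (exp (I * x)) := by
  rw [continuous_iff_continuousAt]
  intro x
  exact ContinuousAt.comp (f := fun x : ℝ => exp (I * x)) (differentiableAt_singleKernel hP
    (norm_exp_I_mul x).ge (norm_q_mul_exp_le_one hP.β x)).continuousAt (by fun_prop)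

/-- The functional equation splits 1 - w and 1 - tw off the half of `dA` at w; the shift coefficient
cancels them, leaving w replaced by qw there. -/
theorem dA_mul_eq_pairKernel {P : Params} (hP : P.Regular) {x : ℝ} (hx : exp (I * x) ≠ 1) :
    (1 - P.t * exp (I * x)) / (1 - exp (I * x)) * dA P x = pairKernel P (exp (I * x)) := by
  have hq := norm_q_lt_one hP.β
  have hz1 : 1 - exp (I * x) ≠ 0 := sub_ne_zero.2 hx.symm
  have ht1 : 1 - P.t * exp (I * x) ≠ 0 := sub_ne_zero.2 (mul_exp_ne_one hP.norm_t_lt_one).symm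
  rw [dA, dAPlus_eq, dAPlus_eq, exp_I_mul_neg, pairKernel, qFactorial_eq_mul hq (exp (I * x)),
    qFactorial_eq_mul hq (P.t * exp (I * x)), mul_left_comm P.q P.t]
  generalize qFactorial (P.t * (P.q * exp (I * x))) P.q = A
  generalize qFactorial (P.t * (exp (I * x))⁻¹) P.q = B
  generalize qFactorial (P.q * exp (I * x)) P.q = C
  generalize qFactorial (exp (I * x))⁻¹ P.q = D
  rw [div_mul_div_comm, div_mul_div_comm]
  rw [show (1 - P.t * exp (I * x)) * ((1 - exp (I * x)) * C * D) =
    ((1 - exp (I * x)) * (1 - P.t * exp (I * x))) * (C * D) by ring,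
    show (1 - exp (I * x)) * ((1 - P.t * exp (I * x)) * A * B) =
    ((1 - exp (I * x)) * (1 - P.t * exp (I * x))) * (A * B) by ring,
    mul_div_mul_left _ _ (mul_ne_zero hz1 ht1)]

/-- As for `dA`, except that w² must pass to (qw)² = q²w², so the functional equation is applied
twice in the numerator; this produces the factor 1 - q w² of the shift coefficient. -/
theorem dB_mul_eq_singleKernel {P : Params} (hP : P.Regular) {x : ℝ}
    (hx : exp (I * x) ^ 2 ≠ 1) :
    (∏ i, (1 - P.coef i * exp (I * x))) /
      ((1 - exp (I * x) ^ 2) * (1 - P.q * exp (I * x) ^ 2)) * dB P x =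
      singleKernel P (exp (I * x)) := by
  have hq := norm_q_lt_one hP.β
  have h1 : 1 - exp (I * x) ^ 2 ≠ 0 := sub_ne_zero.2 hx.symm
  have h2 : 1 - P.q * exp (I * x) ^ 2 ≠ 0 := by
    rw [sub_ne_zero]
    intro h
    have := congrArg norm h
    rw [norm_mul, norm_pow, norm_exp_I_mul, one_pow, mul_one, norm_one] at this
    exact hq.ne this.symm
  have h3 : ∏ i, (1 - P.coef i * exp (I * x)) ≠ 0 := Finset.prod_ne_zero_iff.2 fun i _ =>
    sub_ne_zero.2 (mul_exp_ne_one (hP.norm_coef_lt_one i)).symm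
  have e1 : qFactorial (exp (I * x) ^ 2) P.q = (1 - exp (I * x) ^ 2) *
      ((1 - P.q * exp (I * x) ^ 2) * qFactorial ((P.q * exp (I * x)) ^ 2) P.q) := by
    rw [qFactorial_eq_mul hq, qFactorial_eq_mul hq (P.q * _)]
    congr 3
    ring
  have e2 : ∏ i, qFactorial (P.coef i * exp (I * x)) P.q = (∏ i, (1 - P.coef i * exp (I * x))) *
      ∏ i, qFactorial (P.coef i * (P.q * exp (I * x))) P.q := by
    rw [← Finset.prod_mul_distrib]
    refine Finset.prod_congr rfl fun i _ => ?_
    rw [qFactorial_eq_mul hq, mul_left_comm P.q]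
  rw [dB, dBPlus_eq, dBPlus_eq, exp_I_mul_neg, singleKernel, e1, e2]
  generalize ∏ i, qFactorial (P.coef i * (P.q * exp (I * x))) P.q = A
  generalize ∏ i, qFactorial (P.coef i * (exp (I * x))⁻¹) P.q = B
  generalize qFactorial ((P.q * exp (I * x)) ^ 2) P.q = C
  generalize qFactorial ((exp (I * x))⁻¹ ^ 2) P.q = D
  generalize ∏ i, (1 - P.coef i * exp (I * x)) = E at h3 ⊢
  generalize 1 - exp (I * x) ^ 2 = F at h1 ⊢
  generalize 1 - P.q * exp (I * x) ^ 2 = G at h2 ⊢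
  rw [div_mul_div_comm, div_mul_div_comm,
    show E * (F * (G * C) * D) = (E * F * G) * (C * D) by ring,
    show F * G * (E * A * B) = (E * F * G) * (A * B) by ring,
    mul_div_mul_left _ _ (mul_ne_zero (mul_ne_zero h3 h1) h2)]

theorem continuous_weight {P : Params} (hP : P.Regular) (n : ℕ) :
    Continuous (weight P : (Fin n → ℝ) → ℂ) := by
  have hq := norm_q_lt_one hP.β
  have hF := continuous_qFactorial hq
  have hc : ∀ {g : ℝ → ℂ}, Continuous g → Continuous fun x => qFactorial (g x) P.q :=
    fun {g} hg => hF.comp hg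
  have hA : Continuous (dAPlus P) := by
    rw [funext (dAPlus_eq P)]
    refine (hc (by fun_prop)).div (hc (by fun_prop)) fun x =>
      qFactorial_ne_zero_of_norm_lt hq ?_
    rw [norm_mul_exp]
    exact hP.norm_t_lt_one
  have hB : Continuous (dBPlus P) := by
    rw [funext (dBPlus_eq P)]
    refine (hc (by fun_prop)).div (continuous_finsetProd _ fun i _ => hc (by fun_prop)) fun x =>
      Finset.prod_ne_zero_iff.2 fun i _ => qFactorial_ne_zero_of_norm_lt hq ?_
    rw [norm_mul_exp]
    exact hP.norm_coef_lt_one i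
  have hA' : Continuous (dA P) := hA.mul (hA.comp continuous_neg)
  have hB' : Continuous (dB P) := hB.mul (hB.comp continuous_neg)
  unfold weight
  refine (continuous_finsetProd _ fun j _ => continuous_finsetProd _ fun k _ => ?_).mul
    (continuous_finsetProd _ fun j _ => hB'.comp (continuous_apply j))
  exact (hA'.comp ((continuous_apply j).add (continuous_apply k))).mul
    (hA'.comp ((continuous_apply j).sub (continuous_apply k)))

/-! ### Separating one variable -/

theorem prod_erase_eq_prod_succAbove {m : ℕ} (j : Fin (m + 1)) (f : Fin (m + 1) → ℂ) :
    ∏ k ∈ Finset.univ.erase j, f k = ∏ k : Fin m, f (j.succAbove k) := by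
  have : Finset.univ.erase j = Finset.univ.image j.succAbove := by
    rw [Fin.image_succAbove_univ]
    ext k
    simp
  rw [this, Finset.prod_image fun a _ b _ h => Fin.succAbove_right_injective h]

/-- Since `dA` is even, the order of the indices in a pair is irrelevant and any variable can be
split off. -/
theorem weight_insertNth (P : Params) {m : ℕ} (j : Fin (m + 1)) (t : ℝ) (y : Fin m → ℝ) :
    weight P (j.insertNth t y : Fin (m + 1) → ℝ) =
      weight P y * (dB P t * ∏ k, (dA P (t + y k) * dA P (t - y k))) := by
  have hIoi : ∀ {n : ℕ} (x : Fin n → ℝ) (a : Fin n),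
      ∏ b ∈ Finset.Ioi a, dA P (x a + x b) * dA P (x a - x b) =
        ∏ b, if a < b then dA P (x a + x b) * dA P (x a - x b) else 1 := by
    intro n x a
    rw [← Finset.prod_filter]
    refine Finset.prod_congr ?_ fun _ _ => rfl
    ext b
    simp
  have hsym : ∀ a b : ℝ, dA P (a + b) * dA P (a - b) = dA P (b + a) * dA P (b - a) := fun a b => by
    rw [add_comm a b, ← dA_neg P (a - b), neg_sub]
  unfold weight
  simp only [hIoi]
  rw [Fin.prod_univ_succAbove (fun a : Fin (m + 1) => dB P _) j, Fin.prod_univ_succAbove _ j,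
    Fin.prod_univ_succAbove _ j]
  simp only [Fin.insertNth_apply_same, Fin.insertNth_apply_succAbove, lt_irrefl, if_false, one_mul]
  have h2 : ∀ a : Fin m, (∏ b : Fin (m + 1), if j.succAbove a < b then
      dA P (y a + (j.insertNth t y : Fin (m + 1) → ℝ) b) *
        dA P (y a - (j.insertNth t y : Fin (m + 1) → ℝ) b) else 1) =
      (if j.succAbove a < j then dA P (t + y a) * dA P (t - y a) else 1) *
        ∏ b : Fin m, if a < b then dA P (y a + y b) * dA P (y a - y b) else 1 := by
    intro a
    rw [Fin.prod_univ_succAbove _ j]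
    simp only [Fin.insertNth_apply_same, Fin.insertNth_apply_succAbove,
      (Fin.strictMono_succAbove j).lt_iff_lt]
    rw [hsym]
  simp only [h2, Finset.prod_mul_distrib]
  have h3 : (∏ k : Fin m, if j < j.succAbove k then dA P (t + y k) * dA P (t - y k) else 1) *
      (∏ k : Fin m, if j.succAbove k < j then dA P (t + y k) * dA P (t - y k) else 1) =
      (∏ k, dA P (t + y k)) * ∏ k, dA P (t - y k) := by
    rw [← Finset.prod_mul_distrib, ← Finset.prod_mul_distrib]
    refine Finset.prod_congr rfl fun k _ => ?_
    rcases (Fin.succAbove_ne j k).lt_or_gt with h | h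
    · rw [if_neg h.asymm, if_pos h, one_mul]
    · rw [if_neg h.asymm, if_pos h, mul_one]
  rw [← h3]
  ring

/-- The product of the weight function and the coefficient of the shift. -/
noncomputable def shiftKernel (P : Params) {m : ℕ} (z : ℂ) (y : Fin m → ℝ) : ℂ :=
  singleKernel P z *
    (∏ k, (pairKernel P (z * exp (I * y k)) * pairKernel P (z / exp (I * y k)))) * weight P y

theorem shiftKernel_symm (P : Params) {m : ℕ} (z : ℂ) (y : Fin m → ℝ) :
    shiftKernel P (P.q * z)⁻¹ y = shiftKernel P z y := by
  unfold shiftKernel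
  rw [singleKernel_symm]
  congr 2
  refine Finset.prod_congr rfl fun k _ => ?_
  have e1 : (P.q * z)⁻¹ * exp (I * y k) = (P.q * (z / exp (I * y k)))⁻¹ := by
    rw [mul_inv, mul_inv, inv_div, div_eq_mul_inv]; ring
  have e2 : (P.q * z)⁻¹ / exp (I * y k) = (P.q * (z * exp (I * y k)))⁻¹ := by
    rw [mul_inv, mul_inv, mul_inv, div_eq_mul_inv]; ring
  rw [e1, e2, pairKernel_symm, pairKernel_symm, mul_comm]

theorem differentiableAt_shiftKernel {P : Params} (hP : P.Regular) {m : ℕ} {z : ℂ}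
    (h1 : 1 ≤ ‖z‖) (h2 : ‖P.q * z‖ ≤ 1) (y : Fin m → ℝ) :
    DifferentiableAt ℂ (fun z => shiftKernel P z y) z := by
  unfold shiftKernel
  refine ((differentiableAt_singleKernel hP h1 h2).mul
    (DifferentiableAt.fun_finsetProd fun k _ => ?_)).mul_const _
  refine DifferentiableAt.mul ?_ ?_
  · refine DifferentiableAt.comp (f := fun z => z * exp (I * y k)) z
      (differentiableAt_pairKernel hP ?_ ?_) (by fun_prop)
    · rwa [norm_mul_exp]
    · rwa [← mul_assoc, norm_mul_exp]
  · refine DifferentiableAt.comp (f := fun z => z / exp (I * y k)) z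
      (differentiableAt_pairKernel hP ?_ ?_) (by fun_prop)
    · rwa [norm_div, norm_exp_I_mul, div_one]
    · rwa [← mul_div_assoc, norm_div, norm_exp_I_mul, div_one]

/-- The zeros of the weight cancel the poles of the coefficient. The resulting kernel is continuous
on the torus and analytic in the variable being shifted. -/
theorem shiftCoeff_mul_weight {P : Params} (hP : P.Regular) {m : ℕ} (j : Fin (m + 1))
    {x : Fin (m + 1) → ℝ} (hx : IsGeneric x) :
    shiftCoeff P j (torusExp x) * weight P x = shiftKernel P (exp (I * x j)) (j.removeNth x) := by
  have hw : weight P x = weight P (j.removeNth x) *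
      (dB P (x j) * ∏ k, (dA P (x j + x (j.succAbove k)) * dA P (x j - x (j.succAbove k)))) := by
    conv_lhs => rw [← Fin.insertNth_self_removeNth j x]
    rw [weight_insertNth]
    rfl
  rw [hw, shiftCoeff, prod_erase_eq_prod_succAbove, shiftKernel,
    ← dB_mul_eq_singleKernel hP (hx.1 j)]
  have hprod : ∏ k, (pairKernel P (exp (I * x j) * exp (I * j.removeNth x k)) *
        pairKernel P (exp (I * x j) / exp (I * j.removeNth x k))) =
      (∏ k, ((1 - P.t * (torusExp x j * torusExp x (j.succAbove k))) /
        (1 - torusExp x j * torusExp x (j.succAbove k)) *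
      ((1 - P.t * (torusExp x j / torusExp x (j.succAbove k))) /
        (1 - torusExp x j / torusExp x (j.succAbove k))))) *
      ∏ k, (dA P (x j + x (j.succAbove k)) * dA P (x j - x (j.succAbove k))) := by
    rw [← Finset.prod_mul_distrib]
    refine Finset.prod_congr rfl fun k _ => ?_
    have h := hx.2 j (j.succAbove k) (Fin.succAbove_ne j k).symm
    have e1 := dA_mul_eq_pairKernel hP h.1
    have e2 := dA_mul_eq_pairKernel hP h.2
    rw [exp_I_mul_add] at e1
    rw [exp_I_mul_sub] at e2
    simp only [Fin.removeNth]
    rw [← e1, ← e2]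
    simp only [torusExp]
    ring
  rw [hprod]
  simp only [torusExp]
  ring

/-! ### Fubini for the torus -/

theorem torusBox_subset_Icc (n : ℕ) :
    torusBox n ⊆ Set.univ.pi fun _ => Set.Icc (-Real.pi) Real.pi :=
  Set.pi_mono fun _ _ => Set.Ioc_subset_Icc_self

theorem isCompact_Icc_pi (n : ℕ) :
    IsCompact (Set.univ.pi fun _ : Fin n => Set.Icc (-Real.pi) Real.pi) :=
  isCompact_univ_pi fun _ => isCompact_Icc

theorem measurableSet_torusBox (n : ℕ) : MeasurableSet (torusBox n) :=
  MeasurableSet.univ_pi fun _ => measurableSet_Ioc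

theorem _root_.Continuous.integrableOn_torusBox {n : ℕ} {f : (Fin n → ℝ) → ℂ} (hf : Continuous f) :
    IntegrableOn f (torusBox n) :=
  (hf.continuousOn.integrableOn_compact (isCompact_Icc_pi n)).mono_set (torusBox_subset_Icc n)

theorem integral_torusBox_succ {m : ℕ} (j : Fin (m + 1)) {f : (Fin (m + 1) → ℝ) → ℂ}
    (hf : Continuous f) :
    ∫ x in torusBox (m + 1), f x =
      ∫ y in torusBox m, ∫ t in -Real.pi..Real.pi, f (j.insertNth t y) := by
  set e := MeasurableEquiv.piFinSuccAbove (fun _ : Fin (m + 1) => ℝ) j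
  have he : MeasurePreserving e.symm (volume.prod volume) volume :=
    (volume_preserving_piFinSuccAbove (fun _ : Fin (m + 1) => ℝ) j).symm _
  have hpre : e.symm ⁻¹' torusBox (m + 1) = Set.Ioc (-Real.pi) Real.pi ×ˢ torusBox m := by
    ext p
    have : ∀ k, e.symm p k = (j.insertNth p.1 p.2 : Fin (m + 1) → ℝ) k := fun _ => rfl
    simp only [torusBox, Set.mem_preimage, Set.mem_pi, Set.mem_univ, true_imp_iff, this,
      Set.mem_prod]
    rw [Fin.forall_iff_succAbove j]
    simp
  have h1 := he.setIntegral_preimage_emb e.symm.measurableEmbedding f (torusBox (m + 1))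
  rw [hpre, ← setIntegral_prod_swap] at h1
  rw [← h1, setIntegral_prod]
  · refine setIntegral_congr_fun (measurableSet_torusBox m) fun y _ => ?_
    simp only [Prod.swap]
    rw [intervalIntegral.integral_of_le (by linarith [Real.pi_pos])]
    rfl
  · have hc : Continuous fun z : (Fin m → ℝ) × ℝ => f (e.symm z.swap) := by
      refine hf.comp (continuous_pi fun k => ?_)
      have : ∀ z : (Fin m → ℝ) × ℝ, e.symm z.swap k = (j.insertNth z.2 z.1 : Fin (m + 1) → ℝ) k :=
        fun _ => rfl
      simp only [this]
      rcases Fin.eq_self_or_eq_succAbove j k with rfl | ⟨i, rfl⟩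
      · simpa using continuous_snd
      · simp only [Fin.insertNth_apply_succAbove]
        exact (continuous_apply i).comp continuous_fst
    exact (hc.continuousOn.integrableOn_compact ((isCompact_Icc_pi m).prod isCompact_Icc)).mono_set
      (Set.prod_mono (torusBox_subset_Icc m) Set.Ioc_subset_Icc_self)

/-! ### Self-adjointness -/

/-- The bilinear form `∫ f h Δ` on the torus. -/
noncomputable def bilinearIntegral (P : Params) {n : ℕ} (f h : (Fin n → ℝ) → ℂ) : ℂ :=
  ∫ x in torusBox n, f x * h x * weight P x

/-- The integrand of the contribution of the shift in the `j`-th variable. -/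
noncomputable def shiftIntegrand (P : Params) {m : ℕ} (j : Fin (m + 1)) (l l' : Fin (m + 1) → ℤ)
    (x : Fin (m + 1) → ℝ) : ℂ :=
  shiftKernel P (exp (I * x j)) (j.removeNth x) *
    (orbitSum l (Function.update (torusExp x) j (P.q * torusExp x j)) - orbitSum l (torusExp x)) *
    orbitSum l' (torusExp x)

theorem continuous_orbitSum_torusExp {n : ℕ} (l : Fin n → ℤ) :
    Continuous fun x : Fin n → ℝ => orbitSum l (torusExp x) :=
  (continuous_monomial l).congr (monomial_eq l)

theorem continuous_shiftIntegrand {P : Params} (hP : P.Regular) {m : ℕ} (j : Fin (m + 1))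
    (l l' : Fin (m + 1) → ℤ) : Continuous (shiftIntegrand P j l l') := by
  unfold shiftIntegrand
  refine ((?_ : Continuous _).mul (Continuous.sub ?_ (continuous_orbitSum_torusExp l))).mul
    (continuous_orbitSum_torusExp l')
  · unfold shiftKernel
    refine (((continuous_singleKernel_exp hP).comp (continuous_apply j)).mul
      (continuous_finsetProd _ fun k _ => ?_)).mul ((continuous_weight hP m).comp ?_)
    · simp only [← exp_I_mul_add, ← exp_I_mul_sub, Fin.removeNth]
      exact ((continuous_pairKernel_exp hP).comp
        ((continuous_apply j).add (continuous_apply (j.succAbove k)))).mul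
        ((continuous_pairKernel_exp hP).comp
        ((continuous_apply j).sub (continuous_apply (j.succAbove k))))
    · exact continuous_pi fun k => continuous_apply _
  · unfold orbitSum
    simp only [laurentMonomial_update_mul, ← fourierExp_eq]
    exact continuous_finsetSum _ fun m _ => (continuous_fourierExp m).const_mul _

theorem torusExp_insertNth {m : ℕ} (j : Fin (m + 1)) (t : ℝ) (y : Fin m → ℝ) :
    torusExp (j.insertNth t y : Fin (m + 1) → ℝ) = j.insertNth (exp (I * t)) (torusExp y) := by
  funext k
  rcases Fin.eq_self_or_eq_succAbove j k with rfl | ⟨i, rfl⟩ <;> simp [torusExp]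

theorem orbitSum_insertNth_inv {m : ℕ} (j : Fin (m + 1)) (l : Fin (m + 1) → ℤ) (z : ℂ)
    (w : Fin m → ℂ) : orbitSum l (j.insertNth z⁻¹ w) = orbitSum l (j.insertNth z w) := by
  have h := orbitSum_update_inv j l (j.insertNth z w) z
  rwa [Fin.update_insertNth, Fin.update_insertNth] at h

theorem differentiableAt_orbitSum_insertNth {m : ℕ} (j : Fin (m + 1)) (l : Fin (m + 1) → ℤ)
    {z : ℂ} (hz : z ≠ 0) (w : Fin m → ℂ) :
    DifferentiableAt ℂ (fun z => orbitSum l (j.insertNth z w)) z := by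
  unfold orbitSum laurentMonomial
  refine DifferentiableAt.fun_sum fun m _ => ?_
  simp only [Fin.prod_univ_succAbove _ j, Fin.insertNth_apply_same, Fin.insertNth_apply_succAbove]
  exact (differentiableAt_zpow.2 (Or.inl hz)).mul_const _

theorem shiftIntegrand_insertNth (P : Params) {m : ℕ} (j : Fin (m + 1)) (l l' : Fin (m + 1) → ℤ)
    (t : ℝ) (y : Fin m → ℝ) :
    shiftIntegrand P j l l' (j.insertNth t y) = shiftKernel P (exp (I * t)) y *
      (orbitSum l (j.insertNth (P.q * exp (I * t)) (torusExp y)) -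
        orbitSum l (j.insertNth (exp (I * t)) (torusExp y))) *
      orbitSum l' (j.insertNth (exp (I * t)) (torusExp y)) := by
  rw [shiftIntegrand, torusExp_insertNth, Fin.update_insertNth, Fin.insertNth_apply_same,
    Fin.insertNth_apply_same, Fin.removeNth_insertNth]

/-- The shifted term is symmetric in `l` and `l'` by the contour shift with ρ = q; the unshifted
term is visibly so. -/
theorem integral_shiftIntegrand_symm {P : Params} (hP : P.Regular) {m : ℕ} (j : Fin (m + 1))
    (l l' : Fin (m + 1) → ℤ) (y : Fin m → ℝ) :
    ∫ t in -Real.pi..Real.pi, shiftIntegrand P j l l' (j.insertNth t y) =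
      ∫ t in -Real.pi..Real.pi, shiftIntegrand P j l' l (j.insertNth t y) := by
  set ρ : ℝ := Real.exp (-P.β * 1)
  have hρ : P.q = (ρ : ℂ) := rfl
  have h0 : 0 < ρ := Real.exp_pos _
  have h1 : ρ < 1 := Real.exp_lt_one_iff.2 (by linarith [hP.β])
  have hnorm : ∀ z, ‖z‖ ≤ ρ⁻¹ → ‖P.q * z‖ ≤ 1 := fun z hz => by
    rw [hρ, norm_mul, Complex.norm_real, Real.norm_eq_abs, abs_of_pos h0]
    calc ρ * ‖z‖ ≤ ρ * ρ⁻¹ := by gcongr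
      _ = 1 := mul_inv_cancel₀ h0.ne'
  have key := integral_shift_symm h0 h1 (u := fun z => shiftKernel P z y)
    (f := fun z => orbitSum l (j.insertNth z (torusExp y)))
    (h := fun z => orbitSum l' (j.insertNth z (torusExp y)))
    (fun z hz1 hz2 => differentiableAt_shiftKernel hP hz1 (hnorm z hz2) y)
    (fun z hz => differentiableAt_orbitSum_insertNth j l hz _)
    (fun z hz => differentiableAt_orbitSum_insertNth j l' hz _)
    (fun z _ => shiftKernel_symm P z y)
    (fun z => orbitSum_insertNth_inv j l z _) (fun z => orbitSum_insertNth_inv j l' z _)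
  have hu : Continuous fun t : ℝ => shiftKernel P (exp (I * t)) y := by
    rw [continuous_iff_continuousAt]
    intro t
    exact ContinuousAt.comp (f := fun t : ℝ => exp (I * t)) (g := fun z => shiftKernel P z y)
      (differentiableAt_shiftKernel hP (norm_exp_I_mul t).ge
        (norm_q_mul_exp_le_one hP.β t) y).continuousAt (by fun_prop)
  have hf : ∀ (l : Fin (m + 1) → ℤ) (a : ℂ), a ≠ 0 →
      Continuous fun t : ℝ => orbitSum l (j.insertNth (a * exp (I * t)) (torusExp y)) := by
    intro l a ha
    rw [continuous_iff_continuousAt]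
    intro t
    exact ContinuousAt.comp (f := fun t : ℝ => a * exp (I * t))
      (g := fun z => orbitSum l (j.insertNth z (torusExp y)))
      (differentiableAt_orbitSum_insertNth j l (mul_ne_zero ha (exp_ne_zero _)) _).continuousAt
      (by fun_prop)
  have hq := q_ne_zero P
  have hf1 : ∀ (l : Fin (m + 1) → ℤ),
      Continuous fun t : ℝ => orbitSum l (j.insertNth (exp (I * t)) (torusExp y)) := fun l => by
    simpa using hf l 1 one_ne_zero
  have hsplit : ∀ l l' : Fin (m + 1) → ℤ,
      ∫ t in -Real.pi..Real.pi, shiftIntegrand P j l l' (j.insertNth t y) =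
        (∫ t in -Real.pi..Real.pi, shiftKernel P (exp (I * t)) y *
          orbitSum l (j.insertNth (P.q * exp (I * t)) (torusExp y)) *
          orbitSum l' (j.insertNth (exp (I * t)) (torusExp y))) -
        ∫ t in -Real.pi..Real.pi, shiftKernel P (exp (I * t)) y *
          orbitSum l (j.insertNth (exp (I * t)) (torusExp y)) *
          orbitSum l' (j.insertNth (exp (I * t)) (torusExp y)) := fun l l' => by
    refine Eq.trans ?_ (intervalIntegral.integral_sub
      (((hu.mul (hf l _ hq)).mul (hf1 l')).intervalIntegrable _ _)
      (((hu.mul (hf1 l)).mul (hf1 l')).intervalIntegrable _ _))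
    refine intervalIntegral.integral_congr fun t _ => ?_
    rw [shiftIntegrand_insertNth, mul_sub, sub_mul]
  rw [hsplit, hsplit]
  rw [← hρ] at key
  rw [key]
  congr 1
  refine intervalIntegral.integral_congr fun t _ => ?_
  exact mul_right_comm _ _ _

theorem update_insertNth_neg {m : ℕ} (j : Fin (m + 1)) (t : ℝ) (y : Fin m → ℝ) :
    Function.update (j.insertNth t y : Fin (m + 1) → ℝ) j
      (-(j.insertNth t y : Fin (m + 1) → ℝ) j) = j.insertNth (-t) y := by
  rw [Fin.update_insertNth, Fin.insertNth_apply_same]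

theorem weight_update_neg (P : Params) {m : ℕ} (j : Fin (m + 1)) (x : Fin (m + 1) → ℝ) :
    weight P (Function.update x j (-x j)) = weight P x := by
  obtain ⟨t, y, rfl⟩ : ∃ (t : ℝ) (y : Fin m → ℝ), x = j.insertNth t y :=
    ⟨x j, j.removeNth x, (Fin.insertNth_self_removeNth j x).symm⟩
  rw [update_insertNth_neg, weight_insertNth, weight_insertNth, dB_neg]
  congr 2
  refine Finset.prod_congr rfl fun k _ => ?_
  rw [← dA_neg P (-t + y k), ← dA_neg P (-t - y k), mul_comm]
  congr 2 <;> ring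

/-- The weight and the orbit sums are even in x_j, so the inverse shift contributes the reflection
of the integrand of the direct shift. -/
theorem koornwinderOp_mul_weight {P : Params} (hP : P.Regular) {m : ℕ} (l l' : Fin (m + 1) → ℤ)
    {x : Fin (m + 1) → ℝ} (hx : IsGeneric x) :
    koornwinderOp P (orbitSum l) (torusExp x) * monomial l' x * weight P x =
      ∑ j, (shiftIntegrand P j l l' x +
        shiftIntegrand P j l l' (Function.update x j (-x j))) := by
  rw [koornwinderOp, Finset.sum_mul, Finset.sum_mul]
  refine Finset.sum_congr rfl fun j _ => ?_
  have h : ∀ {x : Fin (m + 1) → ℝ}, IsGeneric x →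
      shiftIntegrand P j l l' x =
        shiftTerm P j (orbitSum l) (torusExp x) * monomial l' x * weight P x := fun {x} hx => by
    rw [shiftIntegrand, ← shiftCoeff_mul_weight hP j hx, shiftTerm, monomial_eq]
    ring
  have hmon : monomial l' (Function.update x j (-x j)) = monomial l' x := by
    rw [monomial_eq, monomial_eq, torusExp_update_neg, orbitSum_update_inv,
      Function.update_eq_self]
  rw [h hx, h (hx.update_neg j), weight_update_neg, hmon, ← torusExp_update_neg]
  ring

/-- Koornwinder's operator is symmetric for the bilinear form. -/
theorem bilinearIntegral_koornwinderOp_symm {P : Params} (hP : P.Regular) {n : ℕ}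
    {l l' : Fin n → ℤ} {F G : (Fin n → ℝ) → ℂ}
    (hF : ∀ x, IsGeneric x → F x = koornwinderOp P (orbitSum l) (torusExp x))
    (hG : ∀ x, IsGeneric x → G x = koornwinderOp P (orbitSum l') (torusExp x)) :
    bilinearIntegral P F (monomial l') = bilinearIntegral P (monomial l) G := by
  have hgen : ∀ᵐ x ∂volume.restrict (torusBox n), IsGeneric x :=
    ae_restrict_of_ae (ae_isGeneric n)
  -- For n = 0 the operator is an empty sum; otherwise one variable can be split off.
  rcases n with _ | m
  · have h0 : ∀ {l : Fin 0 → ℤ} {H : (Fin 0 → ℝ) → ℂ},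
        (∀ x, IsGeneric x → H x = koornwinderOp P (orbitSum l) (torusExp x)) →
        ∀ x, IsGeneric x → H x = 0 := fun hH x hx => by
      rw [hH x hx, koornwinderOp, Finset.univ_eq_empty, Finset.sum_empty]
    refine integral_congr_ae ?_
    filter_upwards [hgen] with x hx
    rw [h0 hF x hx, h0 hG x hx]
    ring
  have hneg : ∀ (j : Fin (m + 1)) (l l' : Fin (m + 1) → ℤ), Continuous fun x =>
      shiftIntegrand P j l l' (Function.update x j (-x j)) := fun j l l' =>
    (continuous_shiftIntegrand hP j l l').comp (continuous_id.update j (continuous_apply j).neg)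
  have hswap : ∀ (j : Fin (m + 1)) (l l' : Fin (m + 1) → ℤ),
      ∫ x in torusBox (m + 1), shiftIntegrand P j l l' (Function.update x j (-x j)) =
        ∫ x in torusBox (m + 1), shiftIntegrand P j l l' x := by
    intro j l l'
    have hc := continuous_shiftIntegrand hP j l l'
    rw [integral_torusBox_succ j hc, integral_torusBox_succ j (hneg j l l')]
    refine setIntegral_congr_fun (measurableSet_torusBox m) fun y _ => ?_
    simp only [update_insertNth_neg]
    have := intervalIntegral.integral_comp_neg (a := -Real.pi) (b := Real.pi)
      (fun t : ℝ => shiftIntegrand P j l l' (j.insertNth t y))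
    rwa [neg_neg] at this
  have hmain : ∀ (l l' : Fin (m + 1) → ℤ),
      ∫ x in torusBox (m + 1), koornwinderOp P (orbitSum l) (torusExp x) * monomial l' x *
        weight P x = ∑ j, 2 * ∫ x in torusBox (m + 1), shiftIntegrand P j l l' x := by
    intro l l'
    have hc := fun j => continuous_shiftIntegrand hP j l l'
    rw [integral_congr_ae (g := fun x => ∑ j, (shiftIntegrand P j l l' x +
        shiftIntegrand P j l l' (Function.update x j (-x j))))
      (by filter_upwards [hgen] with x hx using koornwinderOp_mul_weight hP l l' hx),
      integral_finsetSum]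
    · refine Finset.sum_congr rfl fun j _ => ?_
      rw [integral_add (hc j).integrableOn_torusBox
        (hneg j l l').integrableOn_torusBox, hswap, two_mul]
    · intro j _
      exact ((hc j).add (hneg j l l')).integrableOn_torusBox
  have hF' : bilinearIntegral P F (monomial l') = ∫ x in torusBox (m + 1),
      koornwinderOp P (orbitSum l) (torusExp x) * monomial l' x * weight P x := by
    refine integral_congr_ae ?_
    filter_upwards [hgen] with x hx
    rw [hF x hx]
  have hG' : bilinearIntegral P (monomial l) G = ∫ x in torusBox (m + 1),
      koornwinderOp P (orbitSum l') (torusExp x) * monomial l x * weight P x := by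
    refine integral_congr_ae ?_
    filter_upwards [hgen] with x hx
    rw [hG x hx, mul_comm (monomial l x)]
  rw [hF', hG', hmain, hmain]
  refine Finset.sum_congr rfl fun j _ => ?_
  rw [integral_torusBox_succ j (continuous_shiftIntegrand hP j l l'),
    integral_torusBox_succ j (continuous_shiftIntegrand hP j l' l)]
  congr 1
  exact setIntegral_congr_fun (measurableSet_torusBox m) fun y _ =>
    integral_shiftIntegrand_symm hP j l l' y

/-! ### Symmetric trigonometric polynomials as finitely supported coefficient families -/

/-- The type of dominant weights. -/
abbrev DominantWeight (n : ℕ) := {l : Fin n → ℤ // IsDominant l}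

/-- The dominant weights strictly below `l`. -/
abbrev DominantWeight.Lower {n : ℕ} (l : DominantWeight n) :=
  {m : DominantWeight n // WeightLT m.1 l.1}

instance {n : ℕ} (l : DominantWeight n) : Finite l.Lower := by
  have := (finite_setOf_weightLT l.1).to_subtype
  exact Finite.of_injective
    (fun m : l.Lower => (⟨m.1.1, m.1.2, m.2⟩ : {l' | IsDominant l' ∧ WeightLT l' l.1}))
    fun a b h => Subtype.ext (Subtype.ext (congrArg (fun x => x.1) h))

noncomputable instance {n : ℕ} (l : DominantWeight n) : Fintype l.Lower := Fintype.ofFinite _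

/-- The coefficient families supported strictly below `l`. -/
noncomputable def lowerCoeffs {n : ℕ} (l : DominantWeight n) :
    Submodule ℂ (DominantWeight n →₀ ℂ) :=
  Finsupp.supported ℂ ℂ {m | WeightLT m.1 l.1}

/-- The symmetric trigonometric polynomial with given coefficients. -/
noncomputable def trigPoly (n : ℕ) : (DominantWeight n →₀ ℂ) →ₗ[ℂ] (Fin n → ℝ) → ℂ :=
  Finsupp.linearCombination ℂ fun l => monomial l.1

theorem trigPoly_single {n : ℕ} (l : DominantWeight n) (c : ℂ) :
    trigPoly n (Finsupp.single l c) = c • monomial l.1 := Finsupp.linearCombination_single ..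

theorem trigPoly_apply {n : ℕ} (a : DominantWeight n →₀ ℂ) (x : Fin n → ℝ) :
    trigPoly n a x = ∑ l ∈ a.support, a l * monomial l.1 x := by
  simp [trigPoly, Finsupp.linearCombination_apply, Finsupp.sum]

theorem continuous_trigPoly {n : ℕ} (a : DominantWeight n →₀ ℂ) : Continuous (trigPoly n a) := by
  rw [funext (trigPoly_apply a)]
  exact continuous_finsetSum _ fun l _ => (continuous_monomial l.1).const_mul _

theorem mem_lowerSpan_iff {n : ℕ} {l : DominantWeight n} {f : (Fin n → ℝ) → ℂ} :
    f ∈ lowerSpan l.1 ↔ ∃ a ∈ lowerCoeffs l, trigPoly n a = f := by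
  have : monomial '' {l' : Fin n → ℤ | IsDominant l' ∧ WeightLT l' l.1} =
      (fun m : DominantWeight n => monomial m.1) '' {m | WeightLT m.1 l.1} := by
    ext g
    simp [and_assoc, and_left_comm]
  rw [lowerSpan, this, Finsupp.span_image_eq_map_linearCombination, Submodule.mem_map]
  rfl

theorem trigPoly_injective (n : ℕ) : Function.Injective (trigPoly n) := by
  rw [injective_iff_map_eq_zero]
  intro a ha
  classical
  ext l
  by_contra hl
  have hinj : Set.InjOn (Subtype.val : DominantWeight n → Fin n → ℤ) a.support :=
    Subtype.val_injective.injOn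
  have := eq_zero_of_sum_monomial_eq_zero (s := a.support.image Subtype.val)
    (a := fun m => if h : IsDominant m then a ⟨m, h⟩ else 0)
    (fun m hm => by
      obtain ⟨m', -, rfl⟩ := Finset.mem_image.1 hm
      exact m'.2)
    (fun x => by
      rw [Finset.sum_image hinj]
      have hx : trigPoly n a x = 0 := by rw [ha, Pi.zero_apply]
      rw [← hx, trigPoly_apply]
      refine Finset.sum_congr rfl fun m _ => ?_
      rw [dif_pos m.2])
    (Finset.mem_image_of_mem _ (Finsupp.mem_support_iff.2 hl))
  rw [dif_pos l.2] at this
  exact hl this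

theorem trigPoly_periodic {n : ℕ} (a : DominantWeight n →₀ ℂ) (x : Fin n → ℝ) (k : Fin n → ℤ) :
    trigPoly n a (fun j => x j - k j • (2 * Real.pi)) = trigPoly n a x := by
  have : torusExp (fun j => x j - k j • (2 * Real.pi)) = torusExp x := by
    funext j
    simp only [torusExp]
    rw [Complex.exp_eq_exp_iff_exists_int]
    refine ⟨-k j, ?_⟩
    simp only [zsmul_eq_mul]
    push_cast
    ring
  simp only [trigPoly_apply, monomial_eq, this]

/-- Continuity extends the vanishing to the open box and then to its closure, and periodicity to the
whole space. -/
theorem trigPoly_eq_zero_of_ae {n : ℕ} {a : DominantWeight n →₀ ℂ}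
    (h : ∀ᵐ x ∂volume.restrict (torusBox n), trigPoly n a x = 0) : a = 0 := by
  apply trigPoly_injective n
  rw [map_zero]
  set U : Set (Fin n → ℝ) := Set.univ.pi fun _ => Set.Ioo (-Real.pi) Real.pi
  have hU : IsOpen U := isOpen_set_pi Set.finite_univ fun _ _ => isOpen_Ioo
  have hUs : U ⊆ torusBox n := Set.pi_mono fun _ _ => Set.Ioo_subset_Ioc_self
  have h1 : Set.EqOn (trigPoly n a) 0 U :=
    Measure.eqOn_open_of_ae_eq (ae_restrict_of_ae_restrict_of_subset hUs h) hU
      (continuous_trigPoly a).continuousOn continuousOn_const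
  have hcl : closure U = Set.univ.pi fun _ => Set.Icc (-Real.pi) Real.pi := by
    rw [closure_pi_set]
    congr 1
    funext j
    exact closure_Ioo (by linarith [Real.pi_pos])
  have h2 : Set.EqOn (trigPoly n a) 0 (closure U) :=
    h1.closure (continuous_trigPoly a) continuous_const
  funext x
  have hp : (0 : ℝ) < 2 * Real.pi := by positivity
  rw [← trigPoly_periodic a x fun j => toIocDiv hp (-Real.pi) (x j)]
  refine h2 ?_
  rw [hcl]
  intro j _
  have := toIocMod_mem_Ioc hp (-Real.pi) (x j)
  rw [toIocMod, show -Real.pi + 2 * Real.pi = Real.pi by ring] at this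
  exact Set.Ioc_subset_Icc_self this

/-! ### The Gram form -/

theorem integrableOn_mul_weight {P : Params} (hP : P.Nonneg) {n : ℕ} {f : (Fin n → ℝ) → ℂ}
    (hf : Continuous f) : IntegrableOn (fun x => f x * weight P x) (torusBox n) := by
  obtain ⟨C, hC⟩ := exists_norm_weight_le hP.β n
  exact hf.integrableOn_torusBox.mul_bdd (c := C) (measurable_weight P hP.β n).aestronglyMeasurable
    (ae_of_all _ fun x => hC P hP rfl x)

/-- The matrix coefficients of the bilinear form on symmetric monomials. -/
noncomputable def gram (P : Params) {n : ℕ} (l m : DominantWeight n) : ℂ :=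
  bilinearIntegral P (monomial l.1) (monomial m.1)

/-- The bilinear form on coefficient families. -/
noncomputable def gramForm (P : Params) (n : ℕ) :
    (DominantWeight n →₀ ℂ) →ₗ[ℂ] (DominantWeight n →₀ ℂ) →ₗ[ℂ] ℂ :=
  Finsupp.linearCombination ℂ fun l => Finsupp.linearCombination ℂ fun m => gram P l m

theorem gramForm_single (P : Params) {n : ℕ} (l m : DominantWeight n) :
    gramForm P n (Finsupp.single l 1) (Finsupp.single m 1) = gram P l m := by
  simp [gramForm]

theorem gramForm_eq_sum (P : Params) {n : ℕ} (a b : DominantWeight n →₀ ℂ) :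
    gramForm P n a b = ∑ l ∈ a.support, ∑ m ∈ b.support, a l * b m * gram P l m := by
  simp only [gramForm, Finsupp.linearCombination_apply, Finsupp.sum, LinearMap.sum_apply,
    LinearMap.smul_apply, smul_eq_mul, Finset.mul_sum, mul_assoc]

theorem gram_comm (P : Params) {n : ℕ} (l m : DominantWeight n) : gram P l m = gram P m l := by
  unfold gram bilinearIntegral
  simp only [mul_comm (monomial l.1 _)]

theorem bilinearIntegral_trigPoly {P : Params} (hP : P.Nonneg) {n : ℕ}
    (a b : DominantWeight n →₀ ℂ) :
    bilinearIntegral P (trigPoly n a) (trigPoly n b) = gramForm P n a b := by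
  have h : ∀ x, trigPoly n a x * trigPoly n b x * weight P x = ∑ l ∈ a.support, ∑ m ∈ b.support,
      a l * b m * (monomial l.1 x * monomial m.1 x * weight P x) := fun x => by
    rw [trigPoly_apply, trigPoly_apply, Finset.sum_mul_sum, Finset.sum_mul]
    refine Finset.sum_congr rfl fun l _ => ?_
    rw [Finset.sum_mul]
    refine Finset.sum_congr rfl fun m _ => ?_
    ring
  have hint : ∀ l m : DominantWeight n, IntegrableOn (fun x =>
      a l * b m * (monomial l.1 x * monomial m.1 x * weight P x)) (torusBox n) := fun l m =>
    (integrableOn_mul_weight hP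
      ((continuous_monomial l.1).mul (continuous_monomial m.1))).const_mul _
  rw [bilinearIntegral, gramForm_eq_sum]
  simp only [h]
  rw [integral_finsetSum _ fun l _ => integrable_finsetSum _ fun m _ => hint l m]
  refine Finset.sum_congr rfl fun l _ => ?_
  rw [integral_finsetSum _ fun m _ => hint l m]
  refine Finset.sum_congr rfl fun m _ => ?_
  rw [integral_const_mul]
  rfl

/-- Complex conjugation of coefficients. -/
noncomputable def conjCoeffs {n : ℕ} (a : DominantWeight n →₀ ℂ) : DominantWeight n →₀ ℂ :=
  a.mapRange (starRingEnd ℂ) (map_zero _)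

theorem conj_trigPoly {n : ℕ} (a : DominantWeight n →₀ ℂ) (x : Fin n → ℝ) :
    (starRingEnd ℂ) (trigPoly n a x) = trigPoly n (conjCoeffs a) x := by
  have hs : (conjCoeffs a).support = a.support := by
    ext l
    simp [conjCoeffs]
  rw [trigPoly_apply, trigPoly_apply, hs, map_sum]
  refine Finset.sum_congr rfl fun l _ => ?_
  rw [map_mul, conj_monomial]
  rfl

theorem pairing_trigPoly (P : Params) {n : ℕ} (f : (Fin n → ℝ) → ℂ) (b : DominantWeight n →₀ ℂ)
    (x : Fin n → ℝ) :
    pairing P f (trigPoly n b) x = f x * trigPoly n (conjCoeffs b) x * weight P x := by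
  rw [pairing, conj_trigPoly]

theorem innerProd_trigPoly {P : Params} (hP : P.Nonneg) {n : ℕ} (a b : DominantWeight n →₀ ℂ) :
    innerProd P (trigPoly n a) (trigPoly n b) = gramForm P n a (conjCoeffs b) := by
  rw [← bilinearIntegral_trigPoly hP]
  simp only [innerProd, pairing_trigPoly]
  rfl

/-- Positive definiteness: the integrand |f|²Δ is nonnegative, and Δ > 0 at generic points forces f
= 0 almost everywhere. -/
theorem eq_zero_of_gramForm_conj_eq_zero {P : Params} (hP : P.Nonneg) {n : ℕ}
    {a : DominantWeight n →₀ ℂ} (h : gramForm P n a (conjCoeffs a) = 0) : a = 0 := by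
  rw [← innerProd_trigPoly hP] at h
  have hpair : ∀ x, pairing P (trigPoly n a) (trigPoly n a) x =
      ((normSq (trigPoly n a x) * realWeight P x : ℝ) : ℂ) := fun x => by
    rw [pairing, mul_conj, weight_eq_realWeight P hP.β, ofReal_mul]
  simp only [innerProd, hpair] at h
  rw [integral_complex_ofReal, ofReal_eq_zero] at h
  have hint : IntegrableOn (fun x => normSq (trigPoly n a x) * realWeight P x) (torusBox n) := by
    have := integrableOn_mul_weight hP ((continuous_trigPoly a).mul
      (continuous_conj.comp (continuous_trigPoly a)))
    have h2 := this.re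
    refine h2.congr (ae_of_all _ fun x => ?_)
    have := congrArg Complex.re (hpair x)
    rw [ofReal_re] at this
    exact this
  rw [setIntegral_eq_zero_iff_of_nonneg_ae (ae_of_all _ fun x =>
    mul_nonneg (normSq_nonneg _) (realWeight_nonneg P x)) hint] at h
  apply trigPoly_eq_zero_of_ae
  filter_upwards [h, ae_restrict_of_ae (ae_isGeneric n)] with x hx hg
  rcases mul_eq_zero.1 hx with h0 | h0
  · exact normSq_eq_zero.1 h0
  · exact absurd h0 (hP.realWeight_pos hg).ne'

theorem conjCoeffs_mem_lowerCoeffs {n : ℕ} {l : DominantWeight n} {a : DominantWeight n →₀ ℂ}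
    (h : a ∈ lowerCoeffs l) : conjCoeffs a ∈ lowerCoeffs l := by
  rw [lowerCoeffs, Finsupp.mem_supported'] at h ⊢
  intro m hm
  simp [conjCoeffs, h m hm]

theorem gramForm_eq_zero_of_mem_lowerCoeffs {P : Params} {n : ℕ} {l : DominantWeight n}
    {a : DominantWeight n →₀ ℂ}
    (h : ∀ m : DominantWeight n, WeightLT m.1 l.1 → gramForm P n a (Finsupp.single m 1) = 0)
    {b : DominantWeight n →₀ ℂ} (hb : b ∈ lowerCoeffs l) : gramForm P n a b = 0 := by
  rw [lowerCoeffs, Finsupp.supported_eq_span_single] at hb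
  induction hb using Submodule.span_induction with
  | mem b hb =>
    obtain ⟨m, hm, rfl⟩ := hb
    exact h m hm
  | zero => exact map_zero _
  | add b c _ _ hb hc => rw [map_add, hb, hc, add_zero]
  | smul r b _ hb => rw [map_smul, hb, smul_zero]

/-- Such a family is orthogonal to its own conjugate, which is again supported below `l`. -/
theorem eq_zero_of_mem_lowerCoeffs {P : Params} (hP : P.Nonneg) {n : ℕ} {l : DominantWeight n}
    {a : DominantWeight n →₀ ℂ} (ha : a ∈ lowerCoeffs l)
    (h : ∀ m : DominantWeight n, WeightLT m.1 l.1 → gramForm P n a (Finsupp.single m 1) = 0) :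
    a = 0 :=
  eq_zero_of_gramForm_conj_eq_zero hP
    (gramForm_eq_zero_of_mem_lowerCoeffs h (conjCoeffs_mem_lowerCoeffs ha))

/-! ### Koornwinder coefficients -/

/-- The coefficient family of the Koornwinder polynomial. -/
structure IsKoornwinderCoeffs (P : Params) {n : ℕ} (l : DominantWeight n)
    (a : DominantWeight n →₀ ℂ) : Prop where
  sub_single_mem : a - Finsupp.single l 1 ∈ lowerCoeffs l
  orthogonal : ∀ m : DominantWeight n, WeightLT m.1 l.1 →
    gramForm P n a (Finsupp.single m 1) = 0

theorem IsKoornwinderCoeffs.unique {P : Params} (hP : P.Nonneg) {n : ℕ} {l : DominantWeight n}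
    {a b : DominantWeight n →₀ ℂ} (ha : IsKoornwinderCoeffs P l a)
    (hb : IsKoornwinderCoeffs P l b) : a = b := by
  rw [← sub_eq_zero]
  refine eq_zero_of_mem_lowerCoeffs hP (l := l) ?_ fun m hm => ?_
  · rw [← sub_sub_sub_cancel_right a b (Finsupp.single l 1)]
    exact sub_mem ha.sub_single_mem hb.sub_single_mem
  · rw [map_sub, LinearMap.sub_apply, ha.orthogonal m hm, hb.orthogonal m hm, sub_zero]

theorem conj_gram {P : Params} (hP : P.Nonneg) {n : ℕ} (l m : DominantWeight n) :
    (starRingEnd ℂ) (gram P l m) = gram P l m := by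
  unfold gram bilinearIntegral
  rw [← integral_conj]
  refine integral_congr_ae (ae_of_all _ fun x => ?_)
  simp only [map_mul, conj_monomial, weight_eq_realWeight P hP.β, conj_ofReal]

theorem gramForm_conjCoeffs {P : Params} (hP : P.Nonneg) {n : ℕ} (a : DominantWeight n →₀ ℂ)
    (m : DominantWeight n) : gramForm P n (conjCoeffs a) (Finsupp.single m 1) =
      (starRingEnd ℂ) (gramForm P n a (Finsupp.single m 1)) := by
  have hs : (conjCoeffs a).support = a.support := by
    ext l
    simp [conjCoeffs]
  rw [gramForm_eq_sum, gramForm_eq_sum, hs, map_sum]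
  refine Finset.sum_congr rfl fun l _ => ?_
  rw [map_sum]
  refine Finset.sum_congr rfl fun k hk => ?_
  rw [map_mul, map_mul, conj_gram hP]
  congr 2
  by_cases h : m = k
  · simp [h]
  · simp [h]

/-- The Gram matrix is real, so conjugation preserves the defining conditions, and uniqueness
applies. Thus the inner product of two Koornwinder polynomials equals their bilinear pairing. -/
theorem IsKoornwinderCoeffs.conj_eq {P : Params} (hP : P.Nonneg) {n : ℕ} {l : DominantWeight n}
    {a : DominantWeight n →₀ ℂ} (ha : IsKoornwinderCoeffs P l a) : conjCoeffs a = a := by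
  refine IsKoornwinderCoeffs.unique hP ⟨?_, fun m hm => ?_⟩ ha
  · have : conjCoeffs a - Finsupp.single l 1 = conjCoeffs (a - Finsupp.single l 1) := by
      ext k
      by_cases h : l = k
      · simp [conjCoeffs, h]
      · simp [conjCoeffs, h]
    rw [this]
    exact conjCoeffs_mem_lowerCoeffs ha.sub_single_mem
  · rw [gramForm_conjCoeffs hP, ha.orthogonal m hm, map_zero]

theorem conjCoeffs_single {n : ℕ} (m : DominantWeight n) :
    conjCoeffs (Finsupp.single m 1) = Finsupp.single m 1 := by
  simp [conjCoeffs]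

theorem isKoornwinderPolynomial_iff {P : Params} (hP : P.Nonneg) {n : ℕ} {l : DominantWeight n}
    {p : (Fin n → ℝ) → ℂ} : IsKoornwinderPolynomial P l.1 p ↔
      ∃ a, IsKoornwinderCoeffs P l a ∧ trigPoly n a = p := by
  have horth : ∀ (a : DominantWeight n →₀ ℂ) (m : DominantWeight n),
      innerProd P (trigPoly n a) (monomial m.1) = gramForm P n a (Finsupp.single m 1) :=
    fun a m => by
      rw [← conjCoeffs_single m, ← innerProd_trigPoly hP, trigPoly_single, one_smul]
  constructor
  · rintro ⟨h1, h2⟩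
    obtain ⟨c, hc, hcp⟩ := mem_lowerSpan_iff.1 h1
    have hp : trigPoly n (Finsupp.single l 1 + c) = p := by
      rw [map_add, trigPoly_single, one_smul, hcp, add_sub_cancel]
    refine ⟨Finsupp.single l 1 + c, ⟨by rwa [add_sub_cancel_left], fun m hm => ?_⟩, hp⟩
    rw [← horth, hp]
    exact h2 m.1 m.2 hm
  · rintro ⟨a, ha, rfl⟩
    refine ⟨mem_lowerSpan_iff.2 ⟨_, ha.sub_single_mem, ?_⟩, fun m hm hml => ?_⟩
    · rw [map_sub, trigPoly_single, one_smul]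
    · rw [horth a ⟨m, hm⟩]
      exact ha.orthogonal ⟨m, hm⟩ hml

/-! ### Orthogonality for separated eigenvalues -/

theorem lowerCoeffs_mono {n : ℕ} {l m : DominantWeight n} (h : WeightLT m.1 l.1) :
    lowerCoeffs m ≤ lowerCoeffs l :=
  Finsupp.supported_mono fun _ hk => WeightLT.trans_le hk h.1

theorem single_mem_lowerCoeffs {n : ℕ} {l m : DominantWeight n} (h : WeightLT m.1 l.1) (c : ℂ) :
    Finsupp.single m c ∈ lowerCoeffs l := Finsupp.single_mem_supported ℂ c h

/-- Koornwinder's operator acts on the coefficients by a triangular symmetric operator. -/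
theorem exists_symmetric_triangular {P : Params} (hP : P.Regular) (n : ℕ) :
    ∃ D : (DominantWeight n →₀ ℂ) →ₗ[ℂ] (DominantWeight n →₀ ℂ),
      (∀ l, D (Finsupp.single l 1) - eigenvalue P l.1 • Finsupp.single l 1 ∈ lowerCoeffs l) ∧
      ∀ a b, gramForm P n (D a) b = gramForm P n a (D b) := by
  have hex : ∀ l : DominantWeight n, ∃ a ∈ lowerCoeffs l, ∀ x : Fin n → ℝ, IsGeneric x →
      trigPoly n (eigenvalue P l.1 • Finsupp.single l 1 + a) x =
        koornwinderOp P (orbitSum l.1) (torusExp x) := fun l => by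
    obtain ⟨h, hh, hx⟩ := exists_koornwinderOp_eq_lower hP l.2
    obtain ⟨a, ha, rfl⟩ := mem_lowerSpan_iff.1 hh
    refine ⟨a, ha, fun x hg => ?_⟩
    rw [hx x hg, map_add, map_smul, trigPoly_single, one_smul]
    rfl
  choose d hd hdx using hex
  refine ⟨Finsupp.linearCombination ℂ fun l => eigenvalue P l.1 • Finsupp.single l 1 + d l,
    fun l => ?_, fun a b => ?_⟩
  · rw [Finsupp.linearCombination_single, one_smul, add_sub_cancel_left]
    exact hd l
  · set D := Finsupp.linearCombination ℂ fun l : DominantWeight n =>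
      eigenvalue P l.1 • Finsupp.single l (1 : ℂ) + d l with hD
    have key : (gramForm P n).comp D = (gramForm P n).compl₂ D := by
      ext l m
      simp only [LinearMap.comp_apply, LinearMap.compl₂_apply, Finsupp.lsingle_apply]
      rw [← bilinearIntegral_trigPoly hP.toNonneg, ← bilinearIntegral_trigPoly hP.toNonneg,
        trigPoly_single, trigPoly_single, one_smul, one_smul]
      refine bilinearIntegral_koornwinderOp_symm hP (fun x hx => ?_) fun x hx => ?_
      · rw [hD, Finsupp.linearCombination_single, one_smul, hdx l x hx]
      · rw [hD, Finsupp.linearCombination_single, one_smul, hdx m x hx]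
    exact congrArg (fun f => f a b) key

/-- By triangularity Da - Ea is supported below l; by symmetry it is orthogonal to everything below
l, since D preserves that span. Hence Da = Ea, and distinct eigenvalues give orthogonality. -/
theorem IsKoornwinderCoeffs.gramForm_eq_zero {P : Params} (hP : P.Regular) {n : ℕ}
    {l l' : DominantWeight n} (hne : eigenvalue P l.1 ≠ eigenvalue P l'.1)
    {a a' : DominantWeight n →₀ ℂ} (ha : IsKoornwinderCoeffs P l a)
    (ha' : IsKoornwinderCoeffs P l' a') : gramForm P n a a' = 0 := by
  obtain ⟨D, hD, hsymm⟩ := exists_symmetric_triangular hP n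
  have hlow : ∀ l : DominantWeight n, ∀ b ∈ lowerCoeffs l, D b ∈ lowerCoeffs l := by
    intro l b hb
    rw [lowerCoeffs, Finsupp.supported_eq_span_single] at hb
    induction hb using Submodule.span_induction with
    | mem b hb =>
      obtain ⟨m, hm, rfl⟩ := hb
      have := lowerCoeffs_mono hm (hD m)
      rw [← sub_add_cancel (D _) (eigenvalue P m.1 • Finsupp.single m 1)]
      exact add_mem this (Submodule.smul_mem _ _ (single_mem_lowerCoeffs hm 1))
    | zero => rw [map_zero]; exact zero_mem _
    | add b c _ _ hb hc => rw [map_add]; exact add_mem hb hc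
    | smul r b _ hb => rw [map_smul]; exact Submodule.smul_mem _ _ hb
  have heig : ∀ (l : DominantWeight n) (a), IsKoornwinderCoeffs P l a →
      D a = eigenvalue P l.1 • a := by
    intro l a ha
    rw [← sub_eq_zero]
    refine eq_zero_of_mem_lowerCoeffs hP.toNonneg (l := l) ?_ fun m hm => ?_
    · have e : D a - eigenvalue P l.1 • a =
          (D (Finsupp.single l 1) - eigenvalue P l.1 • Finsupp.single l 1) +
          (D (a - Finsupp.single l 1) - eigenvalue P l.1 • (a - Finsupp.single l 1)) := by
        rw [map_sub, smul_sub]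
        abel
      rw [e]
      exact add_mem (hD l) (sub_mem (hlow l _ ha.sub_single_mem) (Submodule.smul_mem _ _ ha.sub_single_mem))
    · rw [map_sub, LinearMap.sub_apply, hsymm, map_smul, LinearMap.smul_apply,
        ha.orthogonal m hm, gramForm_eq_zero_of_mem_lowerCoeffs ha.orthogonal
          (hlow l _ (single_mem_lowerCoeffs hm 1)), smul_zero, sub_zero]
  have h := hsymm a a'
  rw [heig l a ha, heig l' a' ha', map_smul, map_smul, LinearMap.smul_apply, smul_eq_mul,
    smul_eq_mul] at h
  by_contra h0
  exact hne (mul_right_cancel₀ h0 h)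

/-! ### Existence of the Koornwinder polynomials -/

/-- The Gram matrix of the monomials below `l`. -/
noncomputable def gramMatrix (P : Params) {n : ℕ} (l : DominantWeight n) :
    Matrix l.Lower l.Lower ℂ := Matrix.of fun m k => gram P m.1 k.1

/-- The lower coefficients of the Koornwinder polynomial. -/
noncomputable def subleadingCoeff (P : Params) {n : ℕ} (l : DominantWeight n) : l.Lower → ℂ :=
  -((gramMatrix P l)⁻¹.mulVec fun m => gram P m.1 l)

/-- The family with leading coefficient one at `l` and given lower coefficients. -/
noncomputable def coeffsOf {n : ℕ} (l : DominantWeight n) (r : ℂ) (c : l.Lower → ℂ) :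
    DominantWeight n →₀ ℂ := r • Finsupp.single l 1 + ∑ m, c m • Finsupp.single m.1 1

theorem coeffsOf_sub_mem {n : ℕ} (l : DominantWeight n) (r : ℂ) (c : l.Lower → ℂ) :
    coeffsOf l r c - r • Finsupp.single l 1 ∈ lowerCoeffs l := by
  rw [coeffsOf, add_sub_cancel_left]
  exact sum_mem fun m _ => Submodule.smul_mem _ _ (single_mem_lowerCoeffs m.2 1)

theorem gramForm_coeffsOf (P : Params) {n : ℕ} (l : DominantWeight n) (r : ℂ) (c : l.Lower → ℂ)
    (m : l.Lower) : gramForm P n (coeffsOf l r c) (Finsupp.single m.1 1) =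
      r * gram P m.1 l + (gramMatrix P l).mulVec c m := by
  simp only [coeffsOf, map_add, map_smul, map_sum, LinearMap.add_apply, LinearMap.smul_apply,
    LinearMap.sum_apply, gramForm_single, smul_eq_mul, Matrix.mulVec, dotProduct, gramMatrix,
    Matrix.of_apply]
  rw [gram_comm]
  congr 1
  refine Finset.sum_congr rfl fun k _ => ?_
  rw [mul_comm, gram_comm]

/-- A kernel vector gives a combination of lower monomials (leading coefficient `r = 0`) orthogonal
to all of them, which must vanish. -/
theorem isUnit_gramMatrix {P : Params} (hP : P.Nonneg) {n : ℕ} (l : DominantWeight n) :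
    IsUnit (gramMatrix P l) := by
  rw [← Matrix.mulVec_injective_iff_isUnit, ← Matrix.coe_mulVecLin, injective_iff_map_eq_zero]
  intro c hc
  rw [Matrix.mulVecLin_apply] at hc
  have h0 : coeffsOf l 0 c = 0 := by
    refine eq_zero_of_mem_lowerCoeffs hP (l := l) ?_ fun m hm => ?_
    · have := coeffsOf_sub_mem l 0 c
      rwa [zero_smul, sub_zero] at this
    · rw [gramForm_coeffsOf P l 0 c ⟨m, hm⟩, hc, zero_mul, Pi.zero_apply, add_zero]
  funext m
  have := DFunLike.congr_fun h0 m.1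
  rw [coeffsOf, zero_smul, zero_add, Finsupp.finsetSum_apply,
    Finset.sum_eq_single m (fun k _ hk => ?_) (by simp)] at this
  · simpa using this
  · simp [Subtype.val_injective.ne hk]

theorem isKoornwinderCoeffs_coeffsOf {P : Params} (hP : P.Nonneg) {n : ℕ} (l : DominantWeight n) :
    IsKoornwinderCoeffs P l (coeffsOf l 1 (subleadingCoeff P l)) := by
  refine ⟨?_, fun m hm => ?_⟩
  · have := coeffsOf_sub_mem l 1 (subleadingCoeff P l)
    rwa [one_smul] at this
  · rw [gramForm_coeffsOf P l 1 _ ⟨m, hm⟩, subleadingCoeff, Matrix.mulVec_neg,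
      Matrix.mulVec_mulVec, Matrix.mul_nonsing_inv _
        ((Matrix.isUnit_iff_isUnit_det _).1 (isUnit_gramMatrix hP l)), Matrix.one_mulVec,
      one_mul, Pi.neg_apply, add_neg_cancel]

/-! ### Continuity in the parameters -/

/-- Dominated convergence: the bound on the weight depends only on β, and convergence holds at
generic points. -/
theorem ParamsTendsto.gram {u : ℕ → Params} {P : Params} (h : ParamsTendsto u P) (hP : P.Nonneg)
    (hu : ∀ k, (u k).Nonneg) {n : ℕ} (l m : DominantWeight n) :
    Tendsto (fun k => gram (u k) l m) atTop (𝓝 (gram P l m)) := by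
  obtain ⟨C, hC⟩ := exists_norm_weight_le hP.β n
  have hc : Continuous fun x => monomial l.1 x * monomial m.1 x :=
    (continuous_monomial l.1).mul (continuous_monomial m.1)
  refine tendsto_integral_of_dominated_convergence (fun x => ‖monomial l.1 x * monomial m.1 x‖ * C)
    (fun k => ?_) ?_ (fun k => ae_of_all _ fun x => ?_) ?_
  · exact (hc.measurable.mul (measurable_weight (u k) (hu k).β n)).aestronglyMeasurable
  · exact (hc.integrableOn_torusBox.norm).mul_const C
  · rw [norm_mul]
    gcongr
    exact hC _ (hu k) (h.β k) x
  · filter_upwards [ae_restrict_of_ae (ae_isGeneric n)] with x hx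
    exact (h.weight hP hx).const_mul _

theorem ParamsTendsto.subleadingCoeff {u : ℕ → Params} {P : Params} (h : ParamsTendsto u P)
    (hP : P.Nonneg) (hu : ∀ k, (u k).Nonneg) {n : ℕ} (l : DominantWeight n) :
    Tendsto (fun k => subleadingCoeff (u k) l) atTop (𝓝 (subleadingCoeff P l)) := by
  have hM : Tendsto (fun k => gramMatrix (u k) l) atTop (𝓝 (gramMatrix P l)) :=
    tendsto_pi_nhds.2 fun m => tendsto_pi_nhds.2 fun k => h.gram hP hu m.1 k.1
  have hv : Tendsto (fun k => fun m : l.Lower => Koornwinder.gram (u k) m.1 l) atTop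
      (𝓝 fun m : l.Lower => Koornwinder.gram P m.1 l) :=
    tendsto_pi_nhds.2 fun m => h.gram hP hu m.1 l
  have hdet : (gramMatrix P l).det ≠ 0 :=
    ((Matrix.isUnit_iff_isUnit_det _).1 (isUnit_gramMatrix hP l)).ne_zero
  have hinv : Tendsto (fun k => (gramMatrix (u k) l)⁻¹) atTop (𝓝 (gramMatrix P l)⁻¹) := by
    -- Cramer's formula makes the inverse continuous where the limiting determinant is nonzero.
    simp only [Matrix.inv_def, Ring.inverse_eq_inv']
    exact ((((continuous_id.matrix_det).tendsto _).comp hM).inv₀ hdet).smul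
      (((continuous_id.matrix_adjugate).tendsto _).comp hM)
  have hmul : Continuous fun p : Matrix l.Lower l.Lower ℂ × (l.Lower → ℂ) => p.1.mulVec p.2 :=
    continuous_fst.matrix_mulVec continuous_snd
  exact ((hmul.tendsto _).comp (hinv.prodMk_nhds hv)).neg

theorem ParamsTendsto.gramForm {u : ℕ → Params} {P : Params} (h : ParamsTendsto u P)
    (hP : P.Nonneg) (hu : ∀ k, (u k).Nonneg) {n : ℕ} (l l' : DominantWeight n) :
    Tendsto (fun k => Koornwinder.gramForm (u k) n
        (coeffsOf l 1 (Koornwinder.subleadingCoeff (u k) l))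
        (coeffsOf l' 1 (Koornwinder.subleadingCoeff (u k) l'))) atTop
      (𝓝 (Koornwinder.gramForm P n (coeffsOf l 1 (Koornwinder.subleadingCoeff P l))
        (coeffsOf l' 1 (Koornwinder.subleadingCoeff P l')))) := by
  have hc := fun l : DominantWeight n => tendsto_pi_nhds.1 (h.subleadingCoeff hP hu l)
  have hg := fun l m : DominantWeight n => h.gram hP hu l m
  simp only [coeffsOf, map_add, map_smul, map_sum, LinearMap.add_apply, LinearMap.smul_apply,
    LinearMap.sum_apply, gramForm_single, smul_eq_mul, one_mul]
  refine ((hg _ _).add (tendsto_finsetSum _ fun m _ => (hc l m).mul (hg _ _))).add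
    (tendsto_finsetSum _ fun m _ => (hc l' m).mul
      ((hg _ _).add (tendsto_finsetSum _ fun k _ => (hc l k).mul (hg _ _))))

/-! ### Separation of the eigenvalues -/

theorem exists_mem_Ioo_notMem_of_injective {f : ℝ → ℂ} (hf : Function.Injective f) {S : Set ℂ}
    (hS : S.Finite) {r : ℝ} (hr : 0 < r) : ∃ ε ∈ Set.Ioo 0 r, f ε ∉ S := by
  obtain ⟨ε, h1, h2⟩ := (Set.Ioo_infinite hr).exists_notMem_finite (hS.preimage hf.injOn)
  exact ⟨ε, h1, h2⟩

theorem qpow_injective {P : Params} (hβ : 0 < P.β) : Function.Injective P.qpow := by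
  intro a b h
  have : -P.β * a = -P.β * b := Real.exp_injective (ofReal_injective h)
  exact mul_left_cancel₀ (neg_ne_zero.2 hβ.ne') this

theorem q_zpow (P : Params) (k : ℤ) : P.q ^ k = P.qpow k := by
  rw [Params.q, Params.qpow, Params.qpow, ofReal_exp, ofReal_exp, ← Complex.exp_int_mul]
  congr 1
  push_cast
  ring

/-- The parameters obtained by increasing `g`, `g₀` and `g₁`. -/
noncomputable def Params.raise (P : Params) (ε δ η : ℝ) : Params :=
  ⟨P.β, P.g + ε, P.g₀ + δ, P.g₁ + η, P.g₀', P.g₁'⟩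

theorem prod_ite_lt {n : ℕ} (j : Fin n) (t : ℂ) :
    (∏ k ∈ Finset.univ.erase j, if k < j then t else 1) = t ^ (j : ℕ) := by
  rw [← Finset.prod_filter, Finset.prod_const]
  congr 1
  rw [← Fin.card_Iio j]
  congr 1
  ext k
  simp only [Finset.mem_filter, Finset.mem_erase, Finset.mem_univ, and_true, Finset.mem_Iio]
  exact ⟨fun h => h.2, fun h => ⟨h.ne, h⟩⟩

/-- At fixed g, g₁ the difference of the eigenvalues is affine in q^{g₀}, with constant term a
polynomial R evaluated at t = q^g. First g is moved so that R(t) ≠ 0, then g₀ so that the affine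
function does not vanish. -/
theorem exists_eigenvalue_ne {P : Params} (hβ : 0 < P.β) {n : ℕ} {l l' : Fin n → ℤ} (h : l ≠ l')
    (η : ℝ) {r : ℝ} (hr : 0 < r) : ∃ ε ∈ Set.Ioo 0 r, ∃ δ ∈ Set.Ioo 0 r,
      eigenvalue (P.raise ε δ η) l ≠ eigenvalue (P.raise ε δ η) l' := by
  -- These are the contributions of the inverse shifts: the coefficient of T_j⁻¹ tends to t^j, with
  -- j counted from 0. As q is not a root of unity, R ≠ 0 for distinct weights.
  set R : Polynomial ℂ := ∑ j : Fin n,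
    Polynomial.C (P.q ^ (-l j) - P.q ^ (-l' j)) * Polynomial.X ^ (j : ℕ) with hR
  have hR0 : R ≠ 0 := by
    obtain ⟨j, hj⟩ := Function.ne_iff.1 h
    intro h0
    have hc : R.coeff j = P.q ^ (-l j) - P.q ^ (-l' j) := by
      rw [hR, Polynomial.finsetSum_coeff, Finset.sum_eq_single j]
      · rw [Polynomial.coeff_C_mul_X_pow, if_pos rfl]
      · intro k _ hk
        rw [Polynomial.coeff_C_mul_X_pow, if_neg fun e => hk (Fin.ext e.symm)]
      · simp
    rw [h0, Polynomial.coeff_zero, q_zpow, q_zpow, eq_comm, sub_eq_zero] at hc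
    have := qpow_injective hβ hc
    exact hj (neg_injective (Int.cast_injective this))
  have hinj : ∀ a : ℝ, Function.Injective fun ε => P.qpow (a + ε) := fun a =>
    (qpow_injective hβ).comp (add_right_injective a)
  obtain ⟨ε, hε, hεR⟩ := exists_mem_Ioo_notMem_of_injective (hinj P.g)
    (R.roots.toFinset.finite_toSet) hr
  have hRt : R.eval (P.qpow (P.g + ε)) ≠ 0 := fun h0 =>
    hεR (by simpa [hR0] using h0)
  set t : ℂ := P.qpow (P.g + ε)
  set A : (Fin n → ℤ) → ℂ := fun l => ∑ j, (∏ k ∈ Finset.univ.erase j,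
    (t * if j < k then t else 1)) * (P.q ^ l j - 1)
  set b : ℂ := -P.qpow (P.g₁ + η) * P.qpow (P.g₀' + 1 / 2) * -P.qpow (P.g₁' + 1 / 2) / P.q
  have hb : b ≠ 0 := by
    refine div_ne_zero (mul_ne_zero (mul_ne_zero (neg_ne_zero.2 (qpow_ne_zero P _))
      (qpow_ne_zero P _)) (neg_ne_zero.2 (qpow_ne_zero P _))) (q_ne_zero P)
  have heig : ∀ (δ : ℝ) (l : Fin n → ℤ), eigenvalue (P.raise ε δ η) l =
      P.qpow (P.g₀ + δ) * b * A l + ∑ j : Fin n, t ^ (j : ℕ) * (P.q ^ (-l j) - 1) := by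
    intro δ l
    have ht : (P.raise ε δ η).t = t := rfl
    have hq : (P.raise ε δ η).q = P.q := rfl
    have hc : (∏ i, (P.raise ε δ η).coef i) / P.q = P.qpow (P.g₀ + δ) * b := by
      rw [Fin.prod_univ_four]
      change P.qpow (P.g₀ + δ) * -P.qpow (P.g₁ + η) * P.qpow (P.g₀' + 1 / 2) *
        -P.qpow (P.g₁' + 1 / 2) / P.q = _
      ring
    rw [eigenvalue, ht, hq, hc, Finset.sum_add_distrib, Finset.mul_sum]
    simp only [prod_ite_lt, mul_assoc]
  have hdiff : ∀ δ : ℝ, eigenvalue (P.raise ε δ η) l - eigenvalue (P.raise ε δ η) l' =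
      P.qpow (P.g₀ + δ) * (b * (A l - A l')) + R.eval t := by
    intro δ
    have : R.eval t = (∑ j : Fin n, t ^ (j : ℕ) * (P.q ^ (-l j) - 1)) -
        ∑ j : Fin n, t ^ (j : ℕ) * (P.q ^ (-l' j) - 1) := by
      rw [hR, Polynomial.eval_finsetSum, ← Finset.sum_sub_distrib]
      refine Finset.sum_congr rfl fun j _ => ?_
      rw [Polynomial.eval_mul, Polynomial.eval_C, Polynomial.eval_pow, Polynomial.eval_X]
      ring
    rw [heig, heig, this]
    ring
  -- The only zero of the affine function is excluded. When the slope vanishes this value is the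
  -- default 0 and plays no role; R(t) ≠ 0 then suffices.
  obtain ⟨δ, hδ, hδS⟩ := exists_mem_Ioo_notMem_of_injective (hinj P.g₀)
    (Set.finite_singleton (-R.eval t / (b * (A l - A l')))) hr
  refine ⟨ε, hε, δ, hδ, fun heq => ?_⟩
  have h0 := hdiff δ
  rw [heq, sub_self] at h0
  rcases eq_or_ne (A l - A l') 0 with hA | hA
  · rw [hA, mul_zero, mul_zero, zero_add] at h0
    exact hRt h0.symm
  · refine hδS ?_
    rw [Set.mem_singleton_iff, eq_div_iff (mul_ne_zero hb hA)]
    linear_combination -h0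

theorem exists_regular_approximation {P : Params} (hP : P.Nonneg) {n : ℕ} {l l' : Fin n → ℤ}
    (h : l ≠ l') : ∃ u : ℕ → Params, (∀ k, (u k).Regular) ∧ ParamsTendsto u P ∧
      ∀ k, eigenvalue (u k) l ≠ eigenvalue (u k) l' := by
  have hpos : ∀ k : ℕ, (0 : ℝ) < 1 / (k + 1) := fun k => Nat.one_div_pos_of_nat
  choose ε hε δ hδ hne using fun k : ℕ =>
    exists_eigenvalue_ne hP.β h (1 / ((k : ℝ) + 1)) (hpos k)
  have h0 : Tendsto (fun k : ℕ => 1 / ((k : ℝ) + 1)) atTop (𝓝 0) :=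
    tendsto_one_div_add_atTop_nhds_zero_nat
  have hlim : ∀ {v : ℕ → ℝ}, (∀ k : ℕ, v k ∈ Set.Ioo 0 (1 / ((k : ℝ) + 1))) → ∀ a : ℝ,
      Tendsto (fun k => a + v k) atTop (𝓝 a) := fun {v} hv a => by
    have := (squeeze_zero (fun k => (hv k).1.le) (fun k => (hv k).2.le) h0).const_add a
    rwa [add_zero] at this
  refine ⟨fun k => P.raise (ε k) (δ k) (1 / ((k : ℝ) + 1)), fun k => ?_, ?_, hne⟩
  · exact
      { β := hP.β
        g := add_nonneg hP.g (hε k).1.le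
        g₀ := add_nonneg hP.g₀ (hδ k).1.le
        g₁ := add_nonneg hP.g₁ (hpos k).le
        g₀' := hP.g₀'
        g₁' := hP.g₁'
        g_pos := add_pos_of_nonneg_of_pos hP.g (hε k).1
        g₀_pos := add_pos_of_nonneg_of_pos hP.g₀ (hδ k).1
        g₁_pos := add_pos_of_nonneg_of_pos hP.g₁ (hpos k) }
  · exact
      { β := fun _ => rfl
        g := hlim hε P.g
        g₀ := hlim hδ P.g₀
        g₁ := (add_zero P.g₁ ▸ h0.const_add P.g₁ : _)
        g₀' := tendsto_const_nhds
        g₁' := tendsto_const_nhds }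

/-- The approximating parameters depend on the pair of weights, which is harmless since
orthogonality is proved one pair at a time. -/
theorem IsKoornwinderCoeffs.gramForm_eq_zero_of_ne {P : Params} (hP : P.Nonneg) {n : ℕ}
    {l l' : DominantWeight n} (hne : l ≠ l') {a a' : DominantWeight n →₀ ℂ}
    (ha : IsKoornwinderCoeffs P l a) (ha' : IsKoornwinderCoeffs P l' a') :
    gramForm P n a a' = 0 := by
  obtain ⟨u, hu, hlim, heig⟩ := exists_regular_approximation hP (Subtype.val_injective.ne hne)
  rw [ha.unique hP (isKoornwinderCoeffs_coeffsOf hP l),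
    ha'.unique hP (isKoornwinderCoeffs_coeffsOf hP l')]
  refine tendsto_nhds_unique (hlim.gramForm hP (fun k => (hu k).toNonneg) l l') ?_
  refine tendsto_const_nhds.congr fun k => ?_
  exact ((isKoornwinderCoeffs_coeffsOf (hu k).toNonneg l).gramForm_eq_zero (hu k) (heig k)
    (isKoornwinderCoeffs_coeffsOf (hu k).toNonneg l')).symm

end Koornwinder

theorem mainTheorem7 (n : ℕ) (P : Koornwinder.Params) (hβ : 0 < P.β)
    (hg : 0 ≤ P.g) (hg₀ : 0 ≤ P.g₀) (hg₁ : 0 ≤ P.g₁) (hg₀' : 0 ≤ P.g₀') (hg₁' : 0 ≤ P.g₁') :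
    (∀ l : Fin n → ℤ, Koornwinder.IsDominant l →
      ∃! p : (Fin n → ℝ) → ℂ, Koornwinder.IsKoornwinderPolynomial P l p) ∧
    (∀ l l' : Fin n → ℤ, Koornwinder.IsDominant l → Koornwinder.IsDominant l' → l ≠ l' →
      ∀ p p' : (Fin n → ℝ) → ℂ,
        Koornwinder.IsKoornwinderPolynomial P l p →
        Koornwinder.IsKoornwinderPolynomial P l' p' →
          MeasureTheory.IntegrableOn (Koornwinder.pairing P p p') (Koornwinder.torusBox n) ∧
          Koornwinder.innerProd P p p' = 0) := by
  have hP : P.Nonneg := ⟨hβ, hg, hg₀, hg₁, hg₀', hg₁'⟩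
  refine ⟨fun l hl => ?_, fun l l' hl hl' hne p p' hp hp' => ?_⟩
  · refine ⟨_, (Koornwinder.isKoornwinderPolynomial_iff hP (l := ⟨l, hl⟩)).2
      ⟨_, Koornwinder.isKoornwinderCoeffs_coeffsOf hP _, rfl⟩, fun p hp => ?_⟩
    obtain ⟨a, ha, rfl⟩ := (Koornwinder.isKoornwinderPolynomial_iff hP (l := ⟨l, hl⟩)).1 hp
    rw [ha.unique hP (Koornwinder.isKoornwinderCoeffs_coeffsOf hP _)]
  · obtain ⟨a, ha, rfl⟩ := (Koornwinder.isKoornwinderPolynomial_iff hP (l := ⟨l, hl⟩)).1 hp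
    obtain ⟨b, hb, rfl⟩ := (Koornwinder.isKoornwinderPolynomial_iff hP (l := ⟨l', hl'⟩)).1 hp'
    refine ⟨?_, ?_⟩
    · have := Koornwinder.integrableOn_mul_weight hP ((Koornwinder.continuous_trigPoly a).mul
        (Koornwinder.continuous_trigPoly (Koornwinder.conjCoeffs b)))
      rwa [funext (Koornwinder.pairing_trigPoly P _ b)]
    · rw [Koornwinder.innerProd_trigPoly hP, hb.conj_eq hP]
      exact ha.gramForm_eq_zero_of_ne hP (fun h => hne (congrArg Subtype.val h)) hb
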